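/- Let $(M,c,D)$ be a Weyl space of dimension $m\geq 3$, that is, a smooth manifold $M$ with a conformal structure $c$ and a torsion-free connection $D$ preserving $c$. Let $\pi:Q_{M,1}\to M$ be the bundle of isotropic complex lines $p\subset T^{\mathbb C}M$; equivalently, of skew-adjoint endomorphisms $F^p$ of the tangent spaces with $(F^p)^3+F^p=0$ whose $(-\mathrm i)$-eigenspace is the line $p$. To an almost $f$-structure $F$ (a section of $\mathrm{End}(TM)$ with $F^3+F=0$) one associates the complex distribution $\mathscr F=T^0M\oplus T^{0,1}M$, the sum of its eigenbundles for $0$ and $-\mathrm i$; $F$ is integrable if the sections of $\mathscr F$ are closed under the Lie bracket, and a map is holomorphic if its complexified differential maps the associated distribution of the domain into that of the codomain. Let $\mathscr H\subset TQ_{M,1}$ be the connection induced by $D$, and let $\mathcal F_{M,1}$ be the almost $f$-structure on $Q_{M,1}$ whose eigenbundle for $0$ is $\{X\in\mathscr H_p: \mathrm d\pi(X)\in\ker F^p\}$ and whose eigenbundle for $-\mathrm i$ is $\{X\in\mathscr H_p^{\mathbb C}: \mathrm d\pi(X)\in p\}\oplus(\ker \mathrm d\pi)^{0,1}$ at each $p\in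 Q_{M,1}$, where the fibres of $\pi$ have the complex structure given by their inclusion into the projective spaces of lines in $T^{\mathbb C}_xM$. Let $p$ be a smooth section of $Q_{M,1}$ and let $F^p$ be the corresponding almost $f$-structure on $(M,c)$. Then the following assertions are equivalent: (i) $p:(M,F^p)\to(Q_{M,1},\mathcal F_{M,1})$ is holomorphic. (ii) $F^p$ is integrable and locally defined by submersive harmonic morphisms with geodesic fibres of codimension two. That is, $F^p$ is integrable and every point of $M$ has an open neighbourhood $W$ with a surjective smooth submersion $\varphi:W\to N$ onto a one-dimensional complex manifold $(N,J)$ (with the conformal structure compatible with $J$) such that $\ker\mathrm d\varphi=\ker F^p|_W$, $\varphi:(W,F^p)\to(N,J)$ is holomorphic, $\varphi$ pulls back local harmonic functions on $N$ to harmonic functions on $(M,c,D)$ (a function $f$ being harmonic if $\mathrm{trace}_c(D\,\mathrm df)=0$), and the fibres of $\varphi$ are totally geodesic with respect to $D$. -/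

import Mathlib

open Bundle
open scoped Manifold ContDiff TensorProduct

noncomputable section

/-! ### Complexified tangent spaces, complex distributions -/

section Complexification

variable {E : Type*} [NormedAddCommGroup E] [NormedSpace ℝ E]
  {H : Type*} [TopologicalSpace H] (I : ModelWithCorners ℝ E H)
  {M : Type*} [TopologicalSpace M] [ChartedSpace H M]
  {E' : Type*} [NormedAddCommGroup E'] [NormedSpace ℝ E']
  {H' : Type*} [TopologicalSpace H'] (I' : ModelWithCorners ℝ E' H')
  {M' : Type*} [TopologicalSpace M'] [ChartedSpace H' M']

/-- The complexified tangent space `ℂ ⊗ TₓM`. -/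
abbrev CTangentSpace (x : M) : Type _ := ℂ ⊗[ℝ] TangentSpace I x

/-- A field of endomorphisms of the tangent spaces, i.e. a (not necessarily smooth) section of
`End(TM)`. -/
abbrev EndField (M : Type*) [TopologicalSpace M] [ChartedSpace H M] : Type _ :=
  ∀ x : M, TangentSpace I x →L[ℝ] TangentSpace I x

/-- The complex tangent vector `X + iY`. -/
def complexVector {V : Type*} [AddCommGroup V] [Module ℝ V] (X Y : V) : ℂ ⊗[ℝ] V :=
  (1 : ℂ) ⊗ₜ[ℝ] X + Complex.I ⊗ₜ[ℝ] Y

/-- The eigenspace, for the eigenvalue `z`, of the complexification of a real endomorphism. -/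
def complexEigenspace {V : Type*} [AddCommGroup V] [Module ℝ V] (F : V →ₗ[ℝ] V) (z : ℂ) :
    Submodule ℂ (ℂ ⊗[ℝ] V) :=
  Module.End.eigenspace (F.baseChange ℂ) z

/-- The complex distribution `T⁰M ⊕ T^{0,1}M` associated to an almost `f`-structure `F`:
the sum of the eigenbundles of `F` corresponding to `0` and `-i`. (For an almost complex structure
this is just the eigenbundle corresponding to `-i`.) -/
def associatedDistribution (F : EndField I M) (x : M) : Submodule ℂ (CTangentSpace I x) :=
  complexEigenspace (F x : TangentSpace I x →ₗ[ℝ] TangentSpace I x) 0 ⊔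
    complexEigenspace (F x : TangentSpace I x →ₗ[ℝ] TangentSpace I x) (-Complex.I)

/-- A complex distribution is integrable if its space of (local, smooth) sections is closed under
the complex bilinear extension of the Lie bracket. The complex vector fields are
`X₁ + iX₂` and `Y₁ + iY₂`. -/
def IsIntegrableDistribution [IsManifold I 1 M] (𝓓 : ∀ x : M, Submodule ℂ (CTangentSpace I x)) : Prop :=
  ∀ (U : Set M), IsOpen U → ∀ X₁ X₂ Y₁ Y₂ : ∀ x : M, TangentSpace I x,
    ContMDiffOn I I.tangent ∞ (fun x ↦ (⟨x, X₁ x⟩ : TangentBundle I M)) U →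
    ContMDiffOn I I.tangent ∞ (fun x ↦ (⟨x, X₂ x⟩ : TangentBundle I M)) U →
    ContMDiffOn I I.tangent ∞ (fun x ↦ (⟨x, Y₁ x⟩ : TangentBundle I M)) U →
    ContMDiffOn I I.tangent ∞ (fun x ↦ (⟨x, Y₂ x⟩ : TangentBundle I M)) U →
    (∀ x ∈ U, complexVector (X₁ x) (X₂ x) ∈ 𝓓 x) →
    (∀ x ∈ U, complexVector (Y₁ x) (Y₂ x) ∈ 𝓓 x) →
    ∀ x ∈ U, complexVector
      (VectorField.mlieBracket I X₁ Y₁ x - VectorField.mlieBracket I X₂ Y₂ x)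
      (VectorField.mlieBracket I X₁ Y₂ x + VectorField.mlieBracket I X₂ Y₁ x) ∈ 𝓓 x

/-- A map `φ` between manifolds endowed with almost `f`-structures (given through their associated
complex distributions) is holomorphic on `U` if the complexified differential of `φ` maps the
complex distribution of the domain into that of the codomain. -/
def IsHolomorphicOn (φ : M → M') (𝓓 : ∀ x : M, Submodule ℂ (CTangentSpace I x))
    (𝓓' : ∀ y : M', Submodule ℂ (CTangentSpace I' y)) (U : Set M) : Prop :=
  ∀ x ∈ U, ∀ Z ∈ 𝓓 x,
    (mfderiv I I' φ x : TangentSpace I x →ₗ[ℝ] TangentSpace I' (φ x)).baseChange ℂ Z ∈ 𝓓' (φ x)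

end Complexification

/-! ### Weyl spaces -/

/-- A Weyl space `(M, c, D)` of dimension `m`: the conformal structure `c` is given by a
representative metric `metric`, and `D` is a smooth torsion-free connection for which
`D c = 0`, that is, `D g = α ⊗ g` for some `1`-form `α`. The condition on `D`, and all the notions
defined below in terms of `metric`, are unchanged if `metric` is replaced by another
representative of its conformal class. -/
structure WeylSpace (m : ℕ) (M : Type*) [TopologicalSpace M]
    [ChartedSpace (EuclideanSpace ℝ (Fin m)) M] [IsManifold (𝓡 m) ∞ M] where
  metric : ContMDiffRiemannianMetric (𝓡 m) ∞ (EuclideanSpace ℝ (Fin m))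
    (fun x : M ↦ TangentSpace (𝓡 m) x)
  D : CovariantDerivative (𝓡 m) (EuclideanSpace ℝ (Fin m)) (fun x : M ↦ TangentSpace (𝓡 m) x)
  smooth : CovariantDerivative.ContMDiffCovariantDerivative D ∞
  torsion_eq_zero : D.torsion = 0
  weyl : ∀ x : M, ∃ α : TangentSpace (𝓡 m) x →L[ℝ] ℝ,
    ∀ Y Z : ∀ y : M, TangentSpace (𝓡 m) y,
      ContMDiffAt (𝓡 m) (𝓡 m).tangent ∞ (fun y ↦ (⟨y, Y y⟩ : TangentBundle (𝓡 m) M)) x →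
      ContMDiffAt (𝓡 m) (𝓡 m).tangent ∞ (fun y ↦ (⟨y, Z y⟩ : TangentBundle (𝓡 m) M)) x →
      ∀ X : TangentSpace (𝓡 m) x,
        mvfderiv (𝓡 m) (fun y ↦ metric.inner y (Y y) (Z y)) x X
            - metric.inner x (D Y x X) (Z x) - metric.inner x (Y x) (D Z x X)
          = α X * metric.inner x (Y x) (Z x)

section Weyl

variable {m : ℕ} {M : Type*} [TopologicalSpace M] [ChartedSpace (EuclideanSpace ℝ (Fin m)) M]
  [IsManifold (𝓡 m) ∞ M]

/-- The second covariant derivative `(D df)(X, Y) = X(Y f) - (D_X Y) f` at `x`, for vector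
fields `X` and `Y`. -/
def WeylSpace.hessian (w : WeylSpace m M) (f : M → ℝ) (X Y : ∀ y : M, TangentSpace (𝓡 m) y)
    (x : M) : ℝ :=
  mvfderiv (𝓡 m) (fun y ↦ mvfderiv (𝓡 m) f y (Y y)) x (X x)
    - mvfderiv (𝓡 m) f x (w.D Y x (X x))

/-- A smooth function `f` is harmonic on the open set `U` of the Weyl space `(M, c, D)` if
`trace_c (D df) = 0` on `U`. The trace at `x` is computed with vector fields `e i` which, at `x`,
form an orthonormal frame with respect to the representative of `c`. -/
def WeylSpace.IsHarmonicOn (w : WeylSpace m M) (f : M → ℝ) (U : Set M) : Prop :=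
  ContMDiffOn (𝓡 m) 𝓘(ℝ, ℝ) ∞ f U ∧
  ∀ x ∈ U, ∀ e : Fin m → ∀ y : M, TangentSpace (𝓡 m) y,
    (∀ i, ContMDiffAt (𝓡 m) (𝓡 m).tangent ∞
      (fun y ↦ (⟨y, e i y⟩ : TangentBundle (𝓡 m) M)) x) →
    (∀ i j, w.metric.inner x (e i x) (e j x) = if i = j then 1 else 0) →
    ∑ i, w.hessian f (e i) (e i) x = 0

/-- `φ`, restricted to the open set `W`, is a harmonic morphism between Weyl spaces: it pulls back
(locally defined) harmonic functions to harmonic functions. -/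
def WeylSpace.IsHarmonicMorphismOn (w : WeylSpace m M)
    {n : ℕ} {N : Type*} [TopologicalSpace N] [ChartedSpace (EuclideanSpace ℝ (Fin n)) N]
    [IsManifold (𝓡 n) ∞ N] (w' : WeylSpace n N) (φ : M → N) (W : Set M) : Prop :=
  ∀ (V : Set N), IsOpen V → ∀ f : N → ℝ, w'.IsHarmonicOn f V →
    w.IsHarmonicOn (f ∘ φ) (W ∩ φ ⁻¹' V)

/-- The fibres of the submersion `φ : W → N` are geodesic with respect to `D`: if `X` and `Y` are
(local, smooth) vector fields tangent to the fibres then so is `D_X Y`. -/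
def WeylSpace.HasGeodesicFibresOn (w : WeylSpace m M)
    {n : ℕ} {N : Type*} [TopologicalSpace N] [ChartedSpace (EuclideanSpace ℝ (Fin n)) N]
    (φ : M → N) (W : Set M) : Prop :=
  ∀ U ⊆ W, IsOpen U → ∀ X Y : ∀ x : M, TangentSpace (𝓡 m) x,
    ContMDiffOn (𝓡 m) (𝓡 m).tangent ∞ (fun x ↦ (⟨x, X x⟩ : TangentBundle (𝓡 m) M)) U →
    ContMDiffOn (𝓡 m) (𝓡 m).tangent ∞ (fun x ↦ (⟨x, Y x⟩ : TangentBundle (𝓡 m) M)) U →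
    (∀ x ∈ U, mfderiv (𝓡 m) (𝓡 n) φ x (X x) = 0) →
    (∀ x ∈ U, mfderiv (𝓡 m) (𝓡 n) φ x (Y x) = 0) →
    ∀ x ∈ U, mfderiv (𝓡 m) (𝓡 n) φ x (w.D Y x (X x)) = 0

/-! ### The bundle of isotropic spaces and its canonical almost `f`-structure -/

variable (m M) in
/-- The total space of the vector bundle `End(TM)`. -/
abbrev EndBundle : Type _ :=
  TotalSpace (EuclideanSpace ℝ (Fin m) →L[ℝ] EuclideanSpace ℝ (Fin m))
    (fun x : M ↦ TangentSpace (𝓡 m) x →L[ℝ] TangentSpace (𝓡 m) x)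

variable (m) in
/-- The model with corners of the manifold `EndBundle m M`. -/
abbrev endModel :=
  (𝓡 m).prod 𝓘(ℝ, EuclideanSpace ℝ (Fin m) →L[ℝ] EuclideanSpace ℝ (Fin m))

namespace EndBundle

/-- The endomorphism of `TₓM` underlying a point of `End(TM)`. -/
def toLin (q : EndBundle m M) : TangentSpace (𝓡 m) q.1 →ₗ[ℝ] TangentSpace (𝓡 m) q.1 :=
  (q.2 : TangentSpace (𝓡 m) q.1 →ₗ[ℝ] TangentSpace (𝓡 m) q.1)

/-- The complexification, acting on `ℂ ⊗ TₓM`, of an endomorphism of `TₓM`. -/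
def complexify {x : M} (A : TangentSpace (𝓡 m) x →L[ℝ] TangentSpace (𝓡 m) x) :
    CTangentSpace (𝓡 m) x →ₗ[ℂ] CTangentSpace (𝓡 m) x :=
  (A : TangentSpace (𝓡 m) x →ₗ[ℝ] TangentSpace (𝓡 m) x).baseChange ℂ

/-- The eigenspace of `q` corresponding to `-i`. -/
def isotropicSpace (q : EndBundle m M) : Submodule ℂ (CTangentSpace (𝓡 m) q.1) :=
  complexEigenspace q.toLin (-Complex.I)

/-- The differential of the bundle projection `End(TM) → M`, complexified. -/
def dProj (q : EndBundle m M) :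
    CTangentSpace (endModel m) q →ₗ[ℂ] CTangentSpace (𝓡 m) q.1 :=
  (mfderiv (endModel m) (𝓡 m) (TotalSpace.proj : EndBundle m M → M) q :
    TangentSpace (endModel m) q →ₗ[ℝ] TangentSpace (𝓡 m) q.1).baseChange ℂ

/-- The identification of `End(TₓM)` with the vertical tangent space of `End(TM)` at `q`: the
differential at `q` of the inclusion of the fibre. -/
def vertical (q : EndBundle m M) (A : TangentSpace (𝓡 m) q.1 →L[ℝ] TangentSpace (𝓡 m) q.1) :
    TangentSpace (endModel m) q :=
  let B₀ : EuclideanSpace ℝ (Fin m) →L[ℝ] EuclideanSpace ℝ (Fin m) := q.2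
  mfderiv 𝓘(ℝ, EuclideanSpace ℝ (Fin m) →L[ℝ] EuclideanSpace ℝ (Fin m)) (endModel m)
    (fun B : EuclideanSpace ℝ (Fin m) →L[ℝ] EuclideanSpace ℝ (Fin m) ↦ (⟨q.1, B⟩ : EndBundle m M))
    B₀ A

end EndBundle

namespace WeylSpace

variable (w : WeylSpace m M)

/-- The endomorphism `A` of `TₓM` is skew-adjoint with respect to `c`. -/
def IsSkew {x : M} (A : TangentSpace (𝓡 m) x →L[ℝ] TangentSpace (𝓡 m) x) : Prop :=
  ∀ X Y : TangentSpace (𝓡 m) x, w.metric.inner x (A X) Y = -w.metric.inner x X (A Y)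

/-- `Q_{M,r}`, the bundle of isotropic spaces of complex dimension `r` on `(M, c)`, viewed as the
bundle of skew-adjoint `f`-structures whose eigenspaces corresponding to `-i` have dimension `r`:
the isotropic space `p` of `TₓM` corresponds to the unique skew-adjoint `F` on `TₓM`
with `F³ + F = 0` whose eigenspace corresponding to `-i` is `p` (and, so, `ker F` is the
orthogonal complement of `p ⊕ p̄`). In this way, `Q_{M,r}` is a submanifold of `End(TM)`. -/
def Q (r : ℕ) : Set (EndBundle m M) :=
  {q | q.2.comp (q.2.comp q.2) + q.2 = 0 ∧ w.IsSkew q.2 ∧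
    Module.finrank ℂ q.isotropicSpace = r}

/-- The tangent space at `q` to the fibre of `Q_{M,r}`, as a subset of `End(TₓM)`: the
kernel of the linearization at `q` of the equations `F³ + F = 0`, `F* + F = 0`. -/
def IsFibreTangent (q : EndBundle m M)
    (A : TangentSpace (𝓡 m) q.1 →L[ℝ] TangentSpace (𝓡 m) q.1) : Prop :=
  A.comp (q.2.comp q.2) + q.2.comp (A.comp q.2) + q.2.comp (q.2.comp A) + A = 0 ∧ w.IsSkew A

/-- The complex structure of the fibres of `Q_{M,r}`: `B = J A`. The fibre is a complex submanifold
of the Grassmannian of `ℂ ⊗ TₓM` through `F ↦ p = ker (F + i)`. The differential of this embedding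
maps `A` to the homomorphism `p → (ℂ ⊗ TₓM)/p` which sends `v` to the class of the vectors `u` for
which `v + t u` is, to first order in `t`, an eigenvector of `F + tA` corresponding to `-i`, that
is, `A v + F u = -i u`. Thus, `B = J A` if and only if `i u` is obtained in the same way
from `B`. -/
def IsFibreComplexStructure (q : EndBundle m M)
    (A B : TangentSpace (𝓡 m) q.1 →L[ℝ] TangentSpace (𝓡 m) q.1) : Prop :=
  ∀ v ∈ q.isotropicSpace, ∀ u : CTangentSpace (𝓡 m) q.1,
    EndBundle.complexify A v + EndBundle.complexify q.2 u = -Complex.I • u →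
    EndBundle.complexify B v + EndBundle.complexify q.2 (Complex.I • u)
      = -Complex.I • (Complex.I • u)

/-- `(ker dπ)^{0,1}` at `q`, where `π : Q_{M,r} → M` is the projection: it is spanned by the
vertical vectors `A + i J A`, with `A` tangent to the fibre. -/
def vertical01 (q : EndBundle m M) : Submodule ℂ (CTangentSpace (endModel m) q) :=
  Submodule.span ℂ {Z | ∃ A B : TangentSpace (𝓡 m) q.1 →L[ℝ] TangentSpace (𝓡 m) q.1,
    w.IsFibreTangent q A ∧ w.IsFibreTangent q B ∧ IsFibreComplexStructure q A B ∧
    Z = complexVector (q.vertical A) (q.vertical B)}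

/-- The section `σ` of `End(TM)` satisfies `D_X σ = 0` at `x`, with respect to the connection on
`End(TM)` induced by `D`; that is, `D_X (σ Y) = σ (D_X Y)` for any local vector field `Y`. -/
def IsParallelAt (σ : EndField (𝓡 m) M) (x : M) (X : TangentSpace (𝓡 m) x) : Prop :=
  ∀ Y : ∀ y : M, TangentSpace (𝓡 m) y,
    ContMDiffAt (𝓡 m) (𝓡 m).tangent ∞ (fun y ↦ (⟨y, Y y⟩ : TangentBundle (𝓡 m) M)) x →
    w.D (fun y ↦ σ y (Y y)) x X = σ x (w.D Y x X)

/-- The horizontal space, at `q`, of the connection induced by `D`: it is formed of the vectors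
`dσ(X)`, where `σ` is a local section of `End(TM)`, with `σ(x) = q` and `D_X σ = 0` at `x`.
(As `D` preserves `c`, this is tangent to `Q_{M,r}` if `q ∈ Q_{M,r}`.) -/
def horizontal (q : EndBundle m M) : Submodule ℝ (TangentSpace (endModel m) q) :=
  Submodule.span ℝ {Z | ∃ (σ : EndField (𝓡 m) M) (_ : (⟨q.1, σ q.1⟩ : EndBundle m M) = q)
    (X : TangentSpace (𝓡 m) q.1),
    ContMDiffAt (𝓡 m) (endModel m) ∞ (fun y ↦ (⟨y, σ y⟩ : EndBundle m M)) q.1 ∧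
    w.IsParallelAt σ q.1 X ∧
    Z = mfderiv (𝓡 m) (endModel m) (fun y ↦ (⟨y, σ y⟩ : EndBundle m M)) q.1 X}

/-- The horizontal complex vectors at `q` which are projected by `dπ` into the eigenspace of `F^q`
corresponding to `z`. For `z = 0` this is (the complexification of) `T⁰Q_{M,r}`, and for `z = -i`
this is `𝒢₀`. -/
def horizontalEigenspace (q : EndBundle m M) (z : ℂ) :
    Submodule ℂ (CTangentSpace (endModel m) q) :=
  (w.horizontal q).baseChange ℂ ⊓ (complexEigenspace q.toLin z).comap q.dProj

/-- The complex distribution `T⁰Q_{M,r} ⊕ T^{0,1}Q_{M,r}`, where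
`T^{0,1}Q_{M,r} = 𝒢₀ ⊕ (ker dπ)^{0,1}`, associated to the almost `f`-structure `𝓕_{M,r}`
on `Q_{M,r}`. -/
def twistorDistribution (q : EndBundle m M) : Submodule ℂ (CTangentSpace (endModel m) q) :=
  w.horizontalEigenspace q 0 ⊔ (w.horizontalEigenspace q (-Complex.I) ⊔ w.vertical01 q)

/-- A smooth section `p` of `Q_{M,r}`. The field of endomorphisms `p.F` is the corresponding almost
`f`-structure `F^p` on `(M, c)`. -/
structure SectionQ (r : ℕ) where
  F : EndField (𝓡 m) M
  smooth : ContMDiff (𝓡 m) (endModel m) ∞ (fun x ↦ (⟨x, F x⟩ : EndBundle m M))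
  mem_Q : ∀ x, (⟨x, F x⟩ : EndBundle m M) ∈ w.Q r

/-- The section `p`, as a map from `M` to (the manifold which contains) `Q_{M,r}`. -/
def SectionQ.toMap {w : WeylSpace m M} {r : ℕ} (p : w.SectionQ r) (x : M) : EndBundle m M :=
  ⟨x, p.F x⟩

end WeylSpace

end Weyl

/-! ### `f`-structures locally defined by harmonic morphisms to surfaces -/

/-- A complex manifold of (complex) dimension one, endowed with its conformal structure: a surface
`N` with a Weyl structure (harmonicity of functions on a surface depends only on the conformal
structure) and a compatible integrable almost complex structure `J`. -/
structure HermitianSurface where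
  N : Type
  [top : TopologicalSpace N]
  [charted : ChartedSpace (EuclideanSpace ℝ (Fin 2)) N]
  [manifold : IsManifold (𝓡 2) ∞ N]
  [t2 : T2Space N]
  [secondCountable : SecondCountableTopology N]
  weyl : WeylSpace 2 N
  J : EndField (𝓡 2) N
  smooth : ContMDiff (𝓡 2) (endModel 2) ∞ (fun y ↦ (⟨y, J y⟩ : EndBundle 2 N))
  sq_eq_neg : ∀ y, (J y).comp (J y) = -ContinuousLinearMap.id ℝ (TangentSpace (𝓡 2) y)
  skew : ∀ y, weyl.IsSkew (J y)
  integrable : IsIntegrableDistribution (𝓡 2) (associatedDistribution (𝓡 2) J)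

attribute [instance] HermitianSurface.top HermitianSurface.charted HermitianSurface.manifold
  HermitianSurface.t2 HermitianSurface.secondCountable

/-- The almost `f`-structure `F` is, on the open set `W`, defined by the map `φ : W → (N, J)`: `φ`
is a holomorphic submersion from `(W, F)` onto `(N, J)` such that `ker dφ = T⁰M`. -/
def IsDefinedByOn {m : ℕ} {M : Type*} [TopologicalSpace M]
    [ChartedSpace (EuclideanSpace ℝ (Fin m)) M] [IsManifold (𝓡 m) ∞ M]
    (F : EndField (𝓡 m) M) (S : HermitianSurface) (φ : M → S.N) (W : Set M) : Prop :=
  ContMDiffOn (𝓡 m) (𝓡 2) ∞ φ W ∧ φ '' W = Set.univ ∧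
  (∀ x ∈ W, Function.Surjective (mfderiv (𝓡 m) (𝓡 2) φ x)) ∧
  (∀ x ∈ W, ∀ X : TangentSpace (𝓡 m) x, mfderiv (𝓡 m) (𝓡 2) φ x X = 0 ↔ F x X = 0) ∧
  IsHolomorphicOn (𝓡 m) (𝓡 2) φ (associatedDistribution (𝓡 m) F)
    (associatedDistribution (𝓡 2) S.J) W

/-- `F` is locally defined by submersive harmonic morphisms with geodesic fibres (of codimension
two) with respect to the Weyl space `(M, c, D)`. -/
def WeylSpace.IsLocallyDefinedByHarmonicMorphisms {m : ℕ} {M : Type*} [TopologicalSpace M]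
    [ChartedSpace (EuclideanSpace ℝ (Fin m)) M] [IsManifold (𝓡 m) ∞ M]
    (w : WeylSpace m M) (F : EndField (𝓡 m) M) : Prop :=
  ∀ x : M, ∃ (W : Set M) (S : HermitianSurface) (φ : M → S.N),
    IsOpen W ∧ x ∈ W ∧ IsDefinedByOn F S φ W ∧
    w.IsHarmonicMorphismOn S.weyl φ W ∧ w.HasGeodesicFibresOn (n := 2) φ W

end

/-! Write `p` for the isotropic line, `F` for the skew `f`-structure with `-i` eigenspace `p`, and
`C_X = D_X F` (`nabla`). Differentiating the equations of skew `f`-structures shows that `C_X` is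
skew and, `F` having rank two, exchanges `ker F` and `im F` (`apply_variation`,
`variation_mem_image`). Both assertions are compared with one first-order condition,
`IsHolomorphicStructure`: whenever `X + iY` lies in `𝓕 = (ker F)^ℂ ⊕ p`, the endomorphism `C_X + i
C_Y` kills `p`.

Assertion (i) is this condition. The differential of the section splits, along `Z`, into the
horizontal lift of `Z` and the vertical vector `D_Z F`. For `Z` in `𝓕` the lift always lies in the
twistor distribution, and a vertical vector `A + iB` is of type `(0,1)` exactly when it kills `p`
(`isHolomorphicOn_iff`).

The condition has two direct consequences. A real `X` in `ker F` lies in `𝓕`, so `C_X = 0` on `im F`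
and then everywhere, by skewness; in particular the leaves of `ker F` are geodesic. Moreover `𝓕 =
p^⊥` and `D` preserves the conformal structure, so `D_Z`, which preserves `p` for `Z` in `𝓕`, also
preserves `𝓕`; as `D` is torsion-free, `𝓕` is closed under brackets (`integrability_identity`,
`isIntegrableDistribution_of`).

Conversely, geodesic fibres give `C_X = 0` on `ker F` for `X` in `ker F`, hence `C_X = 0`.
Integrability, applied to `X + iFX` and a section of `ker F`, gives `C_{FX} = F C_X` on `ker F`.
Transposing, one recovers the condition (`isHolomorphicStructure_of`).

It remains to produce the harmonic morphisms. Integrability makes `ker F` involutive, and the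
Frobenius theorem makes it constant (`exists_straightening`). Integrability also says that `F`
modulo `ker F` does not vary along `ker F`, so it descends to an almost complex structure `J` on a
plane (`exists_submersion_plane`). On a plane there are a Hermitian metric and a torsion-free
conformal connection with `DJ = 0` (`Plane.weylSpace`). For the resulting `φ`, let `τ = D dφ`.
Differentiating `J dφ = dφ F` gives `J τ(X, v) = dφ(C_X v) + τ(X, Fv)`. Hence `τ(v, v) = 0` for `v`
in `ker F`, while on `im F` one gets `τ(v, v) + τ(Fv, Fv) = 0`, because `C_X` maps `im F` into `ker
F = ker dφ`. Since `Hess(f ∘ φ) = Hess f(dφ, dφ) + df(τ)`, the trace vanishes for `f` harmonic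
(`isHarmonicMorphismOn`).

The Frobenius theorem is proved from the differential equation of a commuting frame; smooth
dependence on parameters comes from the inverse function theorem in the space of continuous paths.
-/

noncomputable section

/-! ### Complexified vectors -/

section ComplexVector

variable {V V' : Type*} [AddCommGroup V] [Module ℝ V] [AddCommGroup V'] [Module ℝ V']

/-- The real part of a vector of the complexification. -/
def complexRe (V : Type*) [AddCommGroup V] [Module ℝ V] : ℂ ⊗[ℝ] V →ₗ[ℝ] V :=
  (TensorProduct.lid ℝ V).toLinearMap ∘ₗ LinearMap.rTensor V Complex.reLm

/-- The imaginary part of a vector of the complexification. -/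
def complexIm (V : Type*) [AddCommGroup V] [Module ℝ V] : ℂ ⊗[ℝ] V →ₗ[ℝ] V :=
  (TensorProduct.lid ℝ V).toLinearMap ∘ₗ LinearMap.rTensor V Complex.imLm

@[simp] lemma complexRe_complexVector (X Y : V) : complexRe V (complexVector X Y) = X := by
  simp [complexRe, complexVector]

@[simp] lemma complexIm_complexVector (X Y : V) : complexIm V (complexVector X Y) = Y := by
  simp [complexIm, complexVector]

lemma complexVector_inj {X Y X' Y' : V} :
    complexVector X Y = complexVector X' Y' ↔ X = X' ∧ Y = Y' := by
  refine ⟨fun h ↦ ⟨?_, ?_⟩, fun h ↦ by rw [h.1, h.2]⟩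
  · simpa using congrArg (complexRe V) h
  · simpa using congrArg (complexIm V) h

lemma complexVector_zero : complexVector (0 : V) 0 = 0 := by simp [complexVector]

lemma complexVector_add (X Y X' Y' : V) :
    complexVector X Y + complexVector X' Y' = complexVector (X + X') (Y + Y') := by
  simp only [complexVector, TensorProduct.tmul_add]; abel

lemma complexVector_neg (X Y : V) : -complexVector X Y = complexVector (-X) (-Y) := by
  simp only [complexVector, TensorProduct.tmul_neg]; abel

lemma tmul_eq_complexVector (z : ℂ) (v : V) : z ⊗ₜ[ℝ] v = complexVector (z.re • v) (z.im • v) := by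
  rw [complexVector, ← TensorProduct.smul_tmul, ← TensorProduct.smul_tmul,
    ← TensorProduct.add_tmul]
  congr 1
  apply Complex.ext <;> simp

lemma smul_complexVector (z : ℂ) (X Y : V) : z • complexVector X Y =
    complexVector (z.re • X - z.im • Y) (z.re • Y + z.im • X) := by
  rw [complexVector, smul_add, TensorProduct.smul_tmul', TensorProduct.smul_tmul',
    tmul_eq_complexVector, tmul_eq_complexVector, complexVector_add, complexVector_inj]
  constructor <;> simp [sub_eq_add_neg, add_comm]

lemma I_smul_complexVector (X Y : V) : Complex.I • complexVector X Y = complexVector (-Y) X := by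
  simp [smul_complexVector]

lemma neg_I_smul_complexVector (X Y : V) :
    -Complex.I • complexVector X Y = complexVector Y (-X) := by
  rw [neg_smul, I_smul_complexVector, complexVector_neg, neg_neg]

lemma exists_eq_complexVector (Z : ℂ ⊗[ℝ] V) : ∃ X Y : V, Z = complexVector X Y := by
  induction Z using TensorProduct.induction_on with
  | zero => exact ⟨0, 0, complexVector_zero.symm⟩
  | tmul z v => exact ⟨_, _, tmul_eq_complexVector z v⟩
  | add Z Z' h h' =>
    obtain ⟨X, Y, rfl⟩ := h
    obtain ⟨X', Y', rfl⟩ := h'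
    exact ⟨_, _, complexVector_add ..⟩

lemma baseChange_complexVector (f : V →ₗ[ℝ] V') (X Y : V) :
    f.baseChange ℂ (complexVector X Y) = complexVector (f X) (f Y) := by
  simp [complexVector]

lemma complexVector_mem_complexEigenspace_zero {F : V →ₗ[ℝ] V} {X Y : V} :
    complexVector X Y ∈ complexEigenspace F 0 ↔ F X = 0 ∧ F Y = 0 := by
  rw [complexEigenspace, Module.End.mem_eigenspace_iff, baseChange_complexVector, zero_smul,
    ← complexVector_zero, complexVector_inj]

lemma complexVector_mem_complexEigenspace_neg_I {F : V →ₗ[ℝ] V} {X Y : V} :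
    complexVector X Y ∈ complexEigenspace F (-Complex.I) ↔ F X = Y ∧ F Y = -X := by
  rw [complexEigenspace, Module.End.mem_eigenspace_iff, baseChange_complexVector,
    neg_I_smul_complexVector, complexVector_inj]

/-- Since `F³ = -F`, the maps `1 + F²` and `-F²` project onto the kernel and the image. The kernel
parts of `X` and `Y` are free; the real equation only says that the image parts form a `-i`
eigenvector. Membership in the associated distribution is always used in this real form. -/
lemma complexVector_mem_sup_complexEigenspace {F : V →ₗ[ℝ] V} (hF : ∀ v, F (F (F v)) = -F v)
    {X Y : V} :
    complexVector X Y ∈ complexEigenspace F 0 ⊔ complexEigenspace F (-Complex.I) ↔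
      F Y = F (F X) := by
  constructor
  · intro h
    obtain ⟨Z, hZ, Z', hZ', h⟩ := Submodule.mem_sup.1 h
    obtain ⟨A, B, rfl⟩ := exists_eq_complexVector Z
    obtain ⟨A', B', rfl⟩ := exists_eq_complexVector Z'
    rw [complexVector_mem_complexEigenspace_zero] at hZ
    rw [complexVector_mem_complexEigenspace_neg_I] at hZ'
    rw [complexVector_add, complexVector_inj] at h
    rw [← h.1, ← h.2]
    simp [hZ, hZ']
  · intro h
    have h2 : F (F Y) = -F X := by rw [h, hF]
    refine Submodule.mem_sup.2 ⟨complexVector (X + F (F X)) (Y + F (F Y)), ?_,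
      complexVector (-F (F X)) (-F (F Y)), ?_, ?_⟩
    · rw [complexVector_mem_complexEigenspace_zero]
      simp [hF]
    · rw [complexVector_mem_complexEigenspace_neg_I]
      simp [hF, h2]
    · rw [complexVector_add]; simp

/-- If the eigenspace for `-i` has complex dimension one, the eigenspace for `-1` of `F²` is spanned
by `v` and `F v`, for any of its nonzero elements `v`. -/
lemma exists_eq_smul_add_smul {F : V →ₗ[ℝ] V}
    (h : Module.finrank ℂ (complexEigenspace F (-Complex.I)) = 1) {v w : V} (hv0 : v ≠ 0)
    (hv : F (F v) = -v) (hw : F (F w) = -w) : ∃ a b : ℝ, w = a • v + b • F v := by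
  let s : complexEigenspace F (-Complex.I) :=
    ⟨complexVector v (F v), complexVector_mem_complexEigenspace_neg_I.2 ⟨rfl, hv⟩⟩
  have hs : s ≠ 0 := by
    intro hs
    have := congrArg Subtype.val hs
    rw [Submodule.coe_zero, ← complexVector_zero, complexVector_inj] at this
    exact hv0 this.1
  obtain ⟨c, hc⟩ := (finrank_eq_one_iff_of_nonzero' s hs).1 h
    ⟨complexVector w (F w), complexVector_mem_complexEigenspace_neg_I.2 ⟨rfl, hw⟩⟩
  have hc := congrArg Subtype.val hc
  simp only [Submodule.coe_smul, s, smul_complexVector, complexVector_inj] at hc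
  exact ⟨c.re, -c.im, by rw [← hc.1]; module⟩

lemma exists_ne_zero_apply_apply_eq_neg {F : V →ₗ[ℝ] V}
    (h : Module.finrank ℂ (complexEigenspace F (-Complex.I)) = 1) :
    ∃ v : V, v ≠ 0 ∧ F (F v) = -v := by
  have : Nontrivial (complexEigenspace F (-Complex.I)) :=
    Module.nontrivial_of_finrank_pos (R := ℂ) (by omega)
  obtain ⟨⟨Z, hZ⟩, hne⟩ := exists_ne (0 : complexEigenspace F (-Complex.I))
  obtain ⟨X, Y, rfl⟩ := exists_eq_complexVector Z
  rw [complexVector_mem_complexEigenspace_neg_I] at hZ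
  refine ⟨X, fun h0 ↦ hne ?_, by rw [hZ.1, hZ.2]⟩
  have hY : Y = 0 := by rw [← hZ.1, h0, map_zero]
  simp [h0, hY, complexVector_zero]

end ComplexVector

/-! ### Skew-adjoint `f`-structures of rank two on a Euclidean space -/

section LinearAlgebra

variable {V : Type*} [AddCommGroup V] [Module ℝ V] [TopologicalSpace V]

/-- `F` is a skew-adjoint `f`-structure of rank two on the Euclidean vector space `(V, g)`. -/
structure IsRankTwoF (g : V →L[ℝ] V →L[ℝ] ℝ) (F : V →ₗ[ℝ] V) : Prop where
  symm : ∀ v w, g v w = g w v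
  pos : ∀ v, v ≠ 0 → 0 < g v v
  skew : ∀ v w, g (F v) w = -g v (F w)
  cube : ∀ v, F (F (F v)) = -F v
  rank : ∀ v w, v ≠ 0 → F (F v) = -v → F (F w) = -w → ∃ a b : ℝ, w = a • v + b • F v

/-- `C` satisfies the linearization at `F` of the equations of skew-adjoint `f`-structures. -/
structure IsVariation (g : V →L[ℝ] V →L[ℝ] ℝ) (F C : V →ₗ[ℝ] V) : Prop where
  skew : ∀ v w, g (C v) w = -g v (C w)
  lin : ∀ v, C (F (F v)) + F (C (F v)) + F (F (C v)) + C v = 0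

variable {g : V →L[ℝ] V →L[ℝ] ℝ} {F : V →ₗ[ℝ] V}

namespace IsRankTwoF

lemma eq_zero_of_inner (h : IsRankTwoF g F) {v : V} (hv : ∀ w, g v w = 0) : v = 0 := by
  by_contra hne
  exact (h.pos v hne).ne' (hv v)

lemma inner_eq_zero (h : IsRankTwoF g F) {v w : V} (hv : F v = 0) (hw : F (F w) = -w) :
    g v w = 0 := by
  have := h.skew v (F w)
  rw [hv, hw] at this
  simpa using this.symm

/-- The variation of `F` maps the image of `F` into the kernel of `F`. -/
lemma apply_variation (h : IsRankTwoF g F) {C : V →ₗ[ℝ] V} (hC : IsVariation g F C) {v : V}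
    (hv : F (F v) = -v) : F (C v) = 0 := by
  rcases eq_or_ne v 0 with rfl | hv0
  · simp
  have hself : ∀ u, g (C u) u = 0 := fun u ↦ by
    have := hC.skew u u
    rw [h.symm u] at this
    linarith
  -- The linearized equation on the image puts `C (F v) + F (C v)` in the kernel, so it is
  -- orthogonal to `v`, and skewness turns this into `C v ⊥ F v`. Also `C v ⊥ v`. As the rank is
  -- two, `v` and `F v` span the image, so `C v` is orthogonal to the whole image.
  have hker : F (C (F v) + F (C v)) = 0 := by
    have := hC.lin v
    rw [hv, map_neg] at this
    rw [map_add, ← this]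
    abel
  have h1 : g (C v) (F v) = 0 := by
    have h2 := h.inner_eq_zero hker hv
    rw [map_add, add_apply, hC.skew, h.skew (C v), h.symm (F v)] at h2
    linarith
  refine h.eq_zero_of_inner fun w ↦ ?_
  rw [h.skew]
  obtain ⟨a, b, hab⟩ := h.rank v (F w) hv0 hv (h.cube w)
  rw [hab]
  simp [h1, hself]

/-- On the kernel, only the last two terms of the linearized equation survive. -/
lemma variation_mem_image (_h : IsRankTwoF g F) {C : V →ₗ[ℝ] V} (hC : IsVariation g F C) {w : V}
    (hw : F w = 0) : F (F (C w)) = -C w := by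
  have := hC.lin w
  simp only [hw, map_zero, zero_add] at this
  exact eq_neg_of_add_eq_zero_left this

lemma eq_of_mem_ker (h : IsRankTwoF g F) {u u' : V} (hu : F u = 0) (hu' : F u' = 0)
    (hw : ∀ w, F w = 0 → g u w = g u' w) : u = u' := by
  rw [← sub_eq_zero]
  refine h.eq_zero_of_inner fun w ↦ ?_
  have hk : F (u - u') = 0 := by simp [hu, hu']
  have h1 := h.inner_eq_zero (w := -F (F w)) hk (by simp [h.cube])
  have h2 : g (u - u') (w + F (F w)) = 0 := by
    rw [map_sub, sub_apply, hw _ (by simp [h.cube]), sub_self]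
  have h3 : w = (w + F (F w)) + (-F (F w)) := by abel
  rw [h3, map_add, h1, h2, add_zero]

/-- A variation of `F` which vanishes on the image of `F` is zero. -/
lemma variation_eq_zero (h : IsRankTwoF g F) {C : V →ₗ[ℝ] V} (hC : IsVariation g F C)
    (h0 : ∀ v, F (F v) = -v → C v = 0) (u : V) : C u = 0 := by
  have h1 : C (F (F u)) = 0 := by
    have := h0 (-F (F u)) (by simp [h.cube])
    simpa using this
  have h2 : C (u + F (F u)) = 0 := by
    have hi := h.variation_mem_image hC (w := u + F (F u)) (by simp [h.cube])
    by_contra hne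
    have := h.pos _ hne
    rw [hC.skew, h0 _ hi] at this
    simp at this
  simpa [h1] using h2

/-- A variation exchanges kernel and image and is skew, so its restriction to the image is minus the
transpose of its restriction to the kernel. -/
lemma variation_eq_zero_of_ker (h : IsRankTwoF g F) {C : V →ₗ[ℝ] V} (hC : IsVariation g F C)
    (h0 : ∀ w, F w = 0 → C w = 0) (u : V) : C u = 0 := by
  refine h.variation_eq_zero hC (fun v hv ↦ ?_) u
  refine h.eq_of_mem_ker (h.apply_variation hC hv) (map_zero F) fun w hw ↦ ?_
  rw [hC.skew, h0 w hw]; simp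

/-- The derivative `C X`, in the direction `X`, of `F` is such that `F` is, to first order,
holomorphic along the associated distribution. -/
def _root_.IsHolomorphicVariation (F : V →ₗ[ℝ] V) (C : V → V →ₗ[ℝ] V) : Prop :=
  ∀ X Y v, F Y = F (F X) → F (F v) = -v → C X v = C Y (F v)

/-- A real vector of the kernel lies in the associated distribution: the pair `(X, 0)` is admissible
and forces `C X` to vanish on the image. -/
lemma apply_eq_zero_of_isHolomorphicVariation (h : IsRankTwoF g F) {C : V → V →ₗ[ℝ] V}
    (hC : ∀ X, IsVariation g F (C X)) (hC0 : C 0 = 0)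
    (hT : IsHolomorphicVariation F C) {X : V} (hX : F X = 0) : C X = 0 := by
  ext u
  refine h.variation_eq_zero (hC X) (fun v hv ↦ ?_) u
  rw [hT X 0 v (by simp [hX]) hv, hC0]; rfl

/-- By `hker` only the image parts of `X` and `Y` matter, and for these `Y = F X`. The two sides
then lie in the kernel; tested against kernel vectors and transposed, the equality becomes `hint`.
-/
lemma isHolomorphicVariation_of (h : IsRankTwoF g F) {C : V → V →ₗ[ℝ] V}
    (hC : ∀ X, IsVariation g F (C X)) (hadd : ∀ X Y, C (X + Y) = C X + C Y)
    (hker : ∀ X, F X = 0 → C X = 0)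
    (hint : ∀ X w, F (F X) = -X → F w = 0 → C (F X) w = F (C X w)) :
    IsHolomorphicVariation F C := by
  have key : ∀ X, C X = C (-F (F X)) := fun X ↦ by
    have h1 := hadd (X + F (F X)) (-F (F X))
    rw [hker (X + F (F X)) (by simp [h.cube]), zero_add] at h1
    rw [← h1]; congr 1; abel
  intro X Y v hXY hv
  rw [key X, key Y, hXY, h.cube, neg_neg]
  set X' := -F (F X) with hX'
  have hFX' : F X = F X' := by simp [hX', h.cube]
  have hX'' : F (F X') = -X' := by simp [hX', h.cube]
  rw [hFX']
  have hFv : F (F (F v)) = -F v := h.cube v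
  refine h.eq_of_mem_ker (h.apply_variation (hC _) hv) (h.apply_variation (hC _) hFv)
    fun w hw ↦ ?_
  rw [(hC _).skew, (hC _).skew, hint _ _ hX'' hw, h.skew, h.variation_mem_image (hC _) hw]
  simp

/-- The pointwise identity behind the integrability of the associated distribution. -/
lemma integrability_identity (h : IsRankTwoF g F) {C : V → V →ₗ[ℝ] V}
    (hC : ∀ X, IsVariation g F (C X)) (hadd : ∀ X Y, C (X + Y) = C X + C Y)
    (hT : IsHolomorphicVariation F C) {X₁ X₂ Y₁ Y₂ : V} (hX : F X₂ = F (F X₁))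
    (hY : F Y₂ = F (F Y₁)) :
    C X₁ (F Y₁) + F (C X₁ Y₁) - C X₁ Y₂ - (C X₂ (F Y₂) + F (C X₂ Y₂) + C X₂ Y₁) = 0 := by
  have hC0 : C 0 = 0 := by simpa using hadd 0 0
  have hker : ∀ X, F X = 0 → C X = 0 :=
    fun X hX ↦ h.apply_eq_zero_of_isHolomorphicVariation hC hC0 hT hX
  -- the action on the kernel
  have hk : ∀ w, F w = 0 → C X₂ w = F (C X₁ w) := by
    intro w hw
    rw [← sub_eq_zero]
    -- Both terms lie in the image, so only the image part of `u` counts; there the claim is the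
    -- transpose of `hT`.
    refine h.eq_zero_of_inner fun u ↦ ?_
    have e1 := h.variation_mem_image (hC X₁) hw
    have e2 := h.variation_mem_image (hC X₂) hw
    have hd : F (F (C X₂ w - F (C X₁ w))) = -(C X₂ w - F (C X₁ w)) := by
      simp only [map_sub, e2, h.cube]; abel
    have a1 : g (C X₂ w - F (C X₁ w)) (u + F (F u)) = 0 := by
      rw [h.symm]; exact h.inner_eq_zero (by simp [h.cube]) hd
    have hv : F (F (-F (F u))) = -(-F (F u)) := by simp [h.cube]
    have a2 : g (C X₂ w - F (C X₁ w)) (-F (F u)) = 0 := by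
      have e3 := hT X₁ X₂ (F (-F (F u))) hX (by simp [h.cube])
      rw [map_sub, sub_apply, (hC X₂).skew, h.skew, (hC X₁).skew, e3, hv]
      simp
    have h3 : u = (u + F (F u)) + (-F (F u)) := by abel
    rw [h3, map_add, a1, a2, add_zero]
  -- decomposition of the fields
  set a := Y₁ + F (F Y₁) with ha
  set b := Y₂ + F (F Y₂) with hb
  set v := -F (F Y₁) with hv
  have fa : F a = 0 := by simp [ha, h.cube]
  have fb : F b = 0 := by simp [hb, h.cube]
  have fv : F (F v) = -v := by simp [hv, h.cube]
  have y1 : Y₁ = a + v := by simp [ha, hv]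
  have y2 : Y₂ = b + F v := by simp [hb, hv, hY, h.cube]
  have c2' := h.apply_variation (hC X₂) (v := F v) (by simp [fv])
  have t1 := hT X₁ X₂ v hX fv
  have kb := congrArg F (hk b fb)
  rw [h.variation_mem_image (hC X₁) fb] at kb
  rw [y1, y2]
  simp only [map_add, fa, fb, fv, map_neg, zero_add, c2', add_zero, hk a fa, kb, t1]
  abel

/-- If the quadratic form of `H` vanishes on the kernel of `F` and, on the image of `F`, has no
`F`-invariant part, then the trace of `H` is zero. -/
lemma sum_eq_zero (h : IsRankTwoF g F) {ι : Type*} [Fintype ι] (e : ι → V)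
    (hspan : ∀ v, v = ∑ j, g (e j) v • e j)
    (H : V →ₗ[ℝ] V →ₗ[ℝ] ℝ) (h0 : ∀ v, F v = 0 → H v v = 0)
    (h1 : ∀ v, F (F v) = -v → H v v + H (F v) (F v) = 0) : ∑ i, H (e i) (e i) = 0 := by
  -- moving the adjoint
  have move : ∀ A B B' : V →ₗ[ℝ] V, (∀ v w, g v (B w) = g (B' v) w) →
      ∑ i, H (A (e i)) (B (e i)) = ∑ i, H (A (B' (e i))) (e i) := by
    intro A B B' hB
    have e1 : ∀ i, H (A (e i)) (B (e i)) = ∑ j, g (B' (e j)) (e i) * H (A (e i)) (e j) := by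
      intro i
      conv_lhs => rw [hspan (B (e i))]
      simp [map_sum, hB]
    have e2 : ∀ j, H (A (B' (e j))) (e j) = ∑ i, g (B' (e j)) (e i) * H (A (e i)) (e j) := by
      intro j
      conv_lhs => rw [hspan (B' (e j))]
      simp [map_sum, h.symm]
    simp only [e1, e2]
    exact Finset.sum_comm
  have hF : ∀ v w, g v (F w) = g ((-F) v) w := fun v w ↦ by simp [h.skew]
  have hFF : ∀ v w, g v ((F ∘ₗ F) w) = g ((F ∘ₗ F) v) w := fun v w ↦ by simp [h.skew]
  -- `m1` and `m2`: the cross terms between kernel and image parts have zero trace, as `F² (1 + F²)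
  -- = 0`. `m3` and `m4`: the sums of `H` over `F² e` and over `F e` coincide; by `h1` they are also
  -- opposite, hence both vanish.
  have m1 := move (LinearMap.id + F ∘ₗ F) (F ∘ₗ F) (F ∘ₗ F) hFF
  have m2 := move (F ∘ₗ F) (LinearMap.id + F ∘ₗ F) (LinearMap.id + F ∘ₗ F)
    (fun v w ↦ by simp [h.skew])
  have m3 := move (F ∘ₗ F) (F ∘ₗ F) (F ∘ₗ F) hFF
  have m4 := move F F (-F) hF
  simp only [LinearMap.add_apply, LinearMap.id_apply, LinearMap.comp_apply, h.cube, map_add,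
    map_neg, LinearMap.neg_apply, add_neg_cancel, map_zero, LinearMap.zero_apply,
    Finset.sum_const_zero] at m1 m2 m3 m4
  have m5 : ∑ i, (H (F (F (e i))) (F (F (e i))) + H (F (e i)) (F (e i))) = 0 := by
    refine Finset.sum_eq_zero fun i _ ↦ ?_
    have := h1 (-F (F (e i))) (by simp [h.cube])
    simpa [h.cube] using this
  have m6 : ∑ i, H (e i + F (F (e i))) (e i + F (F (e i))) = 0 :=
    Finset.sum_eq_zero fun i _ ↦ h0 _ (by simp [h.cube])
  have m7 : ∀ i, H (e i) (e i) = H (e i + F (F (e i))) (e i + F (F (e i)))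
      - (H (e i) (F (F (e i))) + H (F (F (e i))) (F (F (e i))))
      - (H (F (F (e i))) (e i) + H (F (F (e i))) (F (F (e i))))
      + H (F (F (e i))) (F (F (e i))) := fun i ↦ by
    simp only [map_add, LinearMap.add_apply]; ring
  have m8 : ∑ i, H (F (F (e i))) (F (F (e i))) = 0 := by
    simp only [Finset.sum_add_distrib, Finset.sum_neg_distrib] at m3 m4 m5
    linarith
  simp only [Finset.sum_add_distrib] at m1 m2
  rw [Finset.sum_congr rfl fun i _ ↦ m7 i]
  simp only [Finset.sum_add_distrib, Finset.sum_sub_distrib]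
  simp only [Finset.sum_add_distrib, map_add, LinearMap.add_apply] at m6
  simp only [map_add, LinearMap.add_apply, Finset.sum_add_distrib]
  linarith

end IsRankTwoF

end LinearAlgebra

end

/-! ### The covariant derivative of a field of endomorphisms; integrability -/

noncomputable section

section Nabla

open FiberBundle

variable {m : ℕ} {M : Type*} [TopologicalSpace M] [ChartedSpace (EuclideanSpace ℝ (Fin m)) M]
  [IsManifold (𝓡 m) ∞ M]

/-- The vector field `Y` is smooth at `x`. -/
abbrev SmoothFieldAt (Y : ∀ y : M, TangentSpace (𝓡 m) y) (x : M) : Prop :=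
  ContMDiffAt (𝓡 m) (𝓡 m).tangent ∞ (fun y ↦ (⟨y, Y y⟩ : TangentBundle (𝓡 m) M)) x

/-- The vector field `Y` is differentiable at `x`. -/
abbrev DiffFieldAt (Y : ∀ y : M, TangentSpace (𝓡 m) y) (x : M) : Prop :=
  MDifferentiableAt (𝓡 m) (𝓡 m).tangent (fun y ↦ (⟨y, Y y⟩ : TangentBundle (𝓡 m) M)) x

/-- The field of endomorphisms `F` is smooth at `x`. -/
abbrev SmoothEndAt (F : EndField (𝓡 m) M) (x : M) : Prop :=
  ContMDiffAt (𝓡 m) (endModel m) ∞ (fun y ↦ (⟨y, F y⟩ : EndBundle m M)) x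

variable {x : M}

lemma SmoothFieldAt.diff {Y : ∀ y : M, TangentSpace (𝓡 m) y} (h : SmoothFieldAt Y x) :
    DiffFieldAt Y x :=
  h.mdifferentiableAt (by simp)

lemma SmoothEndAt.apply {F : EndField (𝓡 m) M} (hF : SmoothEndAt F x)
    {Y : ∀ y : M, TangentSpace (𝓡 m) y} (hY : SmoothFieldAt Y x) :
    SmoothFieldAt (fun y ↦ F y (Y y)) x :=
  ContMDiffAt.clm_bundle_apply (F₁ := EuclideanSpace ℝ (Fin m)) (F₂ := EuclideanSpace ℝ (Fin m))
    (E₁ := fun x : M ↦ TangentSpace (𝓡 m) x) (E₂ := fun x : M ↦ TangentSpace (𝓡 m) x) hF hY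

lemma SmoothEndAt.apply_diff {F : EndField (𝓡 m) M} (hF : SmoothEndAt F x)
    {Y : ∀ y : M, TangentSpace (𝓡 m) y} (hY : DiffFieldAt Y x) :
    DiffFieldAt (fun y ↦ F y (Y y)) x :=
  MDifferentiableAt.clm_bundle_apply (F₁ := EuclideanSpace ℝ (Fin m))
    (F₂ := EuclideanSpace ℝ (Fin m))
    (E₁ := fun x : M ↦ TangentSpace (𝓡 m) x) (E₂ := fun x : M ↦ TangentSpace (𝓡 m) x)
    (hF.mdifferentiableAt (by simp)) hY

lemma smoothFieldAt_extend (v : TangentSpace (𝓡 m) x) :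
    SmoothFieldAt (extend (EuclideanSpace ℝ (Fin m)) v) x :=
  contMDiffAt_extend (𝓡 m) (EuclideanSpace ℝ (Fin m)) v

namespace WeylSpace

variable (w : WeylSpace m M)

lemma D_add {Y Z : ∀ y : M, TangentSpace (𝓡 m) y} (hY : DiffFieldAt Y x) (hZ : DiffFieldAt Z x) :
    w.D (fun y ↦ Y y + Z y) x = w.D Y x + w.D Z x :=
  w.D.isCovariantDerivativeOnUniv.add hY hZ

lemma D_congr {Y Z : ∀ y : M, TangentSpace (𝓡 m) y} (hY : DiffFieldAt Y x) (hZ : DiffFieldAt Z x)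
    (h : ∀ᶠ y in nhds x, Y y = Z y) : w.D Y x = w.D Z x :=
  w.D.isCovariantDerivativeOnUniv.congr_of_eventuallyEq hY hZ Filter.univ_mem h

lemma D_eq_zero {Y : ∀ y : M, TangentSpace (𝓡 m) y} (hY : DiffFieldAt Y x)
    (h : ∀ᶠ y in nhds x, Y y = 0) : w.D Y x = 0 := by
  rw [w.D_congr hY (mdifferentiableAt_zeroSection ..) (Z := 0) h, w.D.zero]; rfl

lemma mlieBracket_eq {X Y : ∀ y : M, TangentSpace (𝓡 m) y} (hX : DiffFieldAt X x)
    (hY : DiffFieldAt Y x) :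
    VectorField.mlieBracket (𝓡 m) X Y x = w.D Y x (X x) - w.D X x (Y x) :=
  (w.D.torsion_eq_zero_iff.1 w.torsion_eq_zero hX hY).symm

lemma tensorialAt_nabla {F : EndField (𝓡 m) M} (hF : SmoothEndAt F x) :
    TensorialAt (𝓡 m) (EuclideanSpace ℝ (Fin m)) (fun Y : ∀ y : M, TangentSpace (𝓡 m) y ↦
      w.D (fun y ↦ F y (Y y)) x - (F x).comp (w.D Y x)) x where
  smul {f Y} hf hY := by
    have h1 := w.D.isCovariantDerivativeOnUniv.leibniz hY hf
    have h2 := w.D.isCovariantDerivativeOnUniv.leibniz (hF.apply_diff hY) hf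
    have h3 : (fun y ↦ F y ((f • Y) y)) = f • fun y ↦ F y (Y y) := by
      ext y; simp
    rw [h3, h2, h1]
    ext v
    simp [smul_sub]
  add {Y Z} hY hZ := by
    have h3 : (fun y ↦ F y ((Y + Z) y)) = fun y ↦ F y (Y y) + F y (Z y) := by
      ext y; simp
    have h4 : w.D (Y + Z) x = w.D Y x + w.D Z x := w.D_add hY hZ
    rw [h3, w.D_add (hF.apply_diff hY) (hF.apply_diff hZ), h4]
    ext v
    simp
    abel

/-- The covariant derivative `D_X F` of a field of endomorphisms. -/
def nabla {F : EndField (𝓡 m) M} (hF : SmoothEndAt F x) (X : TangentSpace (𝓡 m) x) :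
    TangentSpace (𝓡 m) x →ₗ[ℝ] TangentSpace (𝓡 m) x where
  toFun v := TensorialAt.mkHom _ x (w.tensorialAt_nabla hF) v X
  map_add' := by simp
  map_smul' := by simp

lemma nabla_add {F : EndField (𝓡 m) M} (hF : SmoothEndAt F x) (X Y : TangentSpace (𝓡 m) x) :
    w.nabla hF (X + Y) = w.nabla hF X + w.nabla hF Y := by
  ext v; simp [nabla]

/-- The Leibniz rule `D_X (F Y) = (D_X F) Y + F (D_X Y)`. -/
lemma D_apply {F : EndField (𝓡 m) M} (hF : SmoothEndAt F x)
    {Y : ∀ y : M, TangentSpace (𝓡 m) y} (hY : DiffFieldAt Y x) (X : TangentSpace (𝓡 m) x) :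
    w.D (fun y ↦ F y (Y y)) x X = w.nabla hF X (Y x) + F x (w.D Y x X) := by
  have := TensorialAt.mkHom_apply (w.tensorialAt_nabla hF) hY
  have h2 := congrArg (fun T ↦ T X) this
  simp only [sub_apply, ContinuousLinearMap.comp_apply] at h2
  simp only [nabla, LinearMap.coe_mk, AddHom.coe_mk]
  rw [h2]; abel

lemma isParallelAt_iff {F : EndField (𝓡 m) M} (hF : SmoothEndAt F x) (X : TangentSpace (𝓡 m) x) :
    w.IsParallelAt F x X ↔ w.nabla hF X = 0 := by
  constructor
  · intro h
    ext v
    have h1 := h _ (smoothFieldAt_extend v)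
    rw [w.D_apply hF (smoothFieldAt_extend v).diff, extend_apply_self] at h1
    simpa using h1
  · intro h Y hY
    rw [w.D_apply hF (SmoothFieldAt.diff hY), h]; simp

/-- `F` is, at each point, to first order holomorphic along its associated distribution. -/
def IsHolomorphicStructure {F : EndField (𝓡 m) M} (hF : ∀ x, SmoothEndAt F x) : Prop :=
  ∀ x, IsHolomorphicVariation (F x : TangentSpace (𝓡 m) x →ₗ[ℝ] TangentSpace (𝓡 m) x)
    (w.nabla (hF x))

/-- A sufficient pointwise condition for the integrability of an almost `f`-structure. -/
lemma isIntegrableDistribution_of {F : EndField (𝓡 m) M} (hF : ∀ x, SmoothEndAt F x)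
    (hcube : ∀ x v, F x (F x (F x v)) = -F x v)
    (H : ∀ x, ∀ X₁ X₂ Y₁ Y₂ : TangentSpace (𝓡 m) x, F x X₂ = F x (F x X₁) →
      F x Y₂ = F x (F x Y₁) →
      w.nabla (hF x) X₁ (F x Y₁) + F x (w.nabla (hF x) X₁ Y₁) - w.nabla (hF x) X₁ Y₂
        - (w.nabla (hF x) X₂ (F x Y₂) + F x (w.nabla (hF x) X₂ Y₂) + w.nabla (hF x) X₂ Y₁) = 0) :
    IsIntegrableDistribution (𝓡 m) (associatedDistribution (𝓡 m) F) := by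
  have hmem : ∀ x, ∀ X Y : TangentSpace (𝓡 m) x,
      complexVector X Y ∈ associatedDistribution (𝓡 m) F x ↔ F x Y = F x (F x X) :=
    fun x X Y ↦ complexVector_mem_sup_complexEigenspace (hcube x)
  intro U hU X₁ X₂ Y₁ Y₂ hX₁ hX₂ hY₁ hY₂ hX hY x hx
  simp only [hmem] at hX hY ⊢
  have hUx := hU.mem_nhds hx
  have sX₁ : DiffFieldAt X₁ x := (hX₁.contMDiffAt hUx).mdifferentiableAt (by simp)
  have sX₂ : DiffFieldAt X₂ x := (hX₂.contMDiffAt hUx).mdifferentiableAt (by simp)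
  have sY₁ : DiffFieldAt Y₁ x := (hY₁.contMDiffAt hUx).mdifferentiableAt (by simp)
  have sY₂ : DiffFieldAt Y₂ x := (hY₂.contMDiffAt hUx).mdifferentiableAt (by simp)
  -- In complex terms: if `Z = Z₁ + i Z₂` and `W = W₁ + i W₂` are sections of the distribution, so
  -- is `D_Z W`. Closure under brackets follows, `[X, Y] = D_X Y - D_Y X` being the absence of
  -- torsion.
  have key : ∀ Z₁ Z₂ W₁ W₂ : ∀ y : M, TangentSpace (𝓡 m) y,
      DiffFieldAt W₁ x → DiffFieldAt W₂ x →
      (∀ y ∈ U, F y (Z₂ y) = F y (F y (Z₁ y))) → (∀ y ∈ U, F y (W₂ y) = F y (F y (W₁ y))) →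
      F x (w.D W₂ x (Z₁ x) + w.D W₁ x (Z₂ x)) =
        F x (F x (w.D W₁ x (Z₁ x) - w.D W₂ x (Z₂ x))) := by
    intro Z₁ Z₂ W₁ W₂ s₁ s₂ hZ hW
    have f₁ := (hF x).apply_diff s₁
    have f₂ := (hF x).apply_diff s₂
    have ff₁ := (hF x).apply_diff f₁
    have ff₂ := (hF x).apply_diff f₂
    -- The membership equation is differentiated along `Z₁` as `F W₂ = F² W₁`, and along `Z₂` in the
    -- equivalent form `F² W₂ + F W₁ = 0`. The terms containing `D F` in the sum are those of `H`.
    have e1 : w.D (fun y ↦ F y (W₂ y)) x = w.D (fun y ↦ F y (F y (W₁ y))) x :=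
      w.D_congr f₂ ff₁ (Filter.eventually_of_mem hUx hW)
    have e2 : w.D (fun y ↦ F y (F y (W₂ y)) + F y (W₁ y)) x = 0 := by
      refine w.D_eq_zero (mdifferentiableAt_add_section ff₂ f₁)
        (Filter.eventually_of_mem hUx fun y hy ↦ ?_)
      rw [hW y hy, hcube]; simp
    have e1' := congrArg (fun T ↦ T (Z₁ x)) e1
    have e2' := congrArg (fun T ↦ T (Z₂ x)) e2
    rw [w.D_add ff₂ f₁] at e2'
    simp only [add_apply, w.D_apply (hF x) f₂, w.D_apply (hF x) f₁, w.D_apply (hF x) s₁,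
      w.D_apply (hF x) s₂, map_add, zero_apply] at e1' e2'
    have e3 := H x _ _ _ _ (hZ x hx) (hW x hx)
    simp only [map_add, map_sub]
    linear_combination (norm := module) e1' + e2' + e3
  have k1 := key X₁ X₂ Y₁ Y₂ sY₁ sY₂ hX hY
  have k2 := key Y₁ Y₂ X₁ X₂ sX₁ sX₂ hY hX
  rw [w.mlieBracket_eq sX₁ sY₁, w.mlieBracket_eq sX₂ sY₂, w.mlieBracket_eq sX₁ sY₂,
    w.mlieBracket_eq sX₂ sY₁]
  simp only [map_add, map_sub] at k1 k2 ⊢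
  linear_combination (norm := module) k1 - k2

/-- The extension of a tangent vector is smooth on a neighbourhood. -/
lemma exists_open_smooth_extend (v : TangentSpace (𝓡 m) x) {W : Set M} (hW : IsOpen W)
    (hx : x ∈ W) : ∃ U ⊆ W, IsOpen U ∧ x ∈ U ∧
      ContMDiffOn (𝓡 m) (𝓡 m).tangent ∞ (fun y ↦ (⟨y, extend (EuclideanSpace ℝ (Fin m)) v y⟩ :
        TangentBundle (𝓡 m) M)) U := by
  obtain ⟨s, hs, h⟩ := exists_contMDiffOn_extend (k := ∞) (𝓡 m) (EuclideanSpace ℝ (Fin m)) v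
  exact ⟨W ∩ interior s, Set.inter_subset_left, hW.inter isOpen_interior,
    ⟨hx, mem_interior_iff_mem_nhds.2 hs⟩,
    h.mono (Set.inter_subset_right.trans interior_subset)⟩

lemma _root_.contMDiffOn_end_apply {F : EndField (𝓡 m) M} (hF : ∀ x, SmoothEndAt F x)
    {Y : ∀ y : M, TangentSpace (𝓡 m) y} {U : Set M}
    (hY : ContMDiffOn (𝓡 m) (𝓡 m).tangent ∞ (fun y ↦ (⟨y, Y y⟩ : TangentBundle (𝓡 m) M)) U) :
    ContMDiffOn (𝓡 m) (𝓡 m).tangent ∞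
      (fun y ↦ (⟨y, F y (Y y)⟩ : TangentBundle (𝓡 m) M)) U :=
  ContMDiffOn.clm_bundle_apply (F₁ := EuclideanSpace ℝ (Fin m)) (F₂ := EuclideanSpace ℝ (Fin m))
    (E₁ := fun x : M ↦ TangentSpace (𝓡 m) x) (E₂ := fun x : M ↦ TangentSpace (𝓡 m) x)
    (fun y _ ↦ (hF y).contMDiffWithinAt) hY

/-- Through each vector of the kernel of an `f`-structure passes a section of the kernel. -/
lemma exists_ker_field {F : EndField (𝓡 m) M} (hF : ∀ x, SmoothEndAt F x)
    (hcube : ∀ x v, F x (F x (F x v)) = -F x v) {v : TangentSpace (𝓡 m) x} (hv : F x v = 0)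
    {W : Set M} (hW : IsOpen W) (hx : x ∈ W) :
    ∃ U ⊆ W, IsOpen U ∧ x ∈ U ∧ ∃ Y : ∀ y : M, TangentSpace (𝓡 m) y,
      ContMDiffOn (𝓡 m) (𝓡 m).tangent ∞ (fun y ↦ (⟨y, Y y⟩ : TangentBundle (𝓡 m) M)) U ∧
      (∀ y, F y (Y y) = 0) ∧ Y x = v := by
  obtain ⟨U, hUW, hU, hxU, h⟩ := exists_open_smooth_extend v hW hx
  refine ⟨U, hUW, hU, hxU, fun y ↦ extend (EuclideanSpace ℝ (Fin m)) v y +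
    F y (F y (extend (EuclideanSpace ℝ (Fin m)) v y)), ?_, ?_, ?_⟩
  · exact ContMDiffOn.add_section h (contMDiffOn_end_apply hF (contMDiffOn_end_apply hF h))
  · intro y; simp [hcube]
  · simp [hv]

/-- The Leibniz rule for `F Y = 0`. It relates `D F` on the kernel to the second fundamental form of
the kernel. -/
lemma nabla_apply_ker {F : EndField (𝓡 m) M} (hF : SmoothEndAt F x)
    {Y : ∀ y : M, TangentSpace (𝓡 m) y} (hY : DiffFieldAt Y x) (h : ∀ᶠ y in nhds x, F y (Y y) = 0)
    (X : TangentSpace (𝓡 m) x) : w.nabla hF X (Y x) = -F x (w.D Y x X) := by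
  have h1 := w.D_apply hF hY X
  rw [w.D_eq_zero (hF.apply_diff hY) h] at h1
  exact eq_neg_of_add_eq_zero_left h1.symm

/-- For an integrable almost `f`-structure. -/
lemma nabla_apply_of_integrable {F : EndField (𝓡 m) M} (hF : ∀ x, SmoothEndAt F x)
    (hcube : ∀ x v, F x (F x (F x v)) = -F x v)
    (hint : IsIntegrableDistribution (𝓡 m) (associatedDistribution (𝓡 m) F))
    {X v : TangentSpace (𝓡 m) x} (hv : F x v = 0) (h0 : w.nabla (hF x) v = 0) :
    w.nabla (hF x) (F x X) v = F x (w.nabla (hF x) X v) := by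
  have hmem : ∀ x, ∀ X Y : TangentSpace (𝓡 m) x,
      complexVector X Y ∈ associatedDistribution (𝓡 m) F x ↔ F x Y = F x (F x X) :=
    fun x X Y ↦ complexVector_mem_sup_complexEigenspace (hcube x)
  obtain ⟨U, -, hU, hxU, Y, hY, hYker, hYx⟩ :=
    exists_ker_field hF hcube hv isOpen_univ (Set.mem_univ x)
  obtain ⟨U', hU'U, hU', hxU', hX⟩ := exists_open_smooth_extend X hU hxU
  set Z := extend (EuclideanSpace ℝ (Fin m)) X with hZ
  have hZx : Z x = X := extend_apply_self ..
  -- The bracket of `Z + i F Z` with the real section `Y` of the kernel. The term with the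
  -- derivative of `F` along `v` disappears by `h0`.
  have h1 := hint U' hU' Z (fun y ↦ F y (Z y)) Y 0 hX (contMDiffOn_end_apply hF hX)
    (hY.mono hU'U)
    (contMDiff_zeroSection ℝ (fun x : M ↦ TangentSpace (𝓡 m) x)).contMDiffOn
    (fun y hy ↦ (hmem ..).2 rfl) (fun y hy ↦ (hmem ..).2 (by simp [hYker])) x hxU'
  rw [hmem, VectorField.mlieBracket_zero_right, VectorField.mlieBracket_zero_right] at h1
  have sZ : DiffFieldAt Z x := (smoothFieldAt_extend X).diff
  have sY : DiffFieldAt Y x := (hY.contMDiffAt (hU.mem_nhds hxU)).mdifferentiableAt (by simp)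
  simp only [Pi.zero_apply, sub_zero, zero_add] at h1
  rw [w.mlieBracket_eq sZ sY, w.mlieBracket_eq ((hF x).apply_diff sZ) sY,
    w.D_apply (hF x) sZ, hYx, h0] at h1
  have h2 := fun X ↦ w.nabla_apply_ker (hF x) sY (Filter.Eventually.of_forall hYker) X
  rw [hYx] at h2
  rw [← hZx, h2, h2]
  simp only [map_sub, map_neg, LinearMap.zero_apply, zero_add] at h1 ⊢
  rw [sub_left_inj] at h1
  rw [h1]

variable {r : ℕ}

lemma SectionQ.cube {w : WeylSpace m M} (p : w.SectionQ r) (x : M) (v : TangentSpace (𝓡 m) x) :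
    p.F x (p.F x (p.F x v)) = -p.F x v := by
  have := congrArg (fun T ↦ T v) (p.mem_Q x).1
  exact eq_neg_of_add_eq_zero_left this

lemma SectionQ.skew {w : WeylSpace m M} (p : w.SectionQ r) (x : M) (v u : TangentSpace (𝓡 m) x) :
    w.metric.inner x (p.F x v) u = -w.metric.inner x v (p.F x u) := (p.mem_Q x).2.1 v u

lemma SectionQ.isRankTwoF {w : WeylSpace m M} (p : w.SectionQ 1) (x : M) :
    IsRankTwoF (w.metric.inner x) (p.F x : TangentSpace (𝓡 m) x →ₗ[ℝ] TangentSpace (𝓡 m) x) where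
  symm := w.metric.symm x
  pos := w.metric.pos x
  skew := p.skew x
  cube := p.cube x
  rank _ _ h0 hv hw := exists_eq_smul_add_smul (p.mem_Q x).2.2 h0 hv hw

/-- Differentiate the skewness of `F` and `F³ + F = 0`. The `1`-form of the Weyl connection drops
out since it multiplies `g (F Y) Z + g Y (F Z) = 0`: it is enough that `D` preserves the conformal
class. -/
lemma SectionQ.isVariation {w : WeylSpace m M} (p : w.SectionQ r) (x : M)
    (X : TangentSpace (𝓡 m) x) :
    IsVariation (w.metric.inner x) (p.F x : TangentSpace (𝓡 m) x →ₗ[ℝ] TangentSpace (𝓡 m) x)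
      (w.nabla (p.smooth x) X) where
  skew v u := by
    obtain ⟨α, hα⟩ := w.weyl x
    set Y := extend (EuclideanSpace ℝ (Fin m)) v with hY
    set Z := extend (EuclideanSpace ℝ (Fin m)) u with hZ
    have sY : SmoothFieldAt Y x := smoothFieldAt_extend v
    have sZ : SmoothFieldAt Z x := smoothFieldAt_extend u
    have hYx : Y x = v := extend_apply_self ..
    have hZx : Z x = u := extend_apply_self ..
    have h1 := hα _ _ (SmoothEndAt.apply (p.smooth x) sY) sZ X
    have h2 := hα _ _ sY (SmoothEndAt.apply (p.smooth x) sZ) X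
    have h3 : (fun y ↦ w.metric.inner y (p.F y (Y y)) (Z y)) =
        -fun y ↦ w.metric.inner y (Y y) (p.F y (Z y)) := by
      ext y; simp [p.skew]
    rw [h3, mvfderiv_neg, w.D_apply (p.smooth x) sY.diff, hYx, hZx] at h1
    rw [w.D_apply (p.smooth x) sZ.diff, hYx, hZx] at h2
    simp only [neg_apply, map_add, add_apply, p.skew] at h1 h2
    linarith
  lin v := by
    set Y := extend (EuclideanSpace ℝ (Fin m)) v with hY
    have sY : DiffFieldAt Y x := (smoothFieldAt_extend v).diff
    have hYx : Y x = v := extend_apply_self ..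
    have s1 := SmoothEndAt.apply_diff (p.smooth x) sY
    have s2 := SmoothEndAt.apply_diff (p.smooth x) s1
    have s3 := SmoothEndAt.apply_diff (p.smooth x) s2
    have h1 : w.D (fun y ↦ p.F y (p.F y (p.F y (Y y))) + p.F y (Y y)) x = 0 :=
      w.D_eq_zero (mdifferentiableAt_add_section s3 s1)
        (Filter.Eventually.of_forall fun y ↦ by rw [p.cube]; simp)
    rw [w.D_add s3 s1] at h1
    have h2 := congrArg (fun T ↦ T X) h1
    simp only [add_apply, w.D_apply (p.smooth x) s2, w.D_apply (p.smooth x) s1,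
      w.D_apply (p.smooth x) sY, map_add, zero_apply, hYx] at h2
    rw [p.cube] at h2
    simp only [ContinuousLinearMap.coe_coe]
    linear_combination (norm := module) h2

variable {w}

lemma SectionQ.isIntegrable (p : w.SectionQ 1) (hp : w.IsHolomorphicStructure p.smooth) :
    IsIntegrableDistribution (𝓡 m) (associatedDistribution (𝓡 m) p.F) :=
  w.isIntegrableDistribution_of p.smooth p.cube fun x _ _ _ _ hX hY ↦
    (p.isRankTwoF x).integrability_identity (p.isVariation x) (w.nabla_add _) (hp x) hX hY

lemma SectionQ.nabla_eq_zero (p : w.SectionQ 1) (hp : w.IsHolomorphicStructure p.smooth)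
    {x : M} {X : TangentSpace (𝓡 m) x} (hX : p.F x X = 0) : w.nabla (p.smooth x) X = 0 :=
  (p.isRankTwoF x).apply_eq_zero_of_isHolomorphicVariation (p.isVariation x)
    (by simpa using w.nabla_add (p.smooth x) 0 0) (hp x) hX

/-- The hypothesis `hgeod` controls `D_X F` only on the kernel, but a variation vanishing there is
zero. With `D_X F = 0` for `X` in the kernel, integrability supplies the remaining relation between
`D_{F X} F` and `D_X F`. -/
lemma SectionQ.isHolomorphicStructure_of (p : w.SectionQ 1)
    (hint : IsIntegrableDistribution (𝓡 m) (associatedDistribution (𝓡 m) p.F))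
    (hgeod : ∀ x, ∀ X v : TangentSpace (𝓡 m) x, p.F x X = 0 → p.F x v = 0 →
      w.nabla (p.smooth x) X v = 0) : w.IsHolomorphicStructure p.smooth := by
  intro x
  have hker : ∀ X, p.F x X = 0 → w.nabla (p.smooth x) X = 0 := fun X hX ↦ by
    ext u
    exact (p.isRankTwoF x).variation_eq_zero_of_ker (p.isVariation x X)
      (fun v hv ↦ hgeod x X v hX hv) u
  exact (p.isRankTwoF x).isHolomorphicVariation_of (p.isVariation x) (w.nabla_add _) hker
    fun X v _ hv ↦ w.nabla_apply_of_integrable p.smooth p.cube hint hv (hker v hv)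

/-- For sections `Y`, `Z` of `ker F = ker dφ` one has `(D_Y F) Z = -F (D_Y Z)`, which vanishes when
the fibres are geodesic. -/
lemma SectionQ.isHolomorphicStructure_of_isLocallyDefined (p : w.SectionQ 1)
    (hint : IsIntegrableDistribution (𝓡 m) (associatedDistribution (𝓡 m) p.F))
    (hloc : w.IsLocallyDefinedByHarmonicMorphisms p.F) :
    w.IsHolomorphicStructure p.smooth := by
  refine p.isHolomorphicStructure_of hint fun x X v hX hv ↦ ?_
  obtain ⟨W, S, φ, hW, hxW, ⟨-, -, -, hker, -⟩, -, hgeod⟩ := hloc x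
  obtain ⟨U, hUW, hU, hxU, Y, hY, hYker, hYx⟩ := exists_ker_field p.smooth p.cube hX hW hxW
  obtain ⟨U', hU'U, hU', hxU', Z, hZ, hZker, hZx⟩ := exists_ker_field p.smooth p.cube hv hU hxU
  have h1 := hgeod U' (hU'U.trans hUW) hU' Y Z (hY.mono hU'U) hZ
    (fun y hy ↦ (hker y (hUW (hU'U hy)) _).2 (hYker y))
    (fun y hy ↦ (hker y (hUW (hU'U hy)) _).2 (hZker y)) x hxU'
  rw [hker x hxW, hYx] at h1
  have sZ : DiffFieldAt Z x := (hZ.contMDiffAt (hU'.mem_nhds hxU')).mdifferentiableAt (by simp)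
  rw [← hZx, w.nabla_apply_ker (p.smooth x) sZ (Filter.Eventually.of_forall hZker), h1, neg_zero]

end WeylSpace

end Nabla

end

/-! ### Connections and sections of `End(TM)` in the preferred charts -/

noncomputable section

section Coordinates

open FiberBundle

variable {m : ℕ} {M : Type*} [TopologicalSpace M] [ChartedSpace (EuclideanSpace ℝ (Fin m)) M]
  [IsManifold (𝓡 m) ∞ M]

/-- The vector field `Y` in the preferred chart at `x`. -/
def fieldCoord (x : M) (Y : ∀ y : M, TangentSpace (𝓡 m) y) (y : M) : EuclideanSpace ℝ (Fin m) :=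
  (trivializationAt (EuclideanSpace ℝ (Fin m)) (TangentSpace (𝓡 m) : M → Type _) x ⟨y, Y y⟩).2

/-- The field of endomorphisms `F` in the preferred chart at `x`. -/
def endCoord (x : M) (F : EndField (𝓡 m) M) (y : M) :
    EuclideanSpace ℝ (Fin m) →L[ℝ] EuclideanSpace ℝ (Fin m) :=
  ContinuousLinearMap.inCoordinates (EuclideanSpace ℝ (Fin m)) (TangentSpace (𝓡 m) : M → Type _)
    (EuclideanSpace ℝ (Fin m)) (TangentSpace (𝓡 m) : M → Type _) x y x y (F y)

variable {x : M}

lemma fieldCoord_eq_continuousLinearMapAt (Y : ∀ y : M, TangentSpace (𝓡 m) y) {y : M}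
    (hy : y ∈ (chartAt (EuclideanSpace ℝ (Fin m)) x).source) :
    fieldCoord x Y y = (trivializationAt (EuclideanSpace ℝ (Fin m))
      (TangentSpace (𝓡 m) : M → Type _) x).continuousLinearMapAt ℝ y (Y y) := by
  rw [fieldCoord, Trivialization.continuousLinearMapAt_apply, Trivialization.linearMapAt_apply,
    if_pos]
  simpa using hy

lemma fieldCoord_eq_mfderiv (Y : ∀ y : M, TangentSpace (𝓡 m) y) {y : M}
    (hy : y ∈ (chartAt (EuclideanSpace ℝ (Fin m)) x).source) :
    fieldCoord x Y y =
      mfderiv (𝓡 m) 𝓘(ℝ, EuclideanSpace ℝ (Fin m)) (extChartAt (𝓡 m) x) y (Y y) :=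
  (fieldCoord_eq_continuousLinearMapAt Y hy).trans
    (congrArg (fun T ↦ T (Y y)) (TangentBundle.continuousLinearMapAt_trivializationAt hy))

lemma endCoord_apply (F : EndField (𝓡 m) M) (Y : ∀ y : M, TangentSpace (𝓡 m) y) {y : M}
    (hy : y ∈ (chartAt (EuclideanSpace ℝ (Fin m)) x).source) :
    endCoord x F y (fieldCoord x Y y) = fieldCoord x (fun y ↦ F y (Y y)) y := by
  have hb : y ∈ (trivializationAt (EuclideanSpace ℝ (Fin m))
      (TangentSpace (𝓡 m) : M → Type _) x).baseSet := by simpa using hy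
  rw [fieldCoord_eq_continuousLinearMapAt Y hy, fieldCoord_eq_continuousLinearMapAt _ hy, endCoord,
    ContinuousLinearMap.inCoordinates, ContinuousLinearMap.comp_apply,
    ContinuousLinearMap.comp_apply, Trivialization.symmL_continuousLinearMapAt _ hb]

lemma fieldCoord_self (Y : ∀ y : M, TangentSpace (𝓡 m) y) : fieldCoord x Y x = Y x := by
  rw [fieldCoord_eq_mfderiv Y (mem_chart_source _ x), mfderiv_extChartAt_self]
  rfl

lemma inCoordinates_self (B : TangentSpace (𝓡 m) x →L[ℝ] TangentSpace (𝓡 m) x) :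
    ContinuousLinearMap.inCoordinates (EuclideanSpace ℝ (Fin m)) (TangentSpace (𝓡 m) : M → Type _)
      (EuclideanSpace ℝ (Fin m)) (TangentSpace (𝓡 m) : M → Type _) x x x x B = B := by
  have h1 := TangentBundle.continuousLinearMapAt_trivializationAt (I := 𝓡 m) (mem_chart_source
    (EuclideanSpace ℝ (Fin m)) x)
  have h2 := TangentBundle.symmL_trivializationAt (I := 𝓡 m) (mem_chart_source
    (EuclideanSpace ℝ (Fin m)) x)
  have h3 := h1.trans mfderiv_extChartAt_self
  have h4 := h2.trans mfderivWithin_range_extChartAt_symm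
  ext1 v
  have h5 := congrArg (fun T ↦ T v) h4
  rw [ContinuousLinearMap.inCoordinates, ContinuousLinearMap.comp_apply,
    ContinuousLinearMap.comp_apply]
  have h6 : ∀ u : TangentSpace (𝓡 m) x, (trivializationAt (EuclideanSpace ℝ (Fin m))
      (TangentSpace (𝓡 m) : M → Type _) x).continuousLinearMapAt ℝ x u = u :=
    fun u ↦ congrArg (fun T ↦ T u) h3
  exact (h6 _).trans (congrArg B h5)

lemma endCoord_self (F : EndField (𝓡 m) M) : endCoord x F x = F x := inCoordinates_self _

lemma fieldCoord_extend (v : TangentSpace (𝓡 m) x) {y : M}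
    (hy : y ∈ (chartAt (EuclideanSpace ℝ (Fin m)) x).source) :
    fieldCoord x (extend (EuclideanSpace ℝ (Fin m)) v) y = v := by
  have h : fieldCoord x (extend (EuclideanSpace ℝ (Fin m)) v) y =
      fieldCoord x (extend (EuclideanSpace ℝ (Fin m)) v) x := by
    have hb : y ∈ (trivializationAt (EuclideanSpace ℝ (Fin m))
      (TangentSpace (𝓡 m) : M → Type _) x).baseSet := by simpa using hy
    have hb' : x ∈ (trivializationAt (EuclideanSpace ℝ (Fin m))
      (TangentSpace (𝓡 m) : M → Type _) x).baseSet := by simp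
    simp only [fieldCoord, extend]
    rw [Trivialization.apply_mk_symm _ hb, Trivialization.apply_mk_symm _ hb']
  rw [h, fieldCoord_self, extend_apply_self]

lemma mdifferentiableAt_fieldCoord {Y : ∀ y : M, TangentSpace (𝓡 m) y}
    (hY : DiffFieldAt Y x) :
    MDifferentiableAt (𝓡 m) 𝓘(ℝ, EuclideanSpace ℝ (Fin m)) (fieldCoord x Y) x :=
  (mdifferentiableAt_section _ _).1 hY

lemma SmoothEndAt.contMDiffAt_endCoord {F : EndField (𝓡 m) M} (hF : SmoothEndAt F x) :
    ContMDiffAt (𝓡 m) 𝓘(ℝ, EuclideanSpace ℝ (Fin m) →L[ℝ] EuclideanSpace ℝ (Fin m)) ∞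
      (endCoord x F) x :=
  ((contMDiffAt_hom_bundle _).1 hF).2

lemma SmoothEndAt.mdifferentiableAt_endCoord {F : EndField (𝓡 m) M} (hF : SmoothEndAt F x) :
    MDifferentiableAt (𝓡 m) 𝓘(ℝ, EuclideanSpace ℝ (Fin m) →L[ℝ] EuclideanSpace ℝ (Fin m))
      (endCoord x F) x :=
  hF.contMDiffAt_endCoord.mdifferentiableAt (by simp)

lemma fieldCoord_add (Y Z : ∀ y : M, TangentSpace (𝓡 m) y) {y : M}
    (hy : y ∈ (chartAt (EuclideanSpace ℝ (Fin m)) x).source) :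
    fieldCoord x (Y + Z) y = fieldCoord x Y y + fieldCoord x Z y := by
  simp only [fieldCoord_eq_mfderiv _ hy, Pi.add_apply, map_add]
  rfl

lemma fieldCoord_smul (f : M → ℝ) (Y : ∀ y : M, TangentSpace (𝓡 m) y) {y : M}
    (hy : y ∈ (chartAt (EuclideanSpace ℝ (Fin m)) x).source) :
    fieldCoord x (f • Y) y = f y • fieldCoord x Y y := by
  simp only [fieldCoord_eq_mfderiv _ hy, Pi.smul_apply', map_smul]
  rfl

omit [IsManifold (𝓡 m) ∞ M] in
lemma eventually_mem_chart_source (x : M) :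
    ∀ᶠ y in nhds x, y ∈ (chartAt (EuclideanSpace ℝ (Fin m)) x).source :=
  chart_source_mem_nhds _ x

omit [IsManifold (𝓡 m) ∞ M] in
lemma mvfderiv_congr {G : Type*} [NormedAddCommGroup G] [NormedSpace ℝ G] {f g : M → G}
    (h : f =ᶠ[nhds x] g) : mvfderiv (𝓡 m) f x = mvfderiv (𝓡 m) g x := by
  ext v
  simp only [mvfderiv, ContinuousLinearMap.comp_apply]
  rw [h.mfderiv_eq]
  rfl

/-- The derivative at `x` of a vector field, in the preferred chart at `x`. -/
def flatD (x : M) (Y : ∀ y : M, TangentSpace (𝓡 m) y) :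
    TangentSpace (𝓡 m) x →L[ℝ] TangentSpace (𝓡 m) x :=
  mvfderiv (𝓡 m) (fieldCoord x Y) x

/-- The derivative at `x`, along `X`, of a field of endomorphisms, in the preferred chart
at `x`. -/
def endD (x : M) (F : EndField (𝓡 m) M) (X : TangentSpace (𝓡 m) x) :
    TangentSpace (𝓡 m) x →L[ℝ] TangentSpace (𝓡 m) x :=
  mvfderiv (𝓡 m) (endCoord x F) x X

lemma flatD_add {Y Z : ∀ y : M, TangentSpace (𝓡 m) y} (hY : DiffFieldAt Y x)
    (hZ : DiffFieldAt Z x) : flatD x (Y + Z) = flatD x Y + flatD x Z := by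
  have h2 : fieldCoord x (Y + Z) =ᶠ[nhds x] fieldCoord x Y + fieldCoord x Z :=
    (eventually_mem_chart_source x).mono fun y hy ↦ fieldCoord_add Y Z hy
  exact (mvfderiv_congr h2).trans (mvfderiv_add (mdifferentiableAt_fieldCoord hY)
    (mdifferentiableAt_fieldCoord hZ))

lemma flatD_smul {f : M → ℝ} {Y : ∀ y : M, TangentSpace (𝓡 m) y}
    (hf : MDifferentiableAt (𝓡 m) 𝓘(ℝ, ℝ) f x) (hY : DiffFieldAt Y x) :
    flatD x (f • Y) = f x • flatD x Y + (mvfderiv (𝓡 m) f x).smulRight (Y x) := by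
  have h2 : fieldCoord x (f • Y) =ᶠ[nhds x] f • fieldCoord x Y :=
    (eventually_mem_chart_source x).mono fun y hy ↦ fieldCoord_smul f Y hy
  have h3 := (mvfderiv_congr h2).trans (mvfderiv_smul hf (mdifferentiableAt_fieldCoord hY))
  rw [fieldCoord_self] at h3
  exact h3

lemma flatD_extend (v : TangentSpace (𝓡 m) x) :
    flatD x (extend (EuclideanSpace ℝ (Fin m)) v) = 0 := by
  have h : fieldCoord x (extend (EuclideanSpace ℝ (Fin m)) v) =ᶠ[nhds x]
      fun _ ↦ (show EuclideanSpace ℝ (Fin m) from v) :=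
    (eventually_mem_chart_source x).mono fun y hy ↦ fieldCoord_extend v hy
  exact (mvfderiv_congr h).trans (mvfderiv_const _)

lemma flatD_apply_extend {F : EndField (𝓡 m) M} (hF : SmoothEndAt F x)
    (X v : TangentSpace (𝓡 m) x) :
    flatD x (fun y ↦ F y (extend (EuclideanSpace ℝ (Fin m)) v y)) X = endD x F X v := by
  have h2 : fieldCoord x (fun y ↦ F y (extend (EuclideanSpace ℝ (Fin m)) v y)) =ᶠ[nhds x]
      fun y ↦ endCoord x F y (show EuclideanSpace ℝ (Fin m) from v) :=
    (eventually_mem_chart_source x).mono fun y hy ↦ by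
      rw [← endCoord_apply F _ hy, fieldCoord_extend v hy]
  have h3 := ((ContinuousLinearMap.apply ℝ (EuclideanSpace ℝ (Fin m))
    (show EuclideanSpace ℝ (Fin m) from v)).hasMFDerivAt (x := endCoord x F x)).comp x
    hF.mdifferentiableAt_endCoord.hasMFDerivAt
  exact (congrArg (fun T ↦ T X) (mvfderiv_congr h2)).trans (congrArg (fun T ↦ T X) h3.mfderiv)

namespace WeylSpace

variable (w : WeylSpace m M)

lemma tensorialAt_christoffel (x : M) : TensorialAt (𝓡 m) (EuclideanSpace ℝ (Fin m))
    (fun Y : ∀ y : M, TangentSpace (𝓡 m) y ↦ w.D Y x - flatD x Y) x where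
  smul {f Y} hf hY := by
    have h1 := w.D.isCovariantDerivativeOnUniv.leibniz hY hf
    rw [h1, flatD_smul hf hY, smul_sub]
    exact add_sub_add_right_eq_sub ..
  add {Y Z} hY hZ := by
    have h1 : w.D (Y + Z) x = w.D Y x + w.D Z x := w.D_add hY hZ
    rw [h1, flatD_add hY hZ]
    exact add_sub_add_comm ..

/-- The Christoffel tensor, at `x`, of the Weyl connection, with respect to the preferred chart
at `x`. -/
def christoffel (x : M) :
    TangentSpace (𝓡 m) x →L[ℝ] TangentSpace (𝓡 m) x →L[ℝ] TangentSpace (𝓡 m) x :=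
  TensorialAt.mkHom _ x (w.tensorialAt_christoffel x)

lemma D_eq_add_christoffel {Y : ∀ y : M, TangentSpace (𝓡 m) y} (hY : DiffFieldAt Y x)
    (X : TangentSpace (𝓡 m) x) :
    w.D Y x X = flatD x Y X + w.christoffel x (Y x) X := by
  have := TensorialAt.mkHom_apply (w.tensorialAt_christoffel x) hY
  have h2 := congrArg (fun T ↦ T X) this
  rw [christoffel, h2, sub_apply]
  abel

lemma D_extend (v X : TangentSpace (𝓡 m) x) :
    w.D (extend (EuclideanSpace ℝ (Fin m)) v) x X = w.christoffel x v X := by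
  rw [w.D_eq_add_christoffel (smoothFieldAt_extend v).diff, flatD_extend, extend_apply_self]
  simp

/-- The classical formula `D_X F = ∂_X F + [Γ_X, F]`, obtained from the field extending `v`, which
is constant in the chart. -/
lemma nabla_eq {F : EndField (𝓡 m) M} (hF : SmoothEndAt F x) (X v : TangentSpace (𝓡 m) x) :
    w.nabla hF X v = endD x F X v +
      w.christoffel x (F x v) X - F x (w.christoffel x v X) := by
  have sv : DiffFieldAt (extend (EuclideanSpace ℝ (Fin m)) v) x := (smoothFieldAt_extend v).diff
  have h1 := w.D_apply hF sv X
  rw [w.D_extend, w.D_eq_add_christoffel (hF.apply_diff sv), extend_apply_self,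
    flatD_apply_extend hF] at h1
  rw [h1]
  abel

end WeylSpace

/-! ### The tangent space of the bundle of endomorphisms -/

lemma extChartAt_endBundle (q q' : EndBundle m M) :
    extChartAt (endModel m) q q' = (extChartAt (𝓡 m) q.1 q'.1,
      ContinuousLinearMap.inCoordinates (EuclideanSpace ℝ (Fin m))
        (TangentSpace (𝓡 m) : M → Type _) (EuclideanSpace ℝ (Fin m))
        (TangentSpace (𝓡 m) : M → Type _) q.1 q'.1 q.1 q'.1 q'.2) := by
  rw [FiberBundle.extChartAt]
  rfl

/-- Tangent vectors at a point of `End(TM)` are read in the preferred chart as pairs in `E × End E`.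
There a section is a graph, which gives both components of its differential. -/
lemma mfderiv_section_apply {F : EndField (𝓡 m) M} (hF : SmoothEndAt F x)
    (X : TangentSpace (𝓡 m) x) :
    mfderiv (𝓡 m) (endModel m) (fun y ↦ (⟨y, F y⟩ : EndBundle m M)) x X =
      ((X, mvfderiv (𝓡 m) (endCoord x F) x X) : EuclideanSpace ℝ (Fin m) ×
        (EuclideanSpace ℝ (Fin m) →L[ℝ] EuclideanSpace ℝ (Fin m))) := by
  have h1 := hF.mdifferentiableAt_endCoord.hasMFDerivAt
  have h2 : HasMFDerivAt (𝓡 m) (endModel m) (fun y ↦ (⟨y, F y⟩ : EndBundle m M)) x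
      ((ContinuousLinearMap.id ℝ (EuclideanSpace ℝ (Fin m))).prod
        (mvfderiv (𝓡 m) (endCoord x F) x)) := by
    refine ⟨hF.continuousAt, ?_⟩
    have h3 := (hasFDerivWithinAt_id (𝕜 := ℝ) (extChartAt (𝓡 m) x x) (Set.range (𝓡 m))).prodMk h1.2
    refine h3.congr_of_eventuallyEq ?_ ?_
    · filter_upwards [extChartAt_target_mem_nhdsWithin (I := 𝓡 m) x] with z hz
      simp only [writtenInExtChartAt, Function.comp_apply]
      rw [extChartAt_endBundle, (extChartAt (𝓡 m) x).right_inv hz]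
      rfl
    · simp only [writtenInExtChartAt, Function.comp_apply]
      rw [extChartAt_endBundle, extChartAt_to_inv]
      rfl
  rw [h2.mfderiv]
  rfl

lemma mfderiv_proj_apply (q : EndBundle m M) (Z : TangentSpace (endModel m) q) :
    mfderiv (endModel m) (𝓡 m) (TotalSpace.proj : EndBundle m M → M) q Z =
      (show EuclideanSpace ℝ (Fin m) × (EuclideanSpace ℝ (Fin m) →L[ℝ] EuclideanSpace ℝ (Fin m))
        from Z).1 := by
  have h2 : HasMFDerivAt (endModel m) (𝓡 m) (TotalSpace.proj : EndBundle m M → M) q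
      (ContinuousLinearMap.fst ℝ (EuclideanSpace ℝ (Fin m))
        (EuclideanSpace ℝ (Fin m) →L[ℝ] EuclideanSpace ℝ (Fin m))) := by
    refine ⟨(FiberBundle.continuous_proj _ _).continuousAt, ?_⟩
    refine (hasFDerivWithinAt_fst (𝕜 := ℝ)).congr_of_eventuallyEq ?_ ?_
    · filter_upwards [extChartAt_target_mem_nhdsWithin (I := endModel m) q] with z hz
      have h3 := congrArg Prod.fst (extChartAt_endBundle q ((extChartAt (endModel m) q).symm z))
      rw [(extChartAt (endModel m) q).right_inv hz] at h3
      exact h3.symm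
    · have h3 := congrArg Prod.fst (extChartAt_endBundle q q)
      simp only [writtenInExtChartAt, Function.comp_apply, extChartAt_to_inv]
      exact h3.symm
  rw [h2.mfderiv]
  rfl

lemma vertical_eq (q : EndBundle m M) (A : TangentSpace (𝓡 m) q.1 →L[ℝ] TangentSpace (𝓡 m) q.1) :
    q.vertical A = ((0, A) : EuclideanSpace ℝ (Fin m) ×
        (EuclideanSpace ℝ (Fin m) →L[ℝ] EuclideanSpace ℝ (Fin m))) := by
  have hin : ∀ B : EuclideanSpace ℝ (Fin m) →L[ℝ] EuclideanSpace ℝ (Fin m),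
      extChartAt (endModel m) q (⟨q.1, B⟩ : EndBundle m M) = (extChartAt (𝓡 m) q.1 q.1, B) := by
    intro B
    rw [extChartAt_endBundle]
    exact congrArg (Prod.mk _) (inCoordinates_self _)
  have h2 : HasMFDerivAt 𝓘(ℝ, EuclideanSpace ℝ (Fin m) →L[ℝ] EuclideanSpace ℝ (Fin m)) (endModel m)
      (fun B : EuclideanSpace ℝ (Fin m) →L[ℝ] EuclideanSpace ℝ (Fin m) ↦
        (⟨q.1, B⟩ : EndBundle m M))
      (show EuclideanSpace ℝ (Fin m) →L[ℝ] EuclideanSpace ℝ (Fin m) from q.2)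
      (ContinuousLinearMap.inr ℝ (EuclideanSpace ℝ (Fin m))
        (EuclideanSpace ℝ (Fin m) →L[ℝ] EuclideanSpace ℝ (Fin m))) := by
    refine ⟨?_, ?_⟩
    · exact (FiberBundle.continuous_totalSpaceMk (EuclideanSpace ℝ (Fin m) →L[ℝ] EuclideanSpace ℝ (Fin m))
        (fun x : M ↦ TangentSpace (𝓡 m) x →L[ℝ] TangentSpace (𝓡 m) x) q.1).continuousAt
    · have h3 := ((hasFDerivAt_const (𝕜 := ℝ) (extChartAt (𝓡 m) q.1 q.1)
        (show EuclideanSpace ℝ (Fin m) →L[ℝ] EuclideanSpace ℝ (Fin m) from q.2)).prodMk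
        (hasFDerivAt_id _)).hasFDerivWithinAt (s := Set.range 𝓘(ℝ, EuclideanSpace ℝ (Fin m) →L[ℝ] EuclideanSpace ℝ (Fin m)))
      refine (h3.congr_of_eventuallyEq (Filter.Eventually.of_forall fun B ↦ ?_) ?_)
      · exact hin B
      · exact hin _
  rw [EndBundle.vertical, h2.mfderiv]
  rfl

end Coordinates

end

/-! ### The twistor distribution, and holomorphicity of a section as a first-order condition on `F`
-/

noncomputable section

section Twistor

open FiberBundle

variable {m : ℕ} {M : Type*} [TopologicalSpace M] [ChartedSpace (EuclideanSpace ℝ (Fin m)) M]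
  [IsManifold (𝓡 m) ∞ M] {x : M}

lemma endD_eq_of {F G : EndField (𝓡 m) M} (hF : SmoothEndAt F x) (hG : SmoothEndAt G x)
    {f : M → ℝ} (hf : MDifferentiableAt (𝓡 m) 𝓘(ℝ, ℝ) f x) (hfx : f x = 0)
    (X : TangentSpace (𝓡 m) x) :
    endD x (fun y ↦ F y - f y • G y) X = endD x F X - mvfderiv (𝓡 m) f x X • G x := by
  have h1 : endCoord x (fun y ↦ F y - f y • G y) = endCoord x F - f • endCoord x G := by
    ext1 y
    ext1 v
    simp only [endCoord, ContinuousLinearMap.inCoordinates, ContinuousLinearMap.comp_apply,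
      sub_apply, smul_apply, map_sub, map_smul, Pi.sub_apply, Pi.smul_apply']
  have h2 := hF.mdifferentiableAt_endCoord
  have h3 := hG.mdifferentiableAt_endCoord
  have h4 : mvfderiv (𝓡 m) (endCoord x F - f • endCoord x G) x X =
      mvfderiv (𝓡 m) (endCoord x F) x X - mvfderiv (𝓡 m) f x X • endCoord x G x := by
    have h5 : MDifferentiableAt (𝓡 m)
      𝓘(ℝ, EuclideanSpace ℝ (Fin m) →L[ℝ] EuclideanSpace ℝ (Fin m)) (f • endCoord x G) x :=
      hf.smul h3
    rw [mvfderiv_sub h2 h5, mvfderiv_smul hf h3, hfx]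
    simp
  rw [← h1, endCoord_self] at h4
  exact h4

lemma exists_mvfderiv_eq_one {X : TangentSpace (𝓡 m) x} (hX : X ≠ 0) :
    ∃ f : M → ℝ, ContMDiffAt (𝓡 m) 𝓘(ℝ, ℝ) ∞ f x ∧ f x = 0 ∧ mvfderiv (𝓡 m) f x X = 1 := by
  obtain ⟨l, hl⟩ : ∃ l : EuclideanSpace ℝ (Fin m) →L[ℝ] ℝ, l X = 1 := by
    let X' : EuclideanSpace ℝ (Fin m) := X
    exact SeparatingDual.exists_eq_one (R := ℝ) (x := X') hX
  have h0 : ContMDiffAt (𝓡 m) 𝓘(ℝ, EuclideanSpace ℝ (Fin m)) ∞ (extChartAt (𝓡 m) x) x :=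
    contMDiffAt_extChartAt
  have h1 : ContMDiffAt (𝓡 m) 𝓘(ℝ, ℝ) ∞ (fun y ↦ l (extChartAt (𝓡 m) x y)) x :=
    l.contMDiff.contMDiffAt.comp x h0
  refine ⟨(fun y ↦ l (extChartAt (𝓡 m) x y)) - fun _ ↦ l (extChartAt (𝓡 m) x x),
    h1.sub contMDiffAt_const, by simp, ?_⟩
  rw [mvfderiv_sub (h1.mdifferentiableAt (by simp)) mdifferentiableAt_const, mvfderiv_const,
    sub_zero]
  have h3 := (l.hasMFDerivAt (x := extChartAt (𝓡 m) x x)).comp x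
    (h0.mdifferentiableAt (by simp)).hasMFDerivAt
  have h4 := congrArg (fun T ↦ T X) h3.mfderiv
  have h5 : mfderiv (𝓡 m) 𝓘(ℝ, EuclideanSpace ℝ (Fin m)) (extChartAt (𝓡 m) x) x X = X :=
    congrArg (fun T ↦ T X) (mfderiv_extChartAt_self (I := 𝓡 m) (x := x))
  refine Eq.trans h4 (Eq.trans ?_ hl)
  exact congrArg l h5

namespace WeylSpace

variable (w : WeylSpace m M)

/-- The covariant derivative, as a continuous linear map. -/
def nablaCLM {F : EndField (𝓡 m) M} (hF : SmoothEndAt F x) (X : TangentSpace (𝓡 m) x) :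
    TangentSpace (𝓡 m) x →L[ℝ] TangentSpace (𝓡 m) x where
  toLinearMap := w.nabla hF X
  cont := (show EuclideanSpace ℝ (Fin m) →ₗ[ℝ] EuclideanSpace ℝ (Fin m) from
    w.nabla hF X).continuous_of_finiteDimensional

/-- The horizontal part of a tangent vector of `End(TM)`, in the preferred chart. -/
def _root_.EndBundle.fstCoord (q : EndBundle m M) :
    TangentSpace (endModel m) q →ₗ[ℝ] TangentSpace (𝓡 m) q.1 :=
  LinearMap.fst ℝ (EuclideanSpace ℝ (Fin m))
    (EuclideanSpace ℝ (Fin m) →L[ℝ] EuclideanSpace ℝ (Fin m))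

/-- The vertical part of a tangent vector of `End(TM)`, in the preferred chart. -/
def _root_.EndBundle.sndCoord (q : EndBundle m M) :
    TangentSpace (endModel m) q →ₗ[ℝ] (TangentSpace (𝓡 m) q.1 →L[ℝ] TangentSpace (𝓡 m) q.1) :=
  LinearMap.snd ℝ (EuclideanSpace ℝ (Fin m))
    (EuclideanSpace ℝ (Fin m) →L[ℝ] EuclideanSpace ℝ (Fin m))

/-- The Christoffel tensor, as a linear map depending linearly on the direction of derivation. -/
def christoffelLin (x : M) :
    TangentSpace (𝓡 m) x →ₗ[ℝ] TangentSpace (𝓡 m) x →ₗ[ℝ] TangentSpace (𝓡 m) x :=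
  LinearMap.mk₂ ℝ (fun X v ↦ w.christoffel x v X) (by simp) (by simp) (by simp) (by simp)

/-- The projection, with kernel the horizontal space, of the tangent space of `End(TM)` onto the
vertical one. -/
def connectionMap (q : EndBundle m M) : TangentSpace (endModel m) q →ₗ[ℝ]
    (TangentSpace (𝓡 m) q.1 →ₗ[ℝ] TangentSpace (𝓡 m) q.1) where
  toFun Z := (q.sndCoord Z : TangentSpace (𝓡 m) q.1 →ₗ[ℝ] TangentSpace (𝓡 m) q.1) +
    w.christoffelLin q.1 (q.fstCoord Z) ∘ₗ q.toLin - q.toLin ∘ₗ w.christoffelLin q.1 (q.fstCoord Z)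
  map_add' Z Z' := by
    ext v
    simp only [map_add, LinearMap.add_apply, LinearMap.sub_apply, LinearMap.comp_apply,
      ContinuousLinearMap.coe_coe, add_apply]
    abel
  map_smul' c Z := by
    ext v
    simp only [map_smul, LinearMap.add_apply, LinearMap.sub_apply, LinearMap.comp_apply,
      ContinuousLinearMap.coe_coe, smul_apply, LinearMap.smul_apply, RingHom.id_apply, smul_add,
      smul_sub]

lemma connectionMap_section {F : EndField (𝓡 m) M} (hF : SmoothEndAt F x)
    (X : TangentSpace (𝓡 m) x) :
    w.connectionMap ⟨x, F x⟩
      (mfderiv (𝓡 m) (endModel m) (fun y ↦ (⟨y, F y⟩ : EndBundle m M)) x X) = w.nabla hF X := by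
  rw [mfderiv_section_apply hF]
  ext v
  exact (w.nabla_eq hF X v).symm

lemma connectionMap_vertical (q : EndBundle m M)
    (A : TangentSpace (𝓡 m) q.1 →L[ℝ] TangentSpace (𝓡 m) q.1) :
    w.connectionMap q (q.vertical A) = A := by
  rw [vertical_eq]
  ext v
  have h : w.connectionMap q ((0, A) : EuclideanSpace ℝ (Fin m) × (EuclideanSpace ℝ (Fin m) →L[ℝ]
      EuclideanSpace ℝ (Fin m))) v = A v + w.christoffelLin q.1 0 (q.toLin v) -
        q.toLin (w.christoffelLin q.1 0 v) := rfl
  refine h.trans ?_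
  simp

/-- On each generator `dσ(X)`, the connection map gives `D_X σ`, which vanishes by parallelism. -/
lemma horizontal_le_ker (q : EndBundle m M) :
    w.horizontal q ≤ LinearMap.ker (w.connectionMap q) := by
  obtain ⟨x, B⟩ := q
  rw [horizontal, Submodule.span_le]
  rintro Z ⟨σ, hσ, X, hsm, hpar, rfl⟩
  obtain rfl : σ x = B := eq_of_heq (TotalSpace.mk.inj hσ).2
  exact (w.connectionMap_section hsm X).trans ((w.isParallelAt_iff hsm X).1 hpar)

/-- A horizontal vector has to be exhibited through a section parallel along `X`. For `X ≠ 0`, take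
`f` with `f x = 0` and `df(X) = 1`, and `G` extending `D_X F`: then `σ = F - f G` passes through `F
x`, has `D_X σ = 0`, and `dσ(X)` differs from `dF(X)` by the vertical lift of `D_X F`. -/
lemma mfderiv_sub_vertical_mem_horizontal {F : EndField (𝓡 m) M} (hF : SmoothEndAt F x)
    (X : TangentSpace (𝓡 m) x) :
    mfderiv (𝓡 m) (endModel m) (fun y ↦ (⟨y, F y⟩ : EndBundle m M)) x X -
      EndBundle.vertical ⟨x, F x⟩ (w.nablaCLM hF X) ∈ w.horizontal ⟨x, F x⟩ := by
  rcases eq_or_ne X 0 with rfl | hX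
  · have h0 : w.nablaCLM hF 0 = 0 := by
      ext v
      have := w.nabla_add hF 0 0
      have h1 : w.nabla hF 0 = 0 := by simpa using this
      exact congrArg (fun T ↦ T v) h1
    have e1 : mfderiv (𝓡 m) (endModel m) (fun y ↦ (⟨y, F y⟩ : EndBundle m M)) x 0 = 0 :=
      ContinuousLinearMap.map_zero _
    have e2 : EndBundle.vertical ⟨x, F x⟩ (0 : TangentSpace (𝓡 m) x →L[ℝ] TangentSpace (𝓡 m) x) = 0 :=
      (vertical_eq _ _).trans rfl
    rw [h0, e1, e2, sub_zero]
    exact Submodule.zero_mem _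
  obtain ⟨f, hf, hfx, hfX⟩ := exists_mvfderiv_eq_one hX
  have hfd : MDifferentiableAt (𝓡 m) 𝓘(ℝ, ℝ) f x := hf.mdifferentiableAt (by simp)
  set G : EndField (𝓡 m) M := extend (EuclideanSpace ℝ (Fin m) →L[ℝ] EuclideanSpace ℝ (Fin m))
    (E := fun x : M ↦ TangentSpace (𝓡 m) x →L[ℝ] TangentSpace (𝓡 m) x) (w.nablaCLM hF X) with hG
  have sG : SmoothEndAt G x := contMDiffAt_extend (𝓡 m)
    (EuclideanSpace ℝ (Fin m) →L[ℝ] EuclideanSpace ℝ (Fin m)) _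
  have hGx : G x = w.nablaCLM hF X := extend_apply_self ..
  have sσ : SmoothEndAt (fun y ↦ F y - f y • G y) x :=
    ContMDiffAt.sub_section hF (ContMDiffAt.smul_section hf sG)
  have hσx : F x - f x • G x = F x := by rw [hfx, zero_smul, sub_zero]
  have hD := endD_eq_of hF sG hfd hfx X
  rw [hfX, one_smul, hGx] at hD
  refine Submodule.subset_span ⟨fun y ↦ F y - f y • G y, ?_, X, sσ, ?_, ?_⟩
  · exact congrArg (fun B ↦ (⟨x, B⟩ : EndBundle m M)) hσx
  · refine (w.isParallelAt_iff sσ X).2 ?_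
    ext v
    rw [w.nabla_eq sσ, hD, hσx, sub_apply]
    have h2 : w.nablaCLM hF X v = w.nabla hF X v := rfl
    rw [h2, w.nabla_eq hF, LinearMap.zero_apply]
    abel
  · rw [mfderiv_section_apply hF, vertical_eq, mfderiv_section_apply sσ]
    refine Prod.ext ?_ ?_
    · exact sub_zero _
    · exact hD.symm

/-- The endomorphisms, of the complexified tangent space, which vanish on the `-i` eigenspace
of `F`. -/
def _root_.vanishingOn {V : Type*} [AddCommGroup V] [Module ℝ V] (F : V →ₗ[ℝ] V) :
    Submodule ℂ (ℂ ⊗[ℝ] (V →ₗ[ℝ] V)) where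
  carrier := {C | ∀ v, F (F v) = -v → complexRe _ C v = complexIm _ C (F v)}
  add_mem' {C C'} h h' v hv := by
    simp only [map_add, LinearMap.add_apply, h v hv, h' v hv]
  zero_mem' v hv := by simp
  smul_mem' z C h v hv := by
    obtain ⟨A, B, rfl⟩ := exists_eq_complexVector C
    have h1 := h v hv
    have h2 := h (F v) (by rw [hv, map_neg])
    simp only [complexRe_complexVector, complexIm_complexVector, hv, map_neg] at h1 h2
    simp only [smul_complexVector, complexRe_complexVector, complexIm_complexVector,
      LinearMap.add_apply, LinearMap.sub_apply, LinearMap.smul_apply, h1, h2]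
    module

lemma _root_.complexVector_mem_vanishingOn {V : Type*} [AddCommGroup V] [Module ℝ V]
    {F A B : V →ₗ[ℝ] V} :
    complexVector A B ∈ vanishingOn F ↔ ∀ v, F (F v) = -v → A v = B (F v) := by
  change (∀ v, F (F v) = -v → complexRe _ (complexVector A B) v =
    complexIm _ (complexVector A B) (F v)) ↔ _
  simp

omit [IsManifold (𝓡 m) ∞ M] in
lemma complexify_complexVector (A : TangentSpace (𝓡 m) x →L[ℝ] TangentSpace (𝓡 m) x)
    (X Y : TangentSpace (𝓡 m) x) :
    EndBundle.complexify A (complexVector X Y) = complexVector (A X) (A Y) :=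
  baseChange_complexVector _ X Y

/-- Let `w = v + i F v` be the eigenvector. Eliminating `F u` from the two equations of the
definition leaves `B w = i A w`, that is, `A + i B` kills the isotropic space. The point is to have
at least one `u` to which the definition applies. -/
lemma apply_eq_of_isFibreComplexStructure {F A B : TangentSpace (𝓡 m) x →L[ℝ] TangentSpace (𝓡 m) x}
    (hA : w.IsFibreTangent ⟨x, F⟩ A) (hAB : IsFibreComplexStructure ⟨x, F⟩ A B)
    {v : TangentSpace (𝓡 m) x} (hv : F (F v) = -v) : A v = B (F v) := by
  have lin : ∀ v, F (F v) = -v → F (A (F v)) + F (F (A v)) = 0 := fun v hv ↦ by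
    have h1 := congrArg (fun T ↦ T v) hA.1
    simp only [add_apply, ContinuousLinearMap.comp_apply, zero_apply] at h1
    rw [hv, map_neg] at h1
    linear_combination (norm := module) h1
  have l1 := lin v hv
  have l2 := lin (F v) (by rw [hv, map_neg])
  rw [hv, map_neg, map_neg] at l2
  -- The solution is `u = i A w - ½ F (A w)`, with `w = v + i F v`; it works because `lin` gives `F²
  -- A w = i F A w`.
  have h := hAB (complexVector v (F v))
    (complexVector_mem_complexEigenspace_neg_I.2 ⟨rfl, hv⟩)
    (complexVector (-(1 / 2 : ℝ) • (F (A v)) - A (F v)) (-(1 / 2 : ℝ) • (F (A (F v))) + A v)) ?_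
  · simp only [complexify_complexVector, I_smul_complexVector, neg_I_smul_complexVector,
      complexVector_add, complexVector_inj, map_add, map_neg, map_smul, map_sub] at h
    linear_combination (norm := module) -h.2 - (1 / 2 : ℝ) • l1
  · simp only [complexify_complexVector, neg_I_smul_complexVector,
      complexVector_add, complexVector_inj, map_add, map_smul, map_sub]
    constructor
    · linear_combination (norm := module) (-1 / 2 : ℝ) • l1
    · linear_combination (norm := module) (-1 / 2 : ℝ) • l2

lemma isFibreComplexStructure_of {F A B : TangentSpace (𝓡 m) x →L[ℝ] TangentSpace (𝓡 m) x}
    (h : ∀ v, F (F v) = -v → A v = B (F v)) : IsFibreComplexStructure ⟨x, F⟩ A B := by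
  intro Z hZ u hu
  obtain ⟨X, Y, rfl⟩ := exists_eq_complexVector Z
  obtain ⟨hX, hY⟩ := complexVector_mem_complexEigenspace_neg_I.1 hZ
  obtain ⟨u₁, u₂, rfl⟩ := exists_eq_complexVector u
  change F X = Y at hX
  change F Y = -X at hY
  have h1 := h X (by rw [hX, hY])
  have h2 := h Y (by rw [hY, map_neg, hX])
  rw [hX] at h1
  rw [hY, map_neg] at h2
  simp only [complexify_complexVector, I_smul_complexVector, neg_I_smul_complexVector,
      complexVector_add, complexVector_inj, map_neg] at hu ⊢
  constructor
  · linear_combination (norm := module) -hu.2 + h2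
  · linear_combination (norm := module) hu.1 - h1

/-- Vertical parts of horizontal vectors are zero and those of type `(0,1)` kill the isotropic
space. So the connection map extracts from a vector of the twistor distribution exactly the
condition on `D F`. -/
lemma twistorDistribution_le {F : TangentSpace (𝓡 m) x →L[ℝ] TangentSpace (𝓡 m) x} :
    w.twistorDistribution ⟨x, F⟩ ≤ (vanishingOn (F : TangentSpace (𝓡 m) x →ₗ[ℝ]
      TangentSpace (𝓡 m) x)).comap ((w.connectionMap ⟨x, F⟩).baseChange ℂ) := by
  have hhor : (w.horizontal ⟨x, F⟩).baseChange ℂ ≤ (vanishingOn (F : TangentSpace (𝓡 m) x →ₗ[ℝ]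
      TangentSpace (𝓡 m) x)).comap ((w.connectionMap ⟨x, F⟩).baseChange ℂ) := by
    rw [Submodule.baseChange_eq_span, Submodule.span_le]
    rintro _ ⟨Z, hZ, rfl⟩
    have h0 : w.connectionMap ⟨x, F⟩ Z = 0 := w.horizontal_le_ker ⟨x, F⟩ hZ
    simp [h0]
  refine sup_le (inf_le_left.trans hhor) (sup_le (inf_le_left.trans hhor) ?_)
  rw [vertical01, Submodule.span_le]
  rintro _ ⟨A, B, hA, hB, hAB, rfl⟩
  rw [SetLike.mem_coe, Submodule.mem_comap, baseChange_complexVector, connectionMap_vertical,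
    connectionMap_vertical, complexVector_mem_vanishingOn]
  intro v hv
  exact w.apply_eq_of_isFibreComplexStructure hA hAB hv

lemma complexVector_sub_mem_horizontalEigenspace {F : EndField (𝓡 m) M} (hF : SmoothEndAt F x)
    {z : ℂ} {X Y : TangentSpace (𝓡 m) x} (hXY : complexVector X Y ∈
      complexEigenspace (F x : TangentSpace (𝓡 m) x →ₗ[ℝ] TangentSpace (𝓡 m) x) z) :
    complexVector (mfderiv (𝓡 m) (endModel m) (fun y ↦ (⟨y, F y⟩ : EndBundle m M)) x X -
      EndBundle.vertical ⟨x, F x⟩ (w.nablaCLM hF X))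
      (mfderiv (𝓡 m) (endModel m) (fun y ↦ (⟨y, F y⟩ : EndBundle m M)) x Y -
      EndBundle.vertical ⟨x, F x⟩ (w.nablaCLM hF Y)) ∈ w.horizontalEigenspace ⟨x, F x⟩ z := by
  have hproj : ∀ X : TangentSpace (𝓡 m) x,
      mfderiv (endModel m) (𝓡 m) (TotalSpace.proj : EndBundle m M → M) ⟨x, F x⟩
      (mfderiv (𝓡 m) (endModel m) (fun y ↦ (⟨y, F y⟩ : EndBundle m M)) x X -
      EndBundle.vertical ⟨x, F x⟩ (w.nablaCLM hF X)) = X := by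
    intro X
    rw [mfderiv_proj_apply, mfderiv_section_apply hF, vertical_eq]
    exact sub_zero X
  refine ⟨?_, ?_⟩
  · exact Submodule.add_mem _
      (Submodule.tmul_mem_baseChange_of_mem _ (w.mfderiv_sub_vertical_mem_horizontal hF X))
      (Submodule.tmul_mem_baseChange_of_mem _ (w.mfderiv_sub_vertical_mem_horizontal hF Y))
  · rw [SetLike.mem_coe, Submodule.mem_comap, EndBundle.dProj, baseChange_complexVector]
    exact (congrArg₂ (fun a b ↦ complexVector a b ∈ complexEigenspace
      (F x : TangentSpace (𝓡 m) x →ₗ[ℝ] TangentSpace (𝓡 m) x) z) (hproj X) (hproj Y)).mpr hXY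

variable {w}

lemma SectionQ.isFibreTangent {r : ℕ} (p : w.SectionQ r) (x : M) (X : TangentSpace (𝓡 m) x) :
    w.IsFibreTangent ⟨x, p.F x⟩ (w.nablaCLM (p.smooth x) X) := by
  refine ⟨?_, (p.isVariation x X).skew⟩
  ext v
  exact (p.isVariation x X).lin v

/-- The section `p` is holomorphic if and only if `F^p` is, at each point and to first order,
holomorphic along its associated distribution. -/
theorem SectionQ.isHolomorphicOn_iff (p : w.SectionQ 1) :
    IsHolomorphicOn (𝓡 m) (endModel m) p.toMap (associatedDistribution (𝓡 m) p.F)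
      w.twistorDistribution Set.univ ↔ w.IsHolomorphicStructure p.smooth := by
  constructor
  · intro h x X Y v hXY hv
    have h1 := h x (Set.mem_univ x) (complexVector X Y)
      ((complexVector_mem_sup_complexEigenspace (p.cube x)).2 hXY)
    have h2 := w.twistorDistribution_le (F := p.F x) h1
    have h4 := baseChange_complexVector (mfderiv (𝓡 m) (endModel m) p.toMap x :
          TangentSpace (𝓡 m) x →ₗ[ℝ] TangentSpace (endModel m) (p.toMap x)) X Y
    have h5 := (congrArg ((w.connectionMap (p.toMap x)).baseChange ℂ) h4).trans
      (baseChange_complexVector _ _ _)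
    have h3 := w.connectionMap_section (p.smooth x)
    have h6 := h5.trans (congrArg₂ complexVector (h3 X) (h3 Y))
    exact complexVector_mem_vanishingOn.1 (Eq.mp (congrArg (· ∈ vanishingOn
      (p.F x : TangentSpace (𝓡 m) x →ₗ[ℝ] TangentSpace (𝓡 m) x)) h6) h2) v hv
  · intro h x _ Z hZ
    -- On each eigenspace, `dp(X + iY)` is the sum of a horizontal lift, which stays over the same
    -- eigenspace, and of the vertical vector `D_X F + i D_Y F`, which is of type `(0,1)` by `h`.
    have key : ∀ z : ℂ, w.horizontalEigenspace (p.toMap x) z ≤ w.twistorDistribution (p.toMap x) →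
        complexEigenspace (p.F x : TangentSpace (𝓡 m) x →ₗ[ℝ] TangentSpace (𝓡 m) x) z ≤
          associatedDistribution (𝓡 m) p.F x →
        complexEigenspace (p.F x : TangentSpace (𝓡 m) x →ₗ[ℝ] TangentSpace (𝓡 m) x) z ≤
        (w.twistorDistribution (p.toMap x)).comap ((mfderiv (𝓡 m) (endModel m) p.toMap x :
          TangentSpace (𝓡 m) x →ₗ[ℝ] TangentSpace (endModel m) (p.toMap x)).baseChange ℂ) := by
      intro z hz hz' Z hZ
      obtain ⟨X, Y, rfl⟩ := exists_eq_complexVector Z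
      have hXY := (complexVector_mem_sup_complexEigenspace (p.cube x)).1 (hz' hZ)
      rw [Submodule.mem_comap, baseChange_complexVector]
      have h1 := hz (w.complexVector_sub_mem_horizontalEigenspace (p.smooth x) hZ)
      have h2 : complexVector (EndBundle.vertical (p.toMap x) (w.nablaCLM (p.smooth x) X))
          (EndBundle.vertical (p.toMap x) (w.nablaCLM (p.smooth x) Y)) ∈
          w.twistorDistribution (p.toMap x) :=
        le_sup_right (a := w.horizontalEigenspace (p.toMap x) 0)
          (le_sup_right (a := w.horizontalEigenspace (p.toMap x) (-Complex.I))
          (Submodule.subset_span ⟨_, _, p.isFibreTangent x X, p.isFibreTangent x Y,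
            isFibreComplexStructure_of fun v hv ↦ h x X Y v hXY hv, rfl⟩))
      have h3 := Submodule.add_mem _ h1 h2
      exact Eq.mp (congrArg (· ∈ w.twistorDistribution (p.toMap x)) ((complexVector_add _ _ _ _).trans
        (congrArg₂ complexVector (sub_add_cancel _ _) (sub_add_cancel _ _)))) h3
    exact sup_le (key 0 le_sup_left le_sup_left)
      (key (-Complex.I) (le_sup_left.trans le_sup_right) le_sup_right) hZ

end WeylSpace

end Twistor

end

/-! ### Calculus on spaces of continuous paths, and the inverse function theorem -/

noncomputable section

section SmoothDependence

open scoped unitInterval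

/-! ### Composition operators on spaces of continuous maps -/

section Composition

variable {K : Type*} [TopologicalSpace K] [CompactSpace K]

set_option synthInstance.maxHeartbeats 400000 in
/-- Linear maps form a normed space, so that continuous families of linear maps do. -/
instance ContinuousMap.normedAddCommGroupCLM {E F : Type*} [NormedAddCommGroup E] [NormedSpace ℝ E]
    [NormedAddCommGroup F] [NormedSpace ℝ F] : NormedAddCommGroup C(K, E →L[ℝ] F) :=
  inferInstance

set_option synthInstance.maxHeartbeats 400000 in
/-- Continuous families of linear maps form a normed space. -/
instance ContinuousMap.normedSpaceCLM {E F : Type*} [NormedAddCommGroup E] [NormedSpace ℝ E]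
    [NormedAddCommGroup F] [NormedSpace ℝ F] : NormedSpace ℝ C(K, E →L[ℝ] F) :=
  inferInstance

/-- The pointwise application of a continuous family of continuous linear maps. -/
def ContinuousMap.applyCLM (K : Type*) [TopologicalSpace K] [CompactSpace K] (E F : Type*)
    [NormedAddCommGroup E] [NormedSpace ℝ E] [NormedAddCommGroup F] [NormedSpace ℝ F] :
    C(K, E →L[ℝ] F) →L[ℝ] C(K, E) →L[ℝ] C(K, F) :=
  LinearMap.mkContinuous₂
    (LinearMap.mk₂ ℝ (fun A u ↦ ⟨fun k ↦ A k (u k), by fun_prop⟩)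
      (fun A B u ↦ by ext; simp) (fun c A u ↦ by ext; simp) (fun A u v ↦ by ext; simp)
      (fun c A u ↦ by ext; simp)) 1 fun A u ↦ by
    refine (ContinuousMap.norm_le _ (by positivity)).2 fun k ↦ ?_
    rw [one_mul]
    exact (A k).le_of_opNorm_le_of_le (A.norm_coe_le_norm k) (u.norm_coe_le_norm k)

@[simp]
lemma ContinuousMap.applyCLM_apply {E F : Type*}
    [NormedAddCommGroup E] [NormedSpace ℝ E] [NormedAddCommGroup F] [NormedSpace ℝ F]
    (A : C(K, E →L[ℝ] F)) (u : C(K, E)) (k : K) :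
    ContinuousMap.applyCLM K E F A u k = A k (u k) := rfl

/-- The constant maps, as a continuous linear map. -/
def ContinuousMap.constCLM (K : Type*) [TopologicalSpace K] [CompactSpace K] (E : Type*)
    [NormedAddCommGroup E] [NormedSpace ℝ E] : E →L[ℝ] C(K, E) :=
  LinearMap.mkContinuous
    { toFun := ContinuousMap.const K
      map_add' := fun _ _ ↦ by ext; simp
      map_smul' := fun _ _ ↦ by ext; simp } 1 fun x ↦
    (ContinuousMap.norm_le _ (by positivity)).2 fun k ↦ by simp

@[simp]
lemma ContinuousMap.constCLM_apply {E : Type*} [NormedAddCommGroup E] [NormedSpace ℝ E]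
    (x : E) (k : K) : ContinuousMap.constCLM K E x k = x := rfl

/-- Pointwise this is the mean value inequality. Continuity of `u ↦ f' ∘ u` in the uniform norm
makes the estimate independent of `k`. -/
lemma ContinuousMap.hasFDerivAt_comp {E F : Type*} [NormedAddCommGroup E] [NormedSpace ℝ E]
    [NormedAddCommGroup F] [NormedSpace ℝ F] (f : C(E, F)) (f' : C(E, E →L[ℝ] F))
    (hf : ∀ x, HasFDerivAt f (f' x) x) (u : C(K, E)) :
    HasFDerivAt (fun u : C(K, E) ↦ f.comp u)
      (ContinuousMap.applyCLM K E F (f'.comp u)) u := by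
  rw [hasFDerivAt_iff_isLittleO, Asymptotics.isLittleO_iff]
  intro ε hε
  have hc := (f'.continuous_postcomp (X := K)).continuousAt (x := u)
  obtain ⟨δ, hδ, h⟩ := Metric.continuousAt_iff.1 hc ε hε
  filter_upwards [Metric.ball_mem_nhds u hδ] with v hv
  refine (ContinuousMap.norm_le _ (by positivity)).2 fun k ↦ ?_
  have hvu : ‖v - u‖ < δ := by rwa [← dist_eq_norm]
  have hk : ‖v k - u k‖ ≤ ‖v - u‖ := (v - u).norm_coe_le_norm k
  have hball : ∀ x ∈ Metric.ball (u k) δ, ‖f' x - f' (u k)‖ ≤ ε := by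
    intro x hx
    -- A translate of `u` by a constant takes the value `x` at `k` and remains at distance less than
    -- `δ` from `u`.
    have h1 : dist (u + ContinuousMap.constCLM K E (x - u k)) u < δ := by
      rw [dist_eq_norm, add_sub_cancel_left]
      refine lt_of_le_of_lt ((ContinuousMap.norm_le _ (norm_nonneg (x - u k))).2 fun _ ↦ le_rfl) ?_
      rwa [← dist_eq_norm]
    have h2 := h h1
    rw [dist_eq_norm] at h2
    have h3 := (ContinuousMap.norm_coe_le_norm _ k).trans h2.le
    simpa using h3
  have := (convex_ball (u k) δ).norm_image_sub_le_of_norm_hasFDerivWithin_le'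
    (fun x _ ↦ (hf x).hasFDerivWithinAt) hball (Metric.mem_ball_self hδ)
    (show v k ∈ Metric.ball (u k) δ by
      rw [Metric.mem_ball, dist_eq_norm]; exact hk.trans_lt hvu)
  refine (le_of_eq ?_).trans (this.trans (mul_le_mul_of_nonneg_left hk hε.le))
  simp

universe u

/-- By induction on `n`: the derivative is composition with `f'`, followed by a continuous linear
map. The target changes from `F` to `E →L[ℝ] F`, so both spaces are kept in the same universe. -/
lemma ContinuousMap.contDiff_comp_nat (n : ℕ) {E F : Type u} [NormedAddCommGroup E]
    [NormedSpace ℝ E] [NormedAddCommGroup F] [NormedSpace ℝ F] (f : C(E, F))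
    (hf : ContDiff ℝ n f) : ContDiff ℝ n (fun u : C(K, E) ↦ f.comp u) := by
  induction n generalizing F with
  | zero =>
    simpa using f.continuous_postcomp (X := K)
  | succ n ih =>
    obtain ⟨f', hf', h⟩ := contDiff_succ_iff_hasFDerivAt.1 (by exact_mod_cast hf)
    have h1 := contDiff_succ_iff_hasFDerivAt.2 ⟨_,
      (ContinuousMap.applyCLM K E F).contDiff.comp (ih ⟨f', hf'.continuous⟩ hf'),
      f.hasFDerivAt_comp ⟨f', hf'.continuous⟩ h⟩
    exact_mod_cast h1

/-- The composition with a smooth map is a smooth operation on continuous maps. -/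
lemma ContinuousMap.contDiff_comp {E F : Type u} [NormedAddCommGroup E]
    [NormedSpace ℝ E] [NormedAddCommGroup F] [NormedSpace ℝ F] (f : C(E, F))
    (hf : ContDiff ℝ ∞ f) : ContDiff ℝ ∞ (fun u : C(K, E) ↦ f.comp u) :=
  contDiff_infty.2 fun n ↦ f.contDiff_comp_nat n (contDiff_infty.1 hf n)

end Composition

/-- The primitive which vanishes at `0`. -/
def ContinuousMap.primitive (E : Type*) [NormedAddCommGroup E] [NormedSpace ℝ E]
    [CompleteSpace E] : C(I, E) →L[ℝ] C(I, E) :=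
  LinearMap.mkContinuous
    { toFun := fun u ↦ ⟨fun t ↦ ∫ s in (0 : ℝ)..t, u (Set.projIcc 0 1 zero_le_one s),
        (intervalIntegral.continuous_primitive (fun a b ↦ (u.continuous.comp
          continuous_projIcc).intervalIntegrable a b) 0).comp continuous_subtype_val⟩
      map_add' := fun u v ↦ by
        ext t
        exact intervalIntegral.integral_add ((u.continuous.comp
          continuous_projIcc).intervalIntegrable _ _) ((v.continuous.comp
          continuous_projIcc).intervalIntegrable _ _)
      map_smul' := fun c u ↦ by
        ext t
        exact intervalIntegral.integral_smul c _ } 1 fun u ↦ by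
    refine (ContinuousMap.norm_le _ (by positivity)).2 fun t ↦ ?_
    have := intervalIntegral.norm_integral_le_of_norm_le_const (a := 0) (b := (t : ℝ))
      (f := fun s ↦ u (Set.projIcc 0 1 zero_le_one s)) (C := ‖u‖)
      fun s _ ↦ u.norm_coe_le_norm _
    rw [sub_zero, abs_of_nonneg t.2.1] at this
    refine this.trans ?_
    rw [one_mul]
    exact mul_le_of_le_one_right (norm_nonneg _) t.2.2

lemma ContinuousMap.primitive_apply {E : Type*} [NormedAddCommGroup E] [NormedSpace ℝ E]
    [CompleteSpace E] (u : C(I, E)) (t : I) : ContinuousMap.primitive E u t =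
      ∫ s in (0 : ℝ)..t, u (Set.projIcc 0 1 zero_le_one s) := rfl

/-- The fundamental theorem of calculus. -/
lemma ContinuousMap.primitive_eq_of_hasDerivAt {E : Type*} [NormedAddCommGroup E] [NormedSpace ℝ E]
    [CompleteSpace E] (u v : C(I, E)) (h0 : u 0 = 0)
    (h : ∀ t : I, HasDerivWithinAt (fun s ↦ u (Set.projIcc 0 1 zero_le_one s)) (v t) I t) :
    ContinuousMap.primitive E v = u := by
  ext t
  rw [primitive_apply, intervalIntegral.integral_eq_sub_of_hasDeriv_right_of_le
    (f := fun s ↦ u (Set.projIcc 0 1 zero_le_one s)) t.2.1]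
  · simp [h0]
  · exact (u.continuous.comp continuous_projIcc).continuousOn
  · intro s hs
    have hs' : s ∈ I := ⟨hs.1.le, hs.2.le.trans t.2.2⟩
    have := h ⟨s, hs'⟩
    rw [Set.projIcc_of_mem _ hs']
    exact (this.hasDerivAt (Icc_mem_nhds hs.1 (hs.2.trans_le t.2.2))).hasDerivWithinAt
  · exact (v.continuous.comp continuous_projIcc).intervalIntegrable _ _

/-- A primitive of a continuous function is differentiable. -/
lemma ContinuousMap.hasDerivWithinAt_primitive {E : Type*} [NormedAddCommGroup E] [NormedSpace ℝ E]
    [CompleteSpace E] (v : C(I, E)) (t : I) :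
    HasDerivWithinAt (fun s ↦ ContinuousMap.primitive E v (Set.projIcc 0 1 zero_le_one s))
      (v t) I t := by
  have hc := v.continuous.comp (continuous_projIcc (h := zero_le_one (α := ℝ)))
  have h1 := intervalIntegral.integral_hasDerivAt_right (hc.intervalIntegrable 0 t)
    (hc.stronglyMeasurableAtFilter _ _) hc.continuousAt
  have h2 := h1.hasDerivWithinAt (s := I)
  rw [Function.comp_apply, Set.projIcc_val] at h2
  refine h2.congr (fun s hs ↦ ?_) ?_
  · rw [primitive_apply, Set.projIcc_of_mem _ hs]; rfl
  · rw [primitive_apply, Set.projIcc_val]; rfl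

/-- A form of the inverse function theorem. -/
theorem exists_openPartialHomeomorph_of_hasFDerivAt {X Y : Type*} [NormedAddCommGroup X]
    [NormedSpace ℝ X] [CompleteSpace X] [NormedAddCommGroup Y] [NormedSpace ℝ Y]
    {f : X → Y} {s : Set X} (hs : IsOpen s) (hf : ContDiffOn ℝ ∞ f s) {a : X} (ha : a ∈ s)
    {e : X ≃L[ℝ] Y} (he : HasFDerivAt f (e : X →L[ℝ] Y) a) :
    ∃ φ : OpenPartialHomeomorph X Y, (φ : X → Y) = f ∧ a ∈ φ.source ∧ φ.source ⊆ s ∧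
      ContDiffOn ℝ ∞ φ.symm φ.target ∧
      ∀ x ∈ φ.source, ∃ e : X ≃L[ℝ] Y, HasFDerivAt f (e : X →L[ℝ] Y) x := by
  have hfa : ContDiffAt ℝ ∞ f a := hf.contDiffAt (hs.mem_nhds ha)
  set φ₀ := hfa.toOpenPartialHomeomorph f he (by simp)
  have hφ₀ : (φ₀ : X → Y) = f := hfa.toOpenPartialHomeomorph_coe he (by simp)
  have hc : ContinuousOn (fderiv ℝ f) s := (hf.fderiv_of_isOpen (m := 0) hs (by simp)).continuousOn
  -- Restricting to the open set where the derivative is invertible makes the inverse smooth on the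
  -- whole target, and not only near `f a`.
  set s' := s ∩ fderiv ℝ f ⁻¹' (Set.range ((↑) : (X ≃L[ℝ] Y) → X →L[ℝ] Y))
  have hs' : IsOpen s' := hc.isOpen_inter_preimage hs ContinuousLinearEquiv.isOpen
  have ha' : a ∈ s' := ⟨ha, e, he.fderiv.symm⟩
  set φ := φ₀.restrOpen s' hs'
  have hφ : (φ : X → Y) = f := hφ₀
  have key : ∀ x ∈ φ.source, ∃ e : X ≃L[ℝ] Y, HasFDerivAt f (e : X →L[ℝ] Y) x := by
    intro x hx
    have hx' : x ∈ s' := (φ₀.restrOpen_source s' hs' ▸ hx : x ∈ φ₀.source ∩ s').2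
    obtain ⟨e, he⟩ := hx'.2
    refine ⟨e, ?_⟩
    rw [he]
    exact ((hf.contDiffAt (hs.mem_nhds hx'.1)).differentiableAt (by simp)).hasFDerivAt
  have hsub : φ.source ⊆ s := fun x hx ↦
    (φ₀.restrOpen_source s' hs' ▸ hx : x ∈ φ₀.source ∩ s').2.1
  refine ⟨φ, hφ, ?_, hsub, ?_, key⟩
  · rw [φ₀.restrOpen_source s' hs']
    exact ⟨hfa.mem_toOpenPartialHomeomorph_source he (by simp), ha'⟩
  · intro y hy
    have hx := φ.map_target hy
    obtain ⟨e, he⟩ := key _ hx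
    refine (φ.contDiffAt_symm hy (f₀' := e) ?_ ?_).contDiffWithinAt
    · rw [hφ]; exact he
    · rw [hφ]; exact hf.contDiffAt (hs.mem_nhds (hsub hx))

end SmoothDependence

end

/-! ### Smooth dependence of solutions on parameters -/

noncomputable section

section ParametrizedEquation

open scoped unitInterval

universe u

variable {E Z : Type u} [NormedAddCommGroup E] [NormedSpace ℝ E]
  [NormedAddCommGroup Z] [NormedSpace ℝ Z]

/-- The path `t ↦ (u t, z)`. -/
def pairCLM (E Z : Type*) [NormedAddCommGroup E] [NormedSpace ℝ E]
    [NormedAddCommGroup Z] [NormedSpace ℝ Z] : Z × C(I, E) →L[ℝ] C(I, E × Z) :=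
  ((ContinuousLinearMap.inl ℝ E Z).compLeftContinuous ℝ I).comp (ContinuousLinearMap.snd ℝ Z C(I, E))
    + ((ContinuousMap.constCLM I (E × Z)).comp (ContinuousLinearMap.inr ℝ E Z)).comp
      (ContinuousLinearMap.fst ℝ Z C(I, E))

@[simp]
lemma pairCLM_apply (z : Z) (u : C(I, E)) (t : I) : pairCLM E Z (z, u) t = (u t, z) := by
  simp [pairCLM]

/-- Smooth dependence on parameters of the solutions of `y' = g(y, z)`, `y(0) = c(z)`, if
`g(·, 0) = 0`. -/
theorem exists_solution_contDiffOn [CompleteSpace E] [CompleteSpace Z] {g : E × Z → E} (hg : ContDiff ℝ ∞ g)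
    (hg0 : ∀ x, g (x, 0) = 0) {c : Z → E} (hc : ContDiff ℝ ∞ c) :
    ∃ (y : Z → C(I, E)) (G : Set Z), IsOpen G ∧ (0 : Z) ∈ G ∧ ContDiffOn ℝ ∞ y G ∧
      y 0 = ContinuousMap.constCLM I E (c 0) ∧
      (∀ z ∈ G, y z = ContinuousMap.constCLM I E (c z) +
        ContinuousMap.primitive E ((⟨g, hg.continuous⟩ : C(E × Z, E)).comp (pairCLM E Z (z, y z)))) ∧
      ∀ z ∈ G, ∀ κ u, (∀ v : C(I, E), (∀ t, v t = fderiv ℝ g (y z t, z) (u t, κ)) →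
        u = ContinuousMap.constCLM I E (fderiv ℝ c z κ) + ContinuousMap.primitive E v) →
        fderiv ℝ y z κ = u := by
  set gc : C(E × Z, E) := ⟨g, hg.continuous⟩
  have hg' : Continuous (fderiv ℝ g) := hg.continuous_fderiv (by simp)
  set gc' : C(E × Z, E × Z →L[ℝ] E) := ⟨fderiv ℝ g, hg'⟩
  set C := ContinuousMap.constCLM I E
  set V := ContinuousMap.primitive E
  -- The integral form of the equation: the path `y` solves it for the parameter `z` if and only if
  -- `f (z, y) = (z, 0)`, so inverting `f` yields the solutions.
  set f : Z × C(I, E) → Z × C(I, E) := fun p ↦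
    (p.1, p.2 - C (c p.1) - V (gc.comp (pairCLM E Z p))) with hf
  have hfs : ContDiff ℝ ∞ f :=
    contDiff_fst.prodMk ((contDiff_snd.sub (C.contDiff.comp (hc.comp contDiff_fst))).sub
      (V.contDiff.comp ((gc.contDiff_comp hg).comp (pairCLM E Z).contDiff)))
  have hder : ∀ p : Z × C(I, E), HasFDerivAt f ((ContinuousLinearMap.fst ℝ Z C(I, E)).prod
      (ContinuousLinearMap.snd ℝ Z C(I, E)
        - C.comp ((fderiv ℝ c p.1).comp (ContinuousLinearMap.fst ℝ Z C(I, E)))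
        - V.comp ((ContinuousMap.applyCLM I (E × Z) E (gc'.comp (pairCLM E Z p))).comp
          (pairCLM E Z)))) p := by
    intro p
    refine hasFDerivAt_fst.prodMk ((hasFDerivAt_snd.sub ?_).sub ?_)
    · exact C.hasFDerivAt.comp p
        (((hc.differentiable (by simp)).differentiableAt (x := p.1)).hasFDerivAt.comp p hasFDerivAt_fst)
    · have h1 := gc.hasFDerivAt_comp gc'
        (fun x ↦ ((hg.differentiable (by simp)).differentiableAt (x := x)).hasFDerivAt)
        (pairCLM E Z p)
      exact V.hasFDerivAt.comp p (HasFDerivAt.comp (g := fun u : C(I, E × Z) ↦ gc.comp u) p h1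
        (pairCLM E Z).hasFDerivAt)
  set a : Z × C(I, E) := (0, C (c 0)) with ha
  have hV0 : V 0 = 0 := V.map_zero
  have hfa : f a = 0 := by
    have : gc.comp (pairCLM E Z a) = 0 := by
      ext t; simp [ha, gc, hg0]
    have h : f a = (a.1, a.2 - C (c a.1) - V (gc.comp (pairCLM E Z a))) := rfl
    rw [h, this, hV0]
    simp [ha]
  have hga : ∀ u : E, fderiv ℝ g (c 0, 0) (u, 0) = 0 := by
    intro u
    have h1 := ((hg.differentiable (by simp)).differentiableAt (x := (c 0, (0 : Z)))).hasFDerivAt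
    have h2 := HasFDerivAt.comp (g := g) (f := fun x : E ↦ (x, (0 : Z))) (c 0) h1
      (hasFDerivAt_prodMk_left (c 0) (0 : Z))
    have h3 : (g ∘ fun x : E ↦ (x, (0 : Z))) = fun _ ↦ 0 := by ext x; simp [hg0]
    rw [h3] at h2
    have h4 := h2.unique (hasFDerivAt_const (0 : E) (c 0))
    have h5 := congrArg (fun T ↦ T u) h4
    simpa using h5
  -- As `g (·, 0) = 0`, the partial derivative of `f` in the path, at the parameter `0` and the
  -- constant path `c 0`, is the identity. So the derivative there is a shear, hence invertible, and
  -- no shortening of the interval is needed.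
  set T : Z →L[ℝ] C(I, E) := - C.comp (fderiv ℝ c 0)
        - V.comp ((ContinuousMap.applyCLM I (E × Z) E (gc'.comp (pairCLM E Z a))).comp
          ((pairCLM E Z).comp (ContinuousLinearMap.inl ℝ Z C(I, E))))
  have he : HasFDerivAt f (((ContinuousLinearEquiv.refl ℝ Z).skewProd
      (ContinuousLinearEquiv.refl ℝ C(I, E)) T : (Z × C(I, E)) ≃L[ℝ] Z × C(I, E)) :
      Z × C(I, E) →L[ℝ] Z × C(I, E)) a := by
    refine (hder a).congr_fderiv ?_
    refine ContinuousLinearMap.ext fun p ↦ Prod.ext rfl ?_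
    have : (ContinuousMap.applyCLM I (E × Z) E (gc'.comp (pairCLM E Z a))) (pairCLM E Z p) =
        (ContinuousMap.applyCLM I (E × Z) E (gc'.comp (pairCLM E Z a))) (pairCLM E Z (p.1, 0)) := by
      ext t
      have h1 : ((p.2 t, p.1) : E × Z) = (p.2 t, 0) + (0, p.1) := by simp
      have h2 : pairCLM E Z p t = (p.2 t, p.1) := pairCLM_apply p.1 p.2 t
      simp only [ContinuousMap.applyCLM_apply, ContinuousMap.comp_apply, pairCLM_apply, h2, ha]
      rw [h1, map_add]
      simp [gc', C, hga]
    simp only [ContinuousLinearMap.prod_apply, sub_apply, ContinuousLinearMap.comp_apply,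
      ContinuousLinearEquiv.coe_coe, ContinuousLinearEquiv.skewProd_apply, T, neg_apply,
      ContinuousLinearMap.inl_apply, ContinuousLinearMap.coe_snd', ContinuousLinearMap.coe_fst',
      ContinuousLinearEquiv.refl_apply]
    rw [this, show a.1 = 0 from rfl]
    abel
  obtain ⟨φ, hφ, haφ, -, hsymm, -⟩ :=
    exists_openPartialHomeomorph_of_hasFDerivAt isOpen_univ hfs.contDiffOn (Set.mem_univ a) he
  set G : Set Z := (fun z : Z ↦ ((z, 0) : Z × C(I, E))) ⁻¹' φ.target with hG
  have hGo : IsOpen G := φ.open_target.preimage (by fun_prop)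
  have h0 : (0 : Z) ∈ G := by
    have := φ.map_source haφ
    rw [hφ, hfa] at this
    exact this
  have hφs : ∀ z ∈ G, φ (φ.symm (z, 0)) = (z, 0) := fun z hz ↦ φ.right_inv hz
  have hfst : ∀ z ∈ G, (φ.symm (z, 0)).1 = z := fun z hz ↦ by
    have := congrArg Prod.fst (hφs z hz)
    rwa [hφ] at this
  have hpair : ∀ z ∈ G, φ.symm (z, 0) = (z, (φ.symm (z, 0)).2) := fun z hz ↦
    Prod.ext (hfst z hz) rfl
  refine ⟨fun z ↦ (φ.symm (z, 0)).2, G, hGo, h0, ?_, ?_, ?_, ?_⟩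
  · exact contDiff_snd.comp_contDiffOn (hsymm.comp
      (contDiff_id.prodMk contDiff_const).contDiffOn fun z hz ↦ hz)
  · have h1 := φ.left_inv haφ
    rw [hφ, hfa] at h1
    have h2 := congrArg Prod.snd h1
    exact h2
  · intro z hz
    have := congrArg Prod.snd (hφs z hz)
    rw [hφ, hpair z hz] at this
    simp only [hf] at this
    rw [sub_sub, sub_eq_zero] at this
    exact this
  · intro z hz κ u hu
    set p := φ.symm (z, 0) with hp
    have hz' : ((z, 0) : Z × C(I, E)) ∈ φ.target := hz
    have hp1 : p.1 = z := hfst z hz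
    have hinv := ((hsymm.contDiffAt (φ.open_target.mem_nhds hz')).differentiableAt
      (by simp)).hasFDerivAt
    have hfp : f p = (z, 0) := by rw [← hφ]; exact hφs z hz
    -- Differentiate `φ.symm ∘ f = id` at `p`. A solution `u` of the linearized equation satisfies
    -- `df (κ, u) = (κ, 0)`, so the derivative of `φ.symm` sends `(κ, 0)` to `(κ, u)`.
    have hcomp := HasFDerivAt.comp p (hfp ▸ hinv) (hder p)
    have hid : φ.symm ∘ f =ᶠ[nhds p] id := by
      filter_upwards [φ.open_source.mem_nhds (φ.map_target hz')] with q hq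
      rw [← hφ]; exact φ.left_inv hq
    have hL := (hcomp.congr_of_eventuallyEq hid.symm).unique (hasFDerivAt_id p)
    have hLu := congrArg (fun L ↦ L (κ, u)) hL
    have hzero : u - C (fderiv ℝ c z κ) - V ((ContinuousMap.applyCLM I (E × Z) E
        (gc'.comp (pairCLM E Z p))) (pairCLM E Z (κ, u))) = 0 := by
      rw [sub_sub, sub_eq_zero]
      apply hu
      intro t
      have h2 : pairCLM E Z p t = (p.2 t, p.1) := pairCLM_apply p.1 p.2 t
      simp only [ContinuousMap.applyCLM_apply, ContinuousMap.comp_apply, pairCLM_apply, h2, hp1]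
      rfl
    simp only [ContinuousLinearMap.comp_apply, ContinuousLinearMap.prod_apply, sub_apply,
      ContinuousLinearMap.coe_fst', ContinuousLinearMap.coe_snd', ContinuousLinearMap.id_apply,
      hp1, hzero, hfp] at hLu
    have h1 : HasFDerivAt (fun z : Z ↦ ((z, 0) : Z × C(I, E)))
        (ContinuousLinearMap.inl ℝ Z C(I, E)) z := hasFDerivAt_prodMk_left z 0
    have h2 := (hasFDerivAt_snd (𝕜 := ℝ) (p := φ.symm (z, 0))).comp z (hinv.comp z h1)
    have h3 : fderiv ℝ (fun z ↦ (φ.symm (z, 0)).2) z = _ := h2.fderiv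
    rw [h3]
    simp only [ContinuousLinearMap.comp_apply, ContinuousLinearMap.inl_apply,
      ContinuousLinearMap.coe_snd']
    rw [hLu]

end ParametrizedEquation

end

/-! ### The Frobenius theorem -/

noncomputable section

section Frobenius

open scoped unitInterval

universe u

variable {E : Type u} [NormedAddCommGroup E] [NormedSpace ℝ E] [FiniteDimensional ℝ E]

/-- A smooth distribution, given as the image of a projection, is parametrized near a point
by its fibre at that point. -/
lemma exists_contDiff_parametrization {P : E → E →L[ℝ] E} {U : Set E} (hU : IsOpen U)
    (hP : ContDiffOn ℝ ∞ P U) (hPP : ∀ y ∈ U, ∀ v, P y (P y v) = P y v) {y₀ : E} (hy₀ : y₀ ∈ U) :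
    ∃ (B : E → E →L[ℝ] E) (O : Set E), ContDiff ℝ ∞ B ∧ IsOpen O ∧ y₀ ∈ O ∧ O ⊆ U ∧
      (∀ y ∈ O, ∀ k, P y₀ k = k → P y (B y k) = B y k ∧ P y₀ (B y k) = k) ∧
      (∀ y ∈ O, ∀ v, P y v = v → B y (P y₀ v) = v) := by
  have : CompleteSpace E := FiniteDimensional.complete ℝ E
  set Q := P y₀
  -- The standard intertwiner of two projections: `Q R = R P = Q P`, and `R = 1` at `y₀`. Near `y₀`
  -- its inverse carries the image of `Q` onto that of `P y`.
  set R : E → E →L[ℝ] E := fun y ↦ Q * P y + (1 - Q) * (1 - P y) with hR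
  have hPP' : ∀ y ∈ U, P y * P y = P y := fun y hy ↦ by ext v; exact hPP y hy v
  have hRs : ContDiffOn ℝ ∞ R U :=
    (contDiffOn_const.mul hP).add (contDiffOn_const.mul (contDiffOn_const.sub hP))
  have hR₀ : R y₀ = 1 := by
    have := hPP' y₀ hy₀
    simp only [hR, Q]
    linear_combination (norm := noncomm_ring) (2 : ℤ) • this
  set U₁ := U ∩ R ⁻¹' {A | IsUnit A}
  have hU₁ : IsOpen U₁ := hRs.continuousOn.isOpen_inter_preimage hU Units.isOpen
  have hy₁ : y₀ ∈ U₁ := ⟨hy₀, by simp [hR₀]⟩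
  have hBs : ∀ y ∈ U₁, ContDiffAt ℝ ∞ (fun y ↦ Ring.inverse (R y)) y := by
    intro y hy
    obtain ⟨u, hu⟩ := hy.2
    have := contDiffAt_ringInverse (n := ∞) ℝ u
    rw [hu] at this
    exact this.comp y (hRs.contDiffAt (hU.mem_nhds hy.1))
  have hQR : ∀ y ∈ U, Q * R y = Q * P y ∧ R y * P y = Q * P y := by
    intro y hy
    have h1 := hPP' y hy
    have h2 := hPP' y₀ hy₀
    change Q * Q = Q at h2
    constructor
    · simp only [hR]
      linear_combination (norm := noncomm_ring) h2 * P y - h2 * (1 - P y)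
    · simp only [hR]
      linear_combination (norm := noncomm_ring) Q * h1 - (1 - Q) * h1
  have hPB : ∀ y ∈ U₁, P y * Ring.inverse (R y) = Ring.inverse (R y) * Q := by
    intro y hy
    have h1 := Ring.mul_inverse_cancel (R y) hy.2
    have h2 := Ring.inverse_mul_cancel (R y) hy.2
    have h3 := hQR y hy.1
    calc P y * Ring.inverse (R y) = Ring.inverse (R y) * (R y * P y) * Ring.inverse (R y) := by
          rw [← mul_assoc (Ring.inverse (R y)), h2, one_mul]
      _ = Ring.inverse (R y) * Q := by
          rw [h3.2, ← h3.1, mul_assoc, mul_assoc, h1, mul_one]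
  obtain ⟨r, hr, hrU⟩ := Metric.isOpen_iff.1 hU₁ y₀ hy₁
  -- The differential equation is solved for globally defined smooth maps, so `R⁻¹` is cut off; on
  -- the ball of radius `r / 4` nothing changes.
  let f : ContDiffBump y₀ := ⟨r / 4, r / 2, by positivity, by linarith⟩
  have hsub : Metric.ball y₀ (r / 4) ⊆ U₁ :=
    (Metric.ball_subset_ball (by linarith)).trans hrU
  refine ⟨fun y ↦ f y • Ring.inverse (R y), Metric.ball y₀ (r / 4), ?_, Metric.isOpen_ball,
    Metric.mem_ball_self (by positivity), hsub.trans Set.inter_subset_left, ?_, ?_⟩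
  · rw [contDiff_iff_contDiffAt]
    intro y
    by_cases hy : y ∈ Metric.ball y₀ r
    · exact f.contDiffAt.smul (hBs y (hrU hy))
    · have hy' : y ∈ (Metric.closedBall y₀ (r / 2))ᶜ := by
        simp only [Set.mem_compl_iff, Metric.mem_closedBall, Metric.mem_ball, not_lt, not_le] at hy ⊢
        linarith
      refine (contDiffAt_const (c := (0 : E →L[ℝ] E))).congr_of_eventuallyEq ?_
      filter_upwards [Metric.isClosed_closedBall.isOpen_compl.mem_nhds hy'] with x hx
      have : f x = 0 := f.zero_of_le_dist (by
        simp only [Set.mem_compl_iff, Metric.mem_closedBall, not_le] at hx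
        exact hx.le)
      simp [this]
  · intro y hy k hk
    have h1 : f y = 1 := f.one_of_mem_closedBall (Metric.ball_subset_closedBall hy)
    have hy₁ := hsub hy
    have h2 := congrArg (fun T : E →L[ℝ] E ↦ T k) (hPB y hy₁)
    have h3 : P y (Ring.inverse (R y) k) = Ring.inverse (R y) k := h2.trans (congrArg _ hk)
    have h4 := congrArg (fun T : E →L[ℝ] E ↦ T k) (Ring.mul_inverse_cancel (R y) hy₁.2)
    have h5 : Q (P y (Ring.inverse (R y) k)) + (Ring.inverse (R y) k - P y (Ring.inverse (R y) k)
      - Q (Ring.inverse (R y) k - P y (Ring.inverse (R y) k))) = k := h4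
    simp only [h3, sub_self, map_zero, add_zero] at h5
    simp only [h1, one_smul]
    exact ⟨h3, h5⟩
  · intro y hy v hv
    have h1 : f y = 1 := f.one_of_mem_closedBall (Metric.ball_subset_closedBall hy)
    have hy₁ := hsub hy
    have h2 := congrArg (fun T : E →L[ℝ] E ↦ T v) (hPB y hy₁)
    have h4 := congrArg (fun T : E →L[ℝ] E ↦ T v) (Ring.inverse_mul_cancel (R y) hy₁.2)
    have h5 : R y v = Q v := by
      change Q (P y v) + ((v - P y v) - Q (v - P y v)) = Q v
      simp [hv]
    simp only [h1, one_smul]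
    rw [← h5]
    exact h4

/-- The **Frobenius theorem**: an involutive distribution is mapped, by a diffeomorphism, to a
constant one. -/
theorem exists_openPartialHomeomorph_of_involutive {P : E → E →L[ℝ] E} {U : Set E} (hU : IsOpen U)
    (hP : ContDiffOn ℝ ∞ P U) (hPP : ∀ y ∈ U, ∀ v, P y (P y v) = P y v)
    (hinv : ∀ y ∈ U, ∀ X Y : E → E, ContDiff ℝ ∞ X → ContDiff ℝ ∞ Y →
      (∀ᶠ x in nhds y, P x (X x) = X x) → (∀ᶠ x in nhds y, P x (Y x) = Y x) →
      P y (VectorField.lieBracket ℝ X Y y) = VectorField.lieBracket ℝ X Y y)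
    {y₀ : E} (hy₀ : y₀ ∈ U) :
    ∃ Φ : OpenPartialHomeomorph E E, (0 : E) ∈ Φ.source ∧ Φ 0 = y₀ ∧ Φ.target ⊆ U ∧
      ContDiffOn ℝ ∞ Φ Φ.source ∧ ContDiffOn ℝ ∞ Φ.symm Φ.target ∧
      ∀ z ∈ Φ.source, (∃ e : E ≃L[ℝ] E, HasFDerivAt Φ (e : E →L[ℝ] E) z) ∧
        ∀ κ, P (Φ z) (fderiv ℝ Φ z κ) = fderiv ℝ Φ z κ ↔ P y₀ κ = κ := by
  have : CompleteSpace E := FiniteDimensional.complete ℝ E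
  obtain ⟨B, O, hB, hO, hy₀O, hOU, hB₁, hB₂⟩ := exists_contDiff_parametrization hU hP hPP hy₀
  set Q := P y₀
  have hQQ : ∀ v, Q (Q v) = Q v := hPP y₀ hy₀
  have hB' : ∀ x, HasFDerivAt B (fderiv ℝ B x) x := fun x ↦
    (hB.differentiable (by simp)).differentiableAt.hasFDerivAt
  have hBk' : ∀ (k x : E), HasFDerivAt (fun x ↦ B x k) ((fderiv ℝ B x).flip k) x := fun k x ↦ by
    have := (hB' x).clm_apply (hasFDerivAt_const k x)
    exact this.congr_fderiv (by ext; simp)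
  -- The fields `B(·) k`, with `k` in the image of `Q`, generate the distribution and have constant
  -- image `k` under `Q`. So `Q` kills their brackets, which by involutivity lie in the
  -- distribution, where `Q` is injective: these fields commute.
  have hsymm : ∀ x ∈ O, ∀ k κ, Q k = k → Q κ = κ →
      fderiv ℝ B x (B x k) κ = fderiv ℝ B x (B x κ) k := by
    intro x hx k κ hk hκ
    have hev : ∀ k, Q k = k → ∀ᶠ y in nhds x, P y (B y k) = B y k := fun k hk ↦ by
      filter_upwards [hO.mem_nhds hx] with y hy using (hB₁ y hy k hk).1
    have hsm : ∀ k, ContDiff ℝ ∞ (fun y ↦ B y k) := fun k ↦ hB.clm_apply contDiff_const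
    have h1 := hinv x (hOU hx) _ _ (hsm k) (hsm κ) (hev k hk) (hev κ hκ)
    have h2 : VectorField.lieBracket ℝ (fun y ↦ B y k) (fun y ↦ B y κ) x =
        fderiv ℝ B x (B x k) κ - fderiv ℝ B x (B x κ) k := by
      rw [VectorField.lieBracket, (hBk' k x).fderiv, (hBk' κ x).fderiv]; simp
    rw [h2] at h1
    have h3 : ∀ k, Q k = k → ∀ w, Q (fderiv ℝ B x w k) = 0 := by
      intro k hk w
      have e1 := Q.hasFDerivAt.comp x (hBk' k x)
      have e2 : HasFDerivAt (Q ∘ fun x ↦ B x k) (0 : E →L[ℝ] E) x := by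
        refine (hasFDerivAt_const k x).congr_of_eventuallyEq ?_
        filter_upwards [hO.mem_nhds hx] with y hy using (hB₁ y hy k hk).2
      have e3 := congrArg (fun T ↦ T w) (e1.unique e2)
      simpa using e3
    have h4 := hB₂ x hx _ h1
    rw [map_sub, h3 κ hκ, h3 k hk, sub_zero, map_zero] at h4
    exact sub_eq_zero.1 h4.symm
  -- The chart is `z ↦ y(1)`, where `y' = B(y) (Q z)` and `y(0) = y₀ + (z - Q z)`: starting on a
  -- transversal at `y₀`, follow the commuting fields during time one.
  have hg : ContDiff ℝ ∞ (fun p : E × E ↦ B p.1 (Q p.2)) :=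
    (hB.comp contDiff_fst).clm_apply (Q.contDiff.comp contDiff_snd)
  have hc : ContDiff ℝ ∞ (fun z : E ↦ y₀ + (z - Q z)) :=
    contDiff_const.add (contDiff_id.sub Q.contDiff)
  have hg' : ∀ x z u κ, fderiv ℝ (fun p : E × E ↦ B p.1 (Q p.2)) (x, z) (u, κ) =
      fderiv ℝ B x u (Q z) + B x (Q κ) := by
    intro x z u κ
    have e1 : HasFDerivAt (fun p : E × E ↦ B p.1) _ (x, z) :=
      HasFDerivAt.comp (g := B) (x, z) (hB' x) (hasFDerivAt_fst (p := (x, z)))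
    have e2 : HasFDerivAt (fun p : E × E ↦ Q p.2) _ (x, z) :=
      HasFDerivAt.comp (g := Q) (x, z) Q.hasFDerivAt (hasFDerivAt_snd (p := (x, z)))
    have h1 := e1.clm_apply e2
    have h2 : fderiv ℝ (fun p : E × E ↦ B p.1 (Q p.2)) (x, z) = _ := h1.fderiv
    rw [h2]
    simp [add_comm]
  have hc' : ∀ z κ, fderiv ℝ (fun z : E ↦ y₀ + (z - Q z)) z κ = κ - Q κ := by
    intro z κ
    have h1 := ((hasFDerivAt_id z).sub Q.hasFDerivAt).const_add y₀
    have h2 : fderiv ℝ (fun z : E ↦ y₀ + (z - Q z)) z = _ := h1.fderiv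
    rw [h2]; simp
  obtain ⟨y, G, hG, h0G, hy, hy0, hyeq, hyder⟩ := exists_solution_contDiffOn hg (by simp) hc
  simp only [map_zero, sub_zero, add_zero] at hy0
  -- The parameters whose solution stays in `O`, where the cut-off is invisible; openness is that of
  -- the compact-open topology.
  set G' : Set E := G ∩ y ⁻¹' {v | Set.MapsTo v Set.univ O}
  have hG' : IsOpen G' := hy.continuousOn.isOpen_inter_preimage hG
    (ContinuousMap.isOpen_setOfPred_mapsTo isCompact_univ hO)
  have h0G' : (0 : E) ∈ G' := ⟨h0G, by
    rw [Set.mem_preimage, hy0]; exact fun _ _ ↦ hy₀O⟩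
  set ev : C(I, E) →L[ℝ] E := ContinuousMap.evalCLM ℝ (1 : I)
  have hev : ∀ v, ev v = v 1 := fun _ ↦ rfl
  have hy' : ∀ z ∈ G', HasFDerivAt (fun z ↦ ev (y z)) (ev.comp (fderiv ℝ y z)) z := fun z hz ↦
    ev.hasFDerivAt.comp z (((hy.contDiffAt (hG.mem_nhds hz.1)).differentiableAt
      (by simp)).hasFDerivAt)
  have hΦs : ContDiffOn ℝ ∞ (fun z ↦ ev (y z)) G' :=
    ev.contDiff.comp_contDiffOn (hy.mono Set.inter_subset_left)
  have hBQ : ∀ v, B y₀ (Q v) = Q v := fun v ↦ by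
    have := hB₂ y₀ hy₀O (Q v) (hQQ v)
    rwa [hQQ] at this
  -- At `z = 0` the solution is the constant `y₀` and its variation is `κ - Q κ + t Q κ`, which
  -- equals `κ` at `t = 1`.
  have hder0 : HasFDerivAt (fun z ↦ ev (y z)) ((ContinuousLinearEquiv.refl ℝ E : E ≃L[ℝ] E) :
      E →L[ℝ] E) 0 := by
    refine (hy' 0 h0G').congr_fderiv ?_
    ext κ
    set w : C(I, E) := ⟨fun t ↦ (t : ℝ) • Q κ, by fun_prop⟩
    have hw : ContinuousMap.primitive E (ContinuousMap.constCLM I E (Q κ)) = w := by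
      refine ContinuousMap.primitive_eq_of_hasDerivAt _ _ (by simp [w]) fun t ↦ ?_
      have h1 : HasDerivWithinAt (fun s : ℝ ↦ s • Q κ) ((1 : ℝ) • Q κ) I t :=
        ((hasDerivAt_id (t : ℝ)).smul_const (Q κ)).hasDerivWithinAt
      rw [one_smul] at h1
      refine h1.congr (fun s hs ↦ ?_) ?_
      · simp [w, Set.projIcc_of_mem _ hs]
      · simp [w]
    have h1 := hyder 0 h0G κ (ContinuousMap.constCLM I E (κ - Q κ) + w) fun v hv ↦ by
      rw [hc', ← hw]
      congr 2
      ext t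
      rw [hv t, hg']
      simp [hy0, hBQ]
    rw [ContinuousLinearMap.comp_apply, h1, hev]
    simp [w]
  obtain ⟨Φ, hΦ, h0Φ, hΦG, hΦsymm, hΦe⟩ :=
    exists_openPartialHomeomorph_of_hasFDerivAt hG' hΦs h0G' hder0
  have hmem : ∀ z ∈ Φ.source, Φ z ∈ O := fun z hz ↦ by
    rw [hΦ]; exact (hΦG hz).2 (Set.mem_univ 1)
  -- For `κ` tangent to the constant distribution, the path `t B(y(t)) κ` solves the linearized
  -- equation, by commutation (`hsymm`). Its value at `t = 1` is the derivative of the chart.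
  have key : ∀ z ∈ Φ.source, ∀ κ, Q κ = κ → fderiv ℝ Φ z κ = B (Φ z) κ := by
    intro z hz κ hκ
    have hzG := hΦG hz
    rw [hΦ, (hy' z hzG).fderiv, ContinuousLinearMap.comp_apply, hev]
    set u : C(I, E) := ⟨fun t ↦ (t : ℝ) • B (y z t) κ, by
      have := hB.continuous
      fun_prop⟩
    have h1 := hyder z hzG.1 κ u fun v hv ↦ by
      rw [hc', hκ, sub_self, map_zero, zero_add]
      refine (ContinuousMap.primitive_eq_of_hasDerivAt _ _ (by simp [u]) fun t ↦ ?_).symm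
      have e1 : HasDerivWithinAt (fun s ↦ y z (Set.projIcc 0 1 zero_le_one s))
          (B (y z t) (Q z)) I t := by
        have := (ContinuousMap.hasDerivWithinAt_primitive ((⟨fun p : E × E ↦ B p.1 (Q p.2),
          hg.continuous⟩ : C(E × E, E)).comp (pairCLM E E (z, y z))) t).const_add (y₀ + (z - Q z))
        rw [ContinuousMap.comp_apply, pairCLM_apply] at this
        refine this.congr (fun s _ ↦ ?_) ?_ <;>
        · conv_lhs => rw [hyeq z hzG.1]
          rfl
      have e2 : HasDerivWithinAt (fun s : ℝ ↦ s • B (y z (Set.projIcc 0 1 zero_le_one s)) κ)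
          ((t : ℝ) • (fderiv ℝ B (y z t) (B (y z t) (Q z)) κ) + (1 : ℝ) • B (y z t) κ) I t := by
        have e3 := HasFDerivAt.comp_hasDerivWithinAt (l := fun x ↦ B x κ) (t : ℝ)
          (f := fun s ↦ y z (Set.projIcc 0 1 zero_le_one s))
          (by rw [Set.projIcc_val]; exact hBk' κ (y z t)) e1
        have e4 := (hasDerivAt_id (t : ℝ)).hasDerivWithinAt (s := I) |>.smul e3
        rw [Function.comp_apply, Set.projIcc_val] at e4
        exact e4
      rw [hv t, hg', hκ]
      have e5 := hsymm (y z t) (hzG.2 (Set.mem_univ t)) (Q z) κ (hQQ z) hκ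
      have e6 : u t = (t : ℝ) • B (y z t) κ := rfl
      rw [e6, map_smul, smul_apply, ← e5]
      rw [one_smul] at e2
      refine e2.congr (fun s hs ↦ ?_) ?_
      · simp [u, Set.projIcc_of_mem _ hs]
      · simp [u]
    rw [h1]
    simp [u, hev]
  refine ⟨Φ, h0Φ, ?_, ?_, ?_, hΦsymm, fun z hz ↦ ⟨hΦ ▸ hΦe z hz, fun κ ↦ ⟨fun h ↦ ?_, fun h ↦ ?_⟩⟩⟩
  · rw [hΦ]; simp [hev, hy0]
  · intro x hx
    rw [← Φ.right_inv hx]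
    exact hOU (hmem _ (Φ.map_target hx))
  · rw [hΦ]; exact hΦs.mono hΦG
  -- If `dΦ κ` is in the distribution, it equals `B (Q (dΦ κ)) = dΦ (Q (dΦ κ))`; injectivity of `dΦ`
  -- shows that `κ` is in the image of `Q`.
  · have h1 := hB₂ (Φ z) (hmem z hz) _ h
    rw [← key z hz _ (hQQ _)] at h1
    obtain ⟨e, he⟩ := hΦe z hz
    rw [← hΦ] at he
    rw [he.fderiv] at h1
    have h2 := e.injective h1
    rw [← h2, hQQ]
  · rw [key z hz κ h]
    exact (hB₁ (Φ z) (hmem z hz) κ h).1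

end Frobenius

end

/-! ### Straightening the kernel of an integrable almost `f`-structure -/

noncomputable section

section Straightening

variable {m : ℕ} {M : Type*} [TopologicalSpace M] [ChartedSpace (EuclideanSpace ℝ (Fin m)) M]
  [IsManifold (𝓡 m) ∞ M]

local notation "𝔼" => EuclideanSpace ℝ (Fin m)

lemma VectorField.mlieBracket_eq_lieBracket {E : Type*} [NormedAddCommGroup E] [NormedSpace ℝ E]
    (V W : ∀ x : E, TangentSpace 𝓘(ℝ, E) x) :
    VectorField.mlieBracket 𝓘(ℝ, E) V W = VectorField.lieBracket ℝ V W := by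
  rw [← VectorField.mlieBracketWithin_univ, VectorField.mlieBracketWithin_eq_lieBracketWithin]
  exact VectorField.lieBracketWithin_univ

/-- Integrability, in terms of real vector fields, is transferred by local diffeomorphisms. -/
lemma IsIntegrableDistribution.lieBracket_of_local_diffeo {F : EndField (𝓡 m) M}
    (hcube : ∀ x v, F x (F x (F x v)) = -F x v)
    (hint : IsIntegrableDistribution (𝓡 m) (associatedDistribution (𝓡 m) F))
    {ψ : M → 𝔼} {W : Set M} (hW : IsOpen W) (hψ : ContMDiffOn (𝓡 m) 𝓘(ℝ, 𝔼) ∞ ψ W)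
    (hinv : ∀ x ∈ W, (mfderiv (𝓡 m) 𝓘(ℝ, 𝔼) ψ x).IsInvertible) {A : 𝔼 → 𝔼 →L[ℝ] 𝔼}
    (hA : ∀ x ∈ W, ∀ v : TangentSpace (𝓡 m) x,
      A (ψ x) (mfderiv (𝓡 m) 𝓘(ℝ, 𝔼) ψ x v) = mfderiv (𝓡 m) 𝓘(ℝ, 𝔼) ψ x (F x v))
    {O : Set 𝔼} (hO : IsOpen O) {X₁ X₂ Y₁ Y₂ : 𝔼 → 𝔼} (hX₁ : ContDiffOn ℝ ∞ X₁ O)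
    (hX₂ : ContDiffOn ℝ ∞ X₂ O) (hY₁ : ContDiffOn ℝ ∞ Y₁ O) (hY₂ : ContDiffOn ℝ ∞ Y₂ O)
    (hX : ∀ y ∈ O, A y (X₂ y) = A y (A y (X₁ y))) (hY : ∀ y ∈ O, A y (Y₂ y) = A y (A y (Y₁ y)))
    {x : M} (hx : x ∈ W) (hxO : ψ x ∈ O) :
    A (ψ x) (VectorField.lieBracket ℝ X₁ Y₂ (ψ x) + VectorField.lieBracket ℝ X₂ Y₁ (ψ x)) =
      A (ψ x) (A (ψ x) (VectorField.lieBracket ℝ X₁ Y₁ (ψ x) -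
        VectorField.lieBracket ℝ X₂ Y₂ (ψ x))) := by
  have : IsManifold (𝓡 m) (minSmoothness ℝ 2) M := by
    rw [minSmoothness_of_isRCLikeNormedField]; infer_instance
  have hmem : ∀ x, ∀ X Y : TangentSpace (𝓡 m) x,
      complexVector X Y ∈ associatedDistribution (𝓡 m) F x ↔ F x Y = F x (F x X) :=
    fun x X Y ↦ complexVector_mem_sup_complexEigenspace (hcube x)
  have hFinv : ∀ x ∈ W, ∀ w, F x ((mfderiv (𝓡 m) 𝓘(ℝ, 𝔼) ψ x).inverse w) =
      (mfderiv (𝓡 m) 𝓘(ℝ, 𝔼) ψ x).inverse (A (ψ x) w) := by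
    intro x hx w
    obtain ⟨e, he⟩ := hinv x hx
    have h1 := hA x hx (e.symm w)
    rw [← he] at h1 ⊢
    rw [ContinuousLinearMap.inverse_equiv]
    simp only [ContinuousLinearEquiv.coe_coe] at h1 ⊢
    rw [e.apply_symm_apply] at h1
    rw [h1, e.symm_apply_apply]
  have hψinv : ∀ x ∈ W, ∀ w, mfderiv (𝓡 m) 𝓘(ℝ, 𝔼) ψ x
      ((mfderiv (𝓡 m) 𝓘(ℝ, 𝔼) ψ x).inverse w) = w := by
    intro x hx w
    obtain ⟨e, he⟩ := hinv x hx
    rw [← he, ContinuousLinearMap.inverse_equiv]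
    exact e.apply_symm_apply w
  set U := W ∩ ψ ⁻¹' O
  have hU : IsOpen U := hψ.continuousOn.isOpen_inter_preimage hW hO
  -- The fields are pulled back to `M`, where integrability is assumed; pullback commutes with
  -- brackets and intertwines `A` with `F`.
  have hsm : ∀ Z : 𝔼 → 𝔼, ContDiffOn ℝ ∞ Z O → ContMDiffOn (𝓡 m) (𝓡 m).tangent ∞
      (fun x ↦ (⟨x, VectorField.mpullback (𝓡 m) 𝓘(ℝ, 𝔼) ψ Z x⟩ : TangentBundle (𝓡 m) M)) U := by
    intro Z hZ x hx
    have h1 : ContDiffAt ℝ ∞ Z (ψ x) := hZ.contDiffAt (hO.mem_nhds hx.2)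
    exact (ContMDiffAt.mpullback_vectorField_preimage
      (contMDiffAt_vectorSpace_iff_contDiffAt.2 h1) (hψ.contMDiffAt (hW.mem_nhds hx.1))
      (hinv x hx.1) (by simp)).contMDiffWithinAt
  have hlie : ∀ Z Z' : 𝔼 → 𝔼, ContDiffOn ℝ ∞ Z O → ContDiffOn ℝ ∞ Z' O →
      VectorField.mlieBracket (𝓡 m) (VectorField.mpullback (𝓡 m) 𝓘(ℝ, 𝔼) ψ Z)
        (VectorField.mpullback (𝓡 m) 𝓘(ℝ, 𝔼) ψ Z') x =
      (mfderiv (𝓡 m) 𝓘(ℝ, 𝔼) ψ x).inverse (VectorField.lieBracket ℝ Z Z' (ψ x)) := by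
    intro Z Z' hZ hZ'
    have h1 : ContDiffAt ℝ ∞ Z (ψ x) := hZ.contDiffAt (hO.mem_nhds hxO)
    have h2 : ContDiffAt ℝ ∞ Z' (ψ x) := hZ'.contDiffAt (hO.mem_nhds hxO)
    rw [← VectorField.mpullback_mlieBracket (n := ∞)
      ((contMDiffAt_vectorSpace_iff_contDiffAt.2 h1).mdifferentiableAt (by simp))
      ((contMDiffAt_vectorSpace_iff_contDiffAt.2 h2).mdifferentiableAt (by simp))
      (hψ.contMDiffAt (hW.mem_nhds hx)) (by rw [minSmoothness_of_isRCLikeNormedField]; exact ENat.LEInfty.out)]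
    exact congrArg (mfderiv (𝓡 m) 𝓘(ℝ, 𝔼) ψ x).inverse
      (congrFun (VectorField.mlieBracket_eq_lieBracket Z Z') (ψ x))
  have hF : ∀ Z Z' : 𝔼 → 𝔼, (∀ y ∈ O, A y (Z' y) = A y (A y (Z y))) → ∀ x ∈ U,
      complexVector (VectorField.mpullback (𝓡 m) 𝓘(ℝ, 𝔼) ψ Z x)
        (VectorField.mpullback (𝓡 m) 𝓘(ℝ, 𝔼) ψ Z' x) ∈ associatedDistribution (𝓡 m) F x := by
    intro Z Z' h x hx
    exact (hmem ..).2 (((hFinv x hx.1 (Z' (ψ x))).trans (congrArg _ (h _ hx.2))).trans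
      ((congrArg (F x) (hFinv x hx.1 (Z (ψ x)))).trans (hFinv x hx.1 _)).symm)
  have := hint U hU _ _ _ _ (hsm X₁ hX₁) (hsm X₂ hX₂) (hsm Y₁ hY₁) (hsm Y₂ hY₂)
    (hF _ _ hX) (hF _ _ hY) x ⟨hx, hxO⟩
  rw [hmem, hlie _ _ hX₁ hY₁, hlie _ _ hX₁ hY₂, hlie _ _ hX₂ hY₁, hlie _ _ hX₂ hY₂, ← map_add,
    ← map_sub] at this
  have h1 := (hFinv x hx _).symm.trans (this.trans
    ((congrArg (F x) (hFinv x hx _)).trans (hFinv x hx _)))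
  have h2 := congrArg (mfderiv (𝓡 m) 𝓘(ℝ, 𝔼) ψ x) h1
  exact (hψinv x hx _).symm.trans (h2.trans (hψinv x hx _))

lemma contMDiffOn_endCoord {F : EndField (𝓡 m) M} (hF : ∀ x, SmoothEndAt F x) (x : M) :
    ContMDiffOn (𝓡 m) 𝓘(ℝ, 𝔼 →L[ℝ] 𝔼) ∞ (endCoord x F) (chartAt 𝔼 x).source := by
  have h1 : ContMDiffOn (𝓡 m) (endModel m) ∞ (fun y ↦ (⟨y, F y⟩ : EndBundle m M))
    (chartAt 𝔼 x).source := fun y _ ↦ (hF y).contMDiffWithinAt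
  exact ((trivializationAt (𝔼 →L[ℝ] 𝔼) (fun x : M ↦ TangentSpace (𝓡 m) x →L[ℝ]
    TangentSpace (𝓡 m) x) x).contMDiffOn_section_iff (chartAt 𝔼 x).open_source
    (by simp)).1 h1

lemma endCoord_mfderiv (F : EndField (𝓡 m) M) {x y : M} (hy : y ∈ (chartAt 𝔼 x).source)
    (v : TangentSpace (𝓡 m) y) :
    endCoord x F y (mfderiv (𝓡 m) 𝓘(ℝ, 𝔼) (extChartAt (𝓡 m) x) y v) =
      mfderiv (𝓡 m) 𝓘(ℝ, 𝔼) (extChartAt (𝓡 m) x) y (F y v) := by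
  have h1 := endCoord_apply F (FiberBundle.extend 𝔼 v) hy
  rw [fieldCoord_eq_mfderiv _ hy, fieldCoord_eq_mfderiv _ hy] at h1
  simpa using h1

/-- An integrable almost `f`-structure can be straightened such that its kernel is constant. -/
theorem exists_straightening {F : EndField (𝓡 m) M} (hF : ∀ x, SmoothEndAt F x)
    (hcube : ∀ x v, F x (F x (F x v)) = -F x v)
    (hint : IsIntegrableDistribution (𝓡 m) (associatedDistribution (𝓡 m) F)) (x₀ : M) :
    ∃ (W : Set M) (ψ : M → 𝔼) (G : Set 𝔼) (A : 𝔼 → 𝔼 →L[ℝ] 𝔼), IsOpen W ∧ x₀ ∈ W ∧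
      IsOpen G ∧ ψ x₀ = 0 ∧ ψ '' W = G ∧ ContMDiffOn (𝓡 m) 𝓘(ℝ, 𝔼) ∞ ψ W ∧
      (∀ x ∈ W, (mfderiv (𝓡 m) 𝓘(ℝ, 𝔼) ψ x).IsInvertible) ∧
      (∀ x ∈ W, ∀ v : TangentSpace (𝓡 m) x,
        A (ψ x) (mfderiv (𝓡 m) 𝓘(ℝ, 𝔼) ψ x v) = mfderiv (𝓡 m) 𝓘(ℝ, 𝔼) ψ x (F x v)) ∧
      ContDiffOn ℝ ∞ A G ∧ ∀ z ∈ G, ∀ κ, A z κ = 0 ↔ A 0 κ = 0 := by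
  set χ := extChartAt (𝓡 m) x₀
  set A₀ : 𝔼 → 𝔼 →L[ℝ] 𝔼 := fun y ↦ endCoord x₀ F (χ.symm y)
  have hχU : IsOpen χ.target := isOpen_extChartAt_target x₀
  have hsrc : χ.source = (chartAt 𝔼 x₀).source := extChartAt_source ..
  have hA₀ : ContDiffOn ℝ ∞ A₀ χ.target :=
    ((contMDiffOn_endCoord hF x₀).comp (contMDiffOn_extChartAt_symm x₀)
      (hsrc ▸ χ.mapsTo_symm)).contDiffOn
  have hχs : ContMDiffOn (𝓡 m) 𝓘(ℝ, 𝔼) ∞ χ χ.source := hsrc ▸ contMDiffOn_extChartAt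
  have hχo : IsOpen χ.source := isOpen_extChartAt_source x₀
  have hχinv : ∀ x ∈ χ.source, (mfderiv (𝓡 m) 𝓘(ℝ, 𝔼) χ x).IsInvertible := fun x hx ↦
    isInvertible_mfderiv_extChartAt hx
  have hχA : ∀ x ∈ χ.source, ∀ v : TangentSpace (𝓡 m) x,
      A₀ (χ x) (mfderiv (𝓡 m) 𝓘(ℝ, 𝔼) χ x v) = mfderiv (𝓡 m) 𝓘(ℝ, 𝔼) χ x (F x v) := by
    intro x hx v
    rw [← endCoord_mfderiv F (hsrc ▸ hx)]
    simp only [A₀]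
    rw [χ.left_inv hx]
  have hcube₀ : ∀ y ∈ χ.target, ∀ v, A₀ y (A₀ y (A₀ y v)) = -A₀ y v := by
    intro y hy v
    have hx := χ.map_target hy
    obtain ⟨e, he⟩ := hχinv _ hx
    have h1 := fun u ↦ hχA _ hx u
    rw [χ.right_inv hy, ← he] at h1
    obtain ⟨u, rfl⟩ := e.surjective v
    exact (congrArg (A₀ y) ((congrArg (A₀ y) (h1 u)).trans (h1 _))).trans ((h1 _).trans
      ((congrArg e (hcube _ u)).trans ((map_neg e _).trans (congrArg Neg.neg (h1 u).symm))))
  -- `1 + A₀²` is the projection onto the kernel of `A₀`.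
  set P : 𝔼 → 𝔼 →L[ℝ] 𝔼 := fun y ↦ ContinuousLinearMap.id ℝ 𝔼 + (A₀ y).comp (A₀ y)
  have hPv : ∀ y v, P y v = v + A₀ y (A₀ y v) := fun y v ↦ rfl
  have hPfix : ∀ y ∈ χ.target, ∀ v, P y v = v ↔ A₀ y v = 0 := by
    intro y hy v
    rw [hPv, add_eq_left]
    refine ⟨fun h ↦ ?_, fun h ↦ by rw [h, map_zero]⟩
    have := hcube₀ y hy v
    rw [h, map_zero] at this
    exact neg_eq_zero.1 this.symm
  obtain ⟨Φ, h0, hΦ0, hΦt, hΦs, hΦs', hΦ⟩ := exists_openPartialHomeomorph_of_involutive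
    (P := P) hχU (contDiffOn_const.add (hA₀.clm_comp hA₀))
    (fun y hy v ↦ by rw [hPfix y hy, hPv, map_add, hcube₀ y hy, add_neg_cancel])
    (fun y hy X Y hX hY hPX hPY ↦ by
      obtain ⟨O, hO, hOo, hyO⟩ := mem_nhds_iff.1 (hPX.and (hPY.and (hχU.mem_nhds hy)))
      -- Applied to real sections of the kernel (zero imaginary parts), integrability becomes
      -- involutivity of the kernel.
      have h1 := hint.lieBracket_of_local_diffeo hcube hχo hχs hχinv hχA hOo
        (X₁ := X) (X₂ := 0) (Y₁ := Y) (Y₂ := 0) hX.contDiffOn contDiffOn_const hY.contDiffOn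
        contDiffOn_const
        (fun z hz ↦ by simp [(hPfix z (hO hz).2.2 _).1 (hO hz).1])
        (fun z hz ↦ by simp [(hPfix z (hO hz).2.2 _).1 (hO hz).2.1])
        (χ.map_target hy) (by rw [χ.right_inv hy]; exact hyO)
      rw [χ.right_inv hy] at h1
      have e1 : VectorField.lieBracket ℝ X 0 y = 0 := by simp [VectorField.lieBracket]
      have e2 : VectorField.lieBracket ℝ (0 : 𝔼 → 𝔼) Y y = 0 := by simp [VectorField.lieBracket]
      have e3 : VectorField.lieBracket ℝ (0 : 𝔼 → 𝔼) 0 y = 0 := by simp [VectorField.lieBracket]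
      rw [e1, e2, e3, add_zero, map_zero, sub_zero] at h1
      rw [hPv, ← h1, add_zero])
    (mem_extChartAt_target x₀)
  have hΦe : ∀ z ∈ Φ.source, ∀ v, fderiv ℝ Φ.symm (Φ z) (fderiv ℝ Φ z v) = v := by
    intro z hz v
    have h1 := ((hΦs.contDiffAt (Φ.open_source.mem_nhds hz)).differentiableAt
      (by simp)).hasFDerivAt
    have h2 := ((hΦs'.contDiffAt (Φ.open_target.mem_nhds (Φ.map_source hz))).differentiableAt
      (by simp)).hasFDerivAt
    have h3 := (h2.comp z h1).congr_of_eventuallyEq (f₁ := id) (by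
      filter_upwards [Φ.open_source.mem_nhds hz] with y hy using (Φ.left_inv hy).symm)
    exact congrArg (fun T ↦ T v) (h3.unique (hasFDerivAt_id z))
  set A : 𝔼 → 𝔼 →L[ℝ] 𝔼 := fun z ↦ (fderiv ℝ Φ.symm (Φ z)).comp
    ((A₀ (Φ z)).comp (fderiv ℝ Φ z))
  set W := χ.source ∩ χ ⁻¹' Φ.target
  have hWo : IsOpen W := hχs.continuousOn.isOpen_inter_preimage hχo Φ.open_target
  set ψ : M → 𝔼 := fun x ↦ Φ.symm (χ x)
  have hψ' : ∀ x ∈ W, mfderiv (𝓡 m) 𝓘(ℝ, 𝔼) ψ x =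
      (fderiv ℝ Φ.symm (χ x)).comp (mfderiv (𝓡 m) 𝓘(ℝ, 𝔼) χ x) := by
    intro x hx
    have h1 : MDifferentiableAt 𝓘(ℝ, 𝔼) 𝓘(ℝ, 𝔼) Φ.symm (χ x) :=
      ((hΦs'.contDiffAt (Φ.open_target.mem_nhds hx.2)).differentiableAt
        (by simp)).mdifferentiableAt
    have h2 : MDifferentiableAt (𝓡 m) 𝓘(ℝ, 𝔼) χ x :=
      (hχs.contMDiffAt (hχo.mem_nhds hx.1)).mdifferentiableAt (by simp)
    have h3 := mfderiv_comp x h1 h2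
    rw [mfderiv_eq_fderiv] at h3
    exact h3
  have hΦΦ : ∀ y ∈ Φ.target, ∃ e : 𝔼 ≃L[ℝ] 𝔼, fderiv ℝ Φ.symm y = (e.symm : 𝔼 →L[ℝ] 𝔼) ∧
      fderiv ℝ Φ (Φ.symm y) = (e : 𝔼 →L[ℝ] 𝔼) := by
    intro y hy
    have hz := Φ.map_target hy
    obtain ⟨e, he⟩ := (hΦ _ hz).1
    refine ⟨e, ?_, he.fderiv⟩
    ext1 v
    have h1 := hΦe _ hz (e.symm v)
    rw [Φ.right_inv hy, he.fderiv] at h1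
    simpa using h1
  refine ⟨W, ψ, Φ.source, A, hWo, ⟨mem_extChartAt_source x₀, ?_⟩, Φ.open_source, ?_, ?_, ?_, ?_, ?_,
    ?_, ?_⟩
  · rw [Set.mem_preimage, ← hΦ0]; exact Φ.map_source h0
  · simp only [ψ]; rw [← hΦ0, Φ.left_inv h0]
  · ext z
    constructor
    · rintro ⟨x, hx, rfl⟩
      exact Φ.map_target hx.2
    · intro hz
      have h1 := Φ.map_source hz
      have h2 := hΦt h1
      refine ⟨χ.symm (Φ z), ⟨χ.map_target h2, ?_⟩, ?_⟩
      · rw [Set.mem_preimage, χ.right_inv h2]; exact h1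
      · simp only [ψ]; rw [χ.right_inv h2, Φ.left_inv hz]
  · exact hΦs'.contMDiffOn.comp (hχs.mono Set.inter_subset_left) fun x hx ↦ hx.2
  · intro x hx
    rw [hψ' x hx]
    obtain ⟨e, he, -⟩ := hΦΦ _ hx.2
    obtain ⟨e', he'⟩ := hχinv x hx.1
    rw [he, ← he']
    exact ⟨e'.trans e.symm, rfl⟩
  · intro x hx v
    rw [hψ' x hx]
    obtain ⟨e, he, he2⟩ := hΦΦ _ hx.2
    have e1 : Φ (ψ x) = χ x := Φ.right_inv hx.2
    have e2 : fderiv ℝ Φ (ψ x) = e := he2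
    simp only [A, e1, e2, he]
    exact congrArg e.symm ((congrArg (A₀ (χ x)) (e.apply_symm_apply _)).trans (hχA x hx.1 v))
  · exact ((hΦs'.fderiv_of_isOpen Φ.open_target (by simp)).comp hΦs Φ.mapsTo).clm_comp
      ((hA₀.comp hΦs fun z hz ↦ hΦt (Φ.map_source hz)).clm_comp
        (hΦs.fderiv_of_isOpen Φ.open_source (by simp)))
  -- The kernel of the transported structure is the preimage under `dΦ` of the kernel of `A₀`, which
  -- the Frobenius chart makes independent of `z`.
  · have key : ∀ z ∈ Φ.source, ∀ κ, A z κ = 0 ↔ P (χ x₀) κ = κ := by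
      intro z hz κ
      rw [← (hΦ z hz).2 κ, hPfix _ (hΦt (Φ.map_source hz))]
      obtain ⟨e, he, -⟩ := hΦΦ _ (Φ.map_source hz)
      simp only [A, he, ContinuousLinearMap.comp_apply, ContinuousLinearEquiv.coe_coe,
        EmbeddingLike.map_eq_zero_iff]
    intro z hz κ
    rw [key z hz, key 0 h0]

end Straightening

end

/-! ### Descent of the `f`-structure to an almost complex structure on the plane -/

noncomputable section

section Plane

/-- The derivatives of a local diffeomorphism and of its inverse are inverse to each other. -/
lemma OpenPartialHomeomorph.fderiv_symm_apply_fderiv {E E' : Type*} [NormedAddCommGroup E]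
    [NormedSpace ℝ E] [NormedAddCommGroup E'] [NormedSpace ℝ E'] (Φ : OpenPartialHomeomorph E E')
    {z : E} (hz : z ∈ Φ.source) (h1 : DifferentiableAt ℝ Φ z)
    (h2 : DifferentiableAt ℝ Φ.symm (Φ z)) (v : E) :
    fderiv ℝ Φ.symm (Φ z) (fderiv ℝ Φ z v) = v := by
  have h3 := (h2.hasFDerivAt.comp z h1.hasFDerivAt).congr_of_eventuallyEq (f₁ := id) (by
    filter_upwards [Φ.open_source.mem_nhds hz] with y hy using (Φ.left_inv hy).symm)
  exact congrArg (fun T ↦ T v) (h3.unique (hasFDerivAt_id z))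

variable {E : Type*} [NormedAddCommGroup E] [NormedSpace ℝ E] [FiniteDimensional ℝ E]

/-- A basis of the image of an `f`-structure of rank two provides compatible projections onto
the plane. -/
lemma exists_plane_projection {F : E →L[ℝ] E} (hcube : ∀ v, F (F (F v)) = -F v) {v₀ : E}
    (hv₀ : v₀ ≠ 0) (hv : F (F v₀) = -v₀)
    (hrank : ∀ w, F (F w) = -w → ∃ a b : ℝ, w = a • v₀ + b • F v₀) :
    ∃ (S : EuclideanSpace ℝ (Fin 2) →L[ℝ] E) (T : E →L[ℝ] EuclideanSpace ℝ (Fin 2)),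
      (∀ a, T (S a) = a) ∧ (∀ v, S (T v) = -F (F v)) := by
  set S : EuclideanSpace ℝ (Fin 2) →L[ℝ] E :=
    (EuclideanSpace.proj (0 : Fin 2)).smulRight v₀ + (EuclideanSpace.proj (1 : Fin 2)).smulRight (F v₀)
  have hS : ∀ a, S a = a 0 • v₀ + a 1 • F v₀ := fun a ↦ by simp [S]
  have hSker : LinearMap.ker (S : EuclideanSpace ℝ (Fin 2) →ₗ[ℝ] E) = ⊥ := by
    rw [LinearMap.ker_eq_bot']
    intro a ha
    have h1 : a 0 • v₀ + a 1 • F v₀ = 0 := (hS a).symm.trans ha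
    have h2 := congrArg F h1
    rw [map_add, map_smul, map_smul, hv, map_zero] at h2
    have h3 : (a 0 ^ 2 + a 1 ^ 2) • v₀ = 0 := by
      linear_combination (norm := module) a 0 • h1 - a 1 • h2
    have h4 := (smul_eq_zero.1 h3).resolve_right hv₀
    ext i
    fin_cases i
    · simp only [Fin.zero_eta, PiLp.zero_apply]; nlinarith [sq_nonneg (a 0), sq_nonneg (a 1)]
    · simp only [Fin.mk_one, PiLp.zero_apply]; nlinarith [sq_nonneg (a 0), sq_nonneg (a 1)]
  obtain ⟨L, hL⟩ := LinearMap.exists_leftInverse_of_injective _ hSker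
  have hL' : ∀ a, L (S a) = a := fun a ↦ congrArg (fun T ↦ T a) hL
  have hFS : ∀ a, -F (F (S a)) = S a := fun a ↦ by
    rw [hS, map_add, map_add, map_smul, map_smul, map_smul, map_smul, hcube, hv]; module
  refine ⟨S, (LinearMap.toContinuousLinearMap L).comp (-(F.comp F)), fun a ↦ ?_, fun v ↦ ?_⟩
  · exact (congrArg L (hFS a)).trans (hL' a)
  · obtain ⟨a, b, hab⟩ := hrank (-F (F v)) (by simp [hcube])
    have h1 : -F (F v) = S !₂[a, b] := by rw [hab, hS]; simp
    have h2 : L (-F (F v)) = !₂[a, b] := by rw [h1, hL']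
    exact (congrArg S h2).trans h1.symm

/-- An almost `f`-structure of rank two, with constant kernel and constant, along the kernel,
modulo the kernel, is locally defined by a submersion onto the plane. -/
theorem exists_submersion_plane {G : Set E} (hG : IsOpen G) (h0 : (0 : E) ∈ G) {A : E → E →L[ℝ] E}
    (hA : ContDiffOn ℝ ∞ A G) (hcube : ∀ z ∈ G, ∀ v, A z (A z (A z v)) = -A z v)
    (hker : ∀ z ∈ G, ∀ κ, A z κ = 0 ↔ A 0 κ = 0)
    (hder : ∀ z ∈ G, ∀ κ v, A 0 κ = 0 → A z (fderiv ℝ A z κ v) = 0) {v₀ : E}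
    (hv₀ : v₀ ≠ 0) (hv : A 0 (A 0 v₀) = -v₀)
    (hrank : ∀ w, A 0 (A 0 w) = -w → ∃ a b : ℝ, w = a • v₀ + b • A 0 v₀) :
    ∃ (V : Set E) (φ : E → EuclideanSpace ℝ (Fin 2))
      (J : EuclideanSpace ℝ (Fin 2) → EuclideanSpace ℝ (Fin 2) →L[ℝ] EuclideanSpace ℝ (Fin 2)),
      V ⊆ G ∧ IsOpen V ∧ 0 ∈ V ∧ ContDiffOn ℝ ∞ φ V ∧ φ '' V = Set.univ ∧ ContDiff ℝ ∞ J ∧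
      (∀ q v, J q (J q v) = -v) ∧ ∀ z ∈ V, Function.Surjective (fderiv ℝ φ z) ∧
        (∀ v, fderiv ℝ φ z v = 0 ↔ A z v = 0) ∧
        ∀ v, J (φ z) (fderiv ℝ φ z v) = fderiv ℝ φ z (A z v) := by
  obtain ⟨S, T, hTS, hST⟩ := exists_plane_projection (hcube 0 h0) hv₀ hv hrank
  have hT : ∀ v, T v = 0 ↔ A 0 v = 0 := by
    intro v
    constructor
    · intro h
      have h1 := hST v
      rw [h, map_zero, zero_eq_neg] at h1
      have h2 := hcube 0 h0 v
      rw [h1, map_zero, zero_eq_neg] at h2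
      exact h2
    · intro h
      have h1 := hST v
      rw [h, map_zero, neg_zero] at h1
      rw [← hTS (T v), h1, map_zero]
  -- The endomorphism induced by `A z` on the quotient by the constant kernel, identified with the
  -- plane through `T`, with section `S`.
  set J₀ : E → EuclideanSpace ℝ (Fin 2) →L[ℝ] EuclideanSpace ℝ (Fin 2) := fun z ↦
    T.comp ((A z).comp S)
  have hJ₀ : ∀ z a, J₀ z a = T (A z (S a)) := fun _ _ ↦ rfl
  have hTA : ∀ z ∈ G, ∀ v, T (A z v) = J₀ z (T v) := by
    intro z hz v
    have h1 : A z (v - S (T v)) = 0 := by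
      rw [hker z hz, ← hT, map_sub, hTS, sub_self]
    rw [map_sub, sub_eq_zero] at h1
    rw [hJ₀, ← h1]
  have hJJ : ∀ z ∈ G, ∀ a, J₀ z (J₀ z a) = -a := by
    intro z hz a
    rw [hJ₀ z a, ← hTA z hz]
    have h1 : A z (A z (A z (S a)) + S a) = 0 := by rw [map_add, hcube z hz, neg_add_cancel]
    rw [hker z hz, ← hT, map_add, hTS] at h1
    exact eq_neg_of_add_eq_zero_left h1
  have hJs : ContDiffOn ℝ ∞ J₀ G := contDiffOn_const.clm_comp (hA.clm_comp contDiffOn_const)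
  have hJd : ∀ z ∈ G, ∀ κ, A 0 κ = 0 → fderiv ℝ J₀ z κ = 0 := by
    intro z hz κ hκ
    have h1 := ((hA.contDiffAt (hG.mem_nhds hz)).differentiableAt (by simp)).hasFDerivAt
    have h2 := (hasFDerivAt_const T z).clm_comp (h1.clm_comp (hasFDerivAt_const S z))
    have h3 : fderiv ℝ J₀ z = _ := h2.fderiv
    rw [h3]
    ext1 a
    have h4 := hder z hz κ (S a) hκ
    rw [hker z hz, ← hT] at h4
    simpa using h4
  obtain ⟨ε, hε, hεG⟩ := Metric.isOpen_iff.1 hG 0 h0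
  -- Half of `ε` bounds `S a` for `‖a‖ < r`, the other half bounds the kernel part; the `+ 1` keeps
  -- the denominator positive. The tube `V` so obtained lies in `G` and contains the segments along
  -- the kernel needed below.
  set r : ℝ := ε / 2 / (‖S‖ + 1) with hr
  have hr0 : 0 < r := by positivity
  set V : Set E := {z | ‖T z‖ < r ∧ ‖z - S (T z)‖ < ε / 2}
  have hVo : IsOpen V := (isOpen_lt (f := fun z ↦ ‖T z‖) (by fun_prop) continuous_const).inter
    (isOpen_lt (f := fun z ↦ ‖z - S (T z)‖) (by fun_prop) continuous_const)
  have hball : ∀ a : EuclideanSpace ℝ (Fin 2), ‖a‖ < r → ‖S a‖ < ε / 2 := by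
    intro a ha
    calc ‖S a‖ ≤ ‖S‖ * ‖a‖ := S.le_opNorm a
      _ ≤ (‖S‖ + 1) * ‖a‖ := by gcongr; linarith
      _ < (‖S‖ + 1) * r := by gcongr
      _ = ε / 2 := by rw [hr]; field_simp
  have hVG : V ⊆ G := by
    intro z hz
    apply hεG
    rw [mem_ball_zero_iff]
    calc ‖z‖ = ‖S (T z) + (z - S (T z))‖ := by rw [add_sub_cancel]
      _ ≤ ‖S (T z)‖ + ‖z - S (T z)‖ := norm_add_le _ _
      _ < ε := by linarith [hball _ hz.1, hz.2]
  have hSV : ∀ a : EuclideanSpace ℝ (Fin 2), ‖a‖ < r → S a ∈ V := fun a ha ↦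
    ⟨by rwa [hTS], by rw [hTS, sub_self, norm_zero]; positivity⟩
  -- The point `z` is joined to `S (T z)` by a segment along the kernel, on which `J₀` has zero
  -- derivative by `hJd`.
  have hJconst : ∀ z ∈ V, J₀ z = J₀ (S (T z)) := by
    intro z hz
    set k := z - S (T z)
    have hk : T k = 0 := by rw [map_sub, hTS, sub_self]
    have hseg : ∀ s ∈ Set.Icc (0 : ℝ) 1, S (T z) + s • k ∈ V := by
      intro s hs
      have e : T (S (T z) + s • k) = T z := by rw [map_add, hTS, map_smul, hk, smul_zero, add_zero]
      refine ⟨by rw [e]; exact hz.1, ?_⟩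
      rw [e, add_sub_cancel_left, norm_smul, Real.norm_eq_abs, abs_of_nonneg hs.1]
      exact (mul_le_of_le_one_left (norm_nonneg k) hs.2).trans_lt hz.2
    have hd : ∀ s ∈ Set.Icc (0 : ℝ) 1, HasDerivAt (fun s : ℝ ↦ J₀ (S (T z) + s • k)) 0 s := by
      intro s hs
      have h1 := ((hJs.contDiffAt (hG.mem_nhds (hVG (hseg s hs)))).differentiableAt
        (by simp)).hasFDerivAt
      have h2 : HasDerivAt (fun s : ℝ ↦ S (T z) + s • k) k s := by
        simpa using ((hasDerivAt_id s).smul_const k).const_add (S (T z))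
      have h3 := h1.comp_hasDerivAt s h2
      rwa [hJd _ (hVG (hseg s hs)) k ((hT k).1 hk)] at h3
    have h1 := constant_of_has_deriv_right_zero
      (fun s hs ↦ (hd s hs).continuousAt.continuousWithinAt)
      (fun s hs ↦ (hd s (Set.Ico_subset_Icc_self hs)).hasDerivWithinAt) 1 (by simp)
    simpa [k] using h1
  -- A diffeomorphism of the plane onto the disc of radius `r`, used to make the submersion onto the
  -- whole plane.
  set h := OpenPartialHomeomorph.univBall (0 : EuclideanSpace ℝ (Fin 2)) r
  have hsrc : h.source = Set.univ := OpenPartialHomeomorph.univBall_source 0 r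
  have htgt : h.target = Metric.ball 0 r := OpenPartialHomeomorph.univBall_target 0 hr0
  have hh : ContDiff ℝ ∞ h := OpenPartialHomeomorph.contDiff_univBall
  have hh' : ContDiffOn ℝ ∞ h.symm h.target := htgt ▸ OpenPartialHomeomorph.contDiffOn_univBall_symm
  have hmap : ∀ q, h q ∈ h.target := fun q ↦ h.map_source (by rw [hsrc]; trivial)
  have htgt' : ∀ b, b ∈ h.target ↔ ‖b‖ < r := fun b ↦ by rw [htgt, mem_ball_zero_iff]
  have hd : ∀ q, DifferentiableAt ℝ h q := fun q ↦ (hh.differentiable (by simp)).differentiableAt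
  have hd' : ∀ b ∈ h.target, DifferentiableAt ℝ h.symm b := fun b hb ↦
    (hh'.contDiffAt (h.open_target.mem_nhds hb)).differentiableAt (by simp)
  have hinv : ∀ q v, fderiv ℝ h.symm (h q) (fderiv ℝ h q v) = v := fun q v ↦
    h.fderiv_symm_apply_fderiv (by rw [hsrc]; trivial) (hd q) (hd' _ (hmap q)) v
  have hinv' : ∀ b ∈ h.target, ∀ v, fderiv ℝ h (h.symm b) (fderiv ℝ h.symm b v) = v :=
    fun b hb v ↦ h.symm.fderiv_symm_apply_fderiv hb (hd' b hb) (hd _) v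
  have hφ' : ∀ z ∈ V, fderiv ℝ (fun z ↦ h.symm (T z)) z = (fderiv ℝ h.symm (T z)).comp T :=
    fun z hz ↦ ((hd' _ ((htgt' _).2 hz.1)).hasFDerivAt.comp z T.hasFDerivAt).fderiv
  refine ⟨V, fun z ↦ h.symm (T z), fun q ↦ (fderiv ℝ h.symm (h q)).comp
    ((J₀ (S (h q))).comp (fderiv ℝ h q)), hVG, hVo, by simp [V, hr0, hε], ?_, ?_, ?_, ?_, ?_⟩
  · exact hh'.comp T.contDiff.contDiffOn fun z hz ↦ (htgt' _).2 hz.1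
  · refine Set.eq_univ_of_forall fun q ↦ ⟨S (h q), hSV _ ((htgt' _).1 (hmap q)), ?_⟩
    simp only [hTS]
    exact h.left_inv (by rw [hsrc]; trivial)
  · have e1 : ContDiff ℝ ∞ (fun q ↦ fderiv ℝ h.symm (h q)) :=
      contDiffOn_univ.1 ((hh'.fderiv_of_isOpen h.open_target (by simp)).comp hh.contDiffOn
        fun q _ ↦ hmap q)
    have e2 : ContDiff ℝ ∞ (fun q ↦ J₀ (S (h q))) :=
      contDiffOn_univ.1 (hJs.comp (S.contDiff.comp hh).contDiffOn
        fun q _ ↦ hVG (hSV _ ((htgt' _).1 (hmap q))))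
    exact e1.clm_comp (e2.clm_comp (hh.fderiv_right (by simp)))
  · intro q v
    simp only [ContinuousLinearMap.comp_apply]
    rw [← h.left_inv (show q ∈ h.source by rw [hsrc]; trivial), h.right_inv (hmap q),
      hinv' _ (hmap q), hJJ _ (hVG (hSV _ ((htgt' _).1 (hmap q)))), map_neg]
    have := hinv (h.symm (h q)) v
    rw [h.right_inv (hmap q)] at this
    rw [this]
  · intro z hz
    have hb := (htgt' _).2 hz.1
    have hinj : ∀ u, fderiv ℝ h.symm (T z) u = 0 ↔ u = 0 := fun u ↦
      ⟨fun hu ↦ by rw [← hinv' _ hb u, hu, map_zero], fun hu ↦ by rw [hu, map_zero]⟩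
    rw [hφ' z hz]
    refine ⟨fun q ↦ ⟨S (fderiv ℝ h (h.symm (T z)) q), ?_⟩, fun v ↦ ?_, fun v ↦ ?_⟩
    · rw [ContinuousLinearMap.comp_apply, hTS]
      have := hinv (h.symm (T z)) q
      rwa [h.right_inv hb] at this
    · rw [ContinuousLinearMap.comp_apply, hinj, hT, hker z (hVG hz)]
    · simp only [ContinuousLinearMap.comp_apply]
      rw [h.right_inv hb, hinv' _ hb, ← hJconst z hz, hTA z (hVG hz)]

end Plane

/-! ### The local submersion defined by an integrable almost `f`-structure of rank two -/

section Submersion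

variable {m : ℕ} {M : Type*} [TopologicalSpace M] [ChartedSpace (EuclideanSpace ℝ (Fin m)) M]
  [IsManifold (𝓡 m) ∞ M]

/-- An integrable almost `f`-structure of rank two is locally defined by a submersion onto the
plane endowed with an almost complex structure. -/
theorem exists_submersion_of_isIntegrableDistribution {F : EndField (𝓡 m) M}
    (hF : ∀ x, SmoothEndAt F x) (hcube : ∀ x v, F x (F x (F x v)) = -F x v)
    (hint : IsIntegrableDistribution (𝓡 m) (associatedDistribution (𝓡 m) F)) {x₀ : M}
    {v₀ : TangentSpace (𝓡 m) x₀} (hv₀ : v₀ ≠ 0) (hv : F x₀ (F x₀ v₀) = -v₀)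
    (hrank : ∀ w, F x₀ (F x₀ w) = -w → ∃ a b : ℝ, w = a • v₀ + b • F x₀ v₀) :
    ∃ (W : Set M) (φ : M → EuclideanSpace ℝ (Fin 2))
      (J : EuclideanSpace ℝ (Fin 2) → EuclideanSpace ℝ (Fin 2) →L[ℝ] EuclideanSpace ℝ (Fin 2)),
      IsOpen W ∧ x₀ ∈ W ∧ ContMDiffOn (𝓡 m) (𝓡 2) ∞ φ W ∧ φ '' W = Set.univ ∧ ContDiff ℝ ∞ J ∧
      (∀ q v, J q (J q v) = -v) ∧ ∀ x ∈ W, Function.Surjective (mfderiv (𝓡 m) (𝓡 2) φ x) ∧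
        (∀ v, mfderiv (𝓡 m) (𝓡 2) φ x v = 0 ↔ F x v = 0) ∧
        ∀ v, J (φ x) (mfderiv (𝓡 m) (𝓡 2) φ x v) = mfderiv (𝓡 m) (𝓡 2) φ x (F x v) := by
  obtain ⟨W, ψ, G, A, hW, hxW, hG, hψ0, hψW, hψ, hψinv, hψA, hA, hker⟩ :=
    exists_straightening hF hcube hint x₀
  have h0G : (0 : EuclideanSpace ℝ (Fin m)) ∈ G := by
    rw [← hψ0, ← hψW]; exact Set.mem_image_of_mem ψ hxW
  have hcubeA : ∀ z ∈ G, ∀ v, A z (A z (A z v)) = -A z v := by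
    intro z hz v
    obtain ⟨x, hx, rfl⟩ := hψW ▸ hz
    obtain ⟨e, he⟩ := hψinv x hx
    have h1 := fun u ↦ hψA x hx u
    rw [← he] at h1
    obtain ⟨u, rfl⟩ := e.surjective v
    exact (congrArg (A (ψ x)) ((congrArg (A (ψ x)) (h1 u)).trans (h1 _))).trans ((h1 _).trans
      ((congrArg e (hcube _ u)).trans ((map_neg e _).trans (congrArg Neg.neg (h1 u).symm))))
  have hder : ∀ z ∈ G, ∀ κ v, A 0 κ = 0 → A z (fderiv ℝ A z κ v) = 0 := by
    intro z hz κ v hκ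
    obtain ⟨x, hx, rfl⟩ := hψW ▸ hz
    have hAd := ((hA.contDiffAt (hG.mem_nhds hz)).differentiableAt (by simp)).hasFDerivAt
    -- The bracket of `v + i A v` with the constant kernel field `κ`: its real part is zero and its
    -- imaginary part is, up to sign, `(∂_κ A) v`.
    have h1 := hint.lieBracket_of_local_diffeo hcube hW hψ hψinv hψA hG
      (X₁ := fun _ ↦ v) (X₂ := fun z ↦ A z v) (Y₁ := fun _ ↦ κ) (Y₂ := fun _ ↦ 0)
      contDiffOn_const (hA.clm_apply contDiffOn_const) contDiffOn_const contDiffOn_const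
      (fun y hy ↦ rfl) (fun y hy ↦ by rw [(hker y hy κ).2 hκ]) hx hz
    have h2 : fderiv ℝ (fun z ↦ A z v) (ψ x) κ = fderiv ℝ A (ψ x) κ v := by
      have h3 : fderiv ℝ (fun z ↦ A z v) (ψ x) = _ :=
        (hAd.clm_apply (hasFDerivAt_const v (ψ x))).fderiv
      rw [h3]; simp
    simp only [VectorField.lieBracket, fderiv_const_apply, map_zero, zero_apply, sub_self,
      zero_add, h2, zero_sub, map_neg, neg_eq_zero] at h1
    exact h1
  obtain ⟨e, he⟩ := hψinv x₀ hxW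
  have heA : ∀ v, A 0 (e v) = e (F x₀ v) := fun v ↦ by
    have h1 := hψA x₀ hxW v
    rw [← he, hψ0] at h1
    exact h1
  have heA2 : ∀ v, A 0 (A 0 (e v)) = e (F x₀ (F x₀ v)) := fun v ↦
    (congrArg (A 0) (heA v)).trans (heA _)
  obtain ⟨V, φ, J, hVG, hV, h0V, hφ, hφV, hJ, hJ2, hφJ⟩ := exists_submersion_plane hG h0G hA hcubeA
    hker hder (v₀ := e v₀) (fun h ↦ hv₀ (e.map_eq_zero_iff.1 h))
    ((heA2 v₀).trans ((congrArg e hv).trans (map_neg e _)))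
    (fun u hu ↦ by
      obtain ⟨u, rfl⟩ := e.surjective u
      have h1 : F x₀ (F x₀ u) = -u :=
        e.injective ((heA2 u).symm.trans (hu.trans (map_neg e u).symm))
      obtain ⟨a, b, hab⟩ := hrank u h1
      refine ⟨a, b, ?_⟩
      have h2 : e u = a • e v₀ + b • e (F x₀ v₀) := by rw [hab, map_add, map_smul, map_smul]
      exact h2.trans (congrArg (fun t ↦ a • e v₀ + b • t) (heA v₀).symm))
  have hφψ : ∀ x ∈ W ∩ ψ ⁻¹' V, ∀ v, mfderiv (𝓡 m) (𝓡 2) (φ ∘ ψ) x v =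
      fderiv ℝ φ (ψ x) (mfderiv (𝓡 m) 𝓘(ℝ, EuclideanSpace ℝ (Fin m)) ψ x v) := by
    intro x hx v
    have h1 : MDifferentiableAt 𝓘(ℝ, EuclideanSpace ℝ (Fin m)) 𝓘(ℝ, EuclideanSpace ℝ (Fin 2))
        φ (ψ x) := ((hφ.contDiffAt (hV.mem_nhds hx.2)).differentiableAt (by simp)).mdifferentiableAt
    have h2 : MDifferentiableAt (𝓡 m) 𝓘(ℝ, EuclideanSpace ℝ (Fin m)) ψ x :=
      (hψ.contMDiffAt (hW.mem_nhds hx.1)).mdifferentiableAt (by simp)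
    have h3 := mfderiv_comp x h1 h2
    rw [mfderiv_eq_fderiv] at h3
    exact congrArg (fun T ↦ T v) h3
  refine ⟨W ∩ ψ ⁻¹' V, φ ∘ ψ, J, hψ.continuousOn.isOpen_inter_preimage hW hV,
    ⟨hxW, by rw [Set.mem_preimage, hψ0]; exact h0V⟩, ?_, ?_, hJ, hJ2, ?_⟩
  · exact hφ.contMDiffOn.comp (hψ.mono Set.inter_subset_left) fun x hx ↦ hx.2
  · refine Set.eq_univ_of_forall fun q ↦ ?_
    obtain ⟨z, hz, rfl⟩ := hφV ▸ Set.mem_univ q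
    obtain ⟨x, hx, rfl⟩ := hψW ▸ hVG hz
    exact ⟨x, ⟨hx, hz⟩, rfl⟩
  · intro x hx
    obtain ⟨e, he⟩ := hψinv x hx.1
    have h1 := hφψ x hx
    have h2 := hψA x hx.1
    rw [← he] at h1 h2
    obtain ⟨hs, hk, hj⟩ := hφJ (ψ x) hx.2
    refine ⟨fun q ↦ ?_, fun v ↦ ?_, fun v ↦ ?_⟩
    · obtain ⟨u, hu⟩ := hs q
      exact ⟨e.symm u, (h1 _).trans ((congrArg _ (e.apply_symm_apply u)).trans hu)⟩
    · rw [h1]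
      refine (hk _).trans ?_
      have h3 : A (ψ x) (e v) = e (F x v) := h2 v
      exact ⟨fun h ↦ e.map_eq_zero_iff.1 (h3.symm.trans h),
        fun h ↦ h3.trans (e.map_eq_zero_iff.2 h)⟩
    · exact (congrArg (J (φ (ψ x))) (h1 v)).trans ((hj _).trans
        ((congrArg _ (h2 v)).trans (h1 _).symm))

end Submersion

end

/-! ### The model space, where the preferred trivializations are the identity -/

noncomputable section

section Flat

variable {n : ℕ}

local notation "𝔼" => EuclideanSpace ℝ (Fin n)

lemma fieldCoord_flat (x y : 𝔼)
    (Y : ∀ y : 𝔼, TangentSpace (𝓡 n) y) : fieldCoord x Y y = Y y :=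
  congrArg Prod.snd
    (trivializationAt_model_space_apply (I := 𝓡 n) (⟨y, Y y⟩ : TangentBundle (𝓡 n) _) x)

lemma endCoord_flat (x y : 𝔼) (F : EndField (𝓡 n) (𝔼)) :
    endCoord x F y = F y :=
  inCoordinates_tangent_bundle_core_model_space (I := 𝓡 n) (I' := 𝓡 n) x y x y (F y)

lemma flatD_flat (x : 𝔼) (Y : 𝔼 → 𝔼) :
    flatD x (M := 𝔼) Y = fderiv ℝ Y x := by
  have h : fieldCoord x (M := 𝔼) Y = Y := by
    ext1 y; exact fieldCoord_flat x y Y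
  exact (congrArg (fun f : 𝔼 → 𝔼 ↦
    mvfderiv (𝓡 n) f x) h).trans mfderiv_eq_fderiv

lemma smoothEndAt_flat {x : 𝔼}
    {F : 𝔼 → 𝔼 →L[ℝ] 𝔼}
    (hF : ContDiffAt ℝ ∞ F x) : SmoothEndAt (M := 𝔼) F x := by
  have h : endCoord x (M := 𝔼) F = F := by
    ext1 y; exact endCoord_flat x y F
  refine (contMDiffAt_hom_bundle _).2 ⟨contMDiffAt_id, ?_⟩
  exact (show ContMDiffAt (𝓡 n) 𝓘(ℝ, 𝔼 →L[ℝ] 𝔼) ∞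
    (endCoord x (M := 𝔼) F) x by
    rw [h]; exact hF.contMDiffAt)

lemma contMDiff_bilin_flat
    {g : 𝔼 → 𝔼 →L[ℝ] 𝔼 →L[ℝ] ℝ}
    (hg : ContDiff ℝ ∞ g) :
    ContMDiff (𝓡 n) ((𝓡 n).prod 𝓘(ℝ, 𝔼 →L[ℝ] 𝔼 →L[ℝ] ℝ)) ∞
      (fun b ↦ TotalSpace.mk' (𝔼 →L[ℝ] 𝔼 →L[ℝ] ℝ)
        (E := fun x : 𝔼 ↦ TangentSpace (𝓡 n) x →L[ℝ] TangentSpace (𝓡 n) x →L[ℝ] ℝ)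
        b (g b)) := by
  intro x
  refine (contMDiffAt_hom_bundle _).2 ⟨contMDiffAt_id, ?_⟩
  have h : (fun y ↦ ContinuousLinearMap.inCoordinates (𝔼)
      (TangentSpace (𝓡 n) : 𝔼 → Type _)
      (𝔼 →L[ℝ] ℝ)
      (fun x : 𝔼 ↦ TangentSpace (𝓡 n) x →L[ℝ] ℝ) x y x y (g y)) = g := by
    ext1 y
    ext u v
    have hs : ∀ u : TangentSpace (𝓡 n) y, (trivializationAt (𝔼) (TangentSpace (𝓡 n)) x).symmL
        ℝ y u = u :=
      fun u ↦ congrArg (fun T : 𝔼 →L[ℝ] 𝔼 ↦ T u)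
        (TangentBundle.symmL_model_space (𝕜 := ℝ) x y)
    have h3 : y ∈ (trivializationAt (𝔼 →L[ℝ] ℝ)
        (fun x : 𝔼 ↦ TangentSpace (𝓡 n) x →L[ℝ] ℝ) x).baseSet := by
      simp [chartAt_self_eq]
    have h4 : ∀ l : TangentSpace (𝓡 n) y →L[ℝ] ℝ,
        (trivializationAt (𝔼 →L[ℝ] ℝ)
          (fun x : 𝔼 ↦ TangentSpace (𝓡 n) x →L[ℝ] ℝ) x).continuousLinearMapAt
          ℝ y l v = l v := by
      intro l
      rw [Trivialization.continuousLinearMapAt_apply, Trivialization.linearMapAt_apply, if_pos h3,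
        hom_trivializationAt_apply]
      change (trivializationAt ℝ (Bundle.Trivial (𝔼) ℝ) x).continuousLinearMapAt ℝ y
        (l ((trivializationAt (𝔼) (TangentSpace (𝓡 n)) x).symmL ℝ y v)) = l v
      refine Eq.trans ?_ (congrArg l (hs v))
      simp
    exact (h4 _).trans (congrArg (fun u : 𝔼 ↦ g y u v) (hs u))
  have h2 := hg.contMDiff.contMDiffAt (x := x)
  rw [← h] at h2
  exact h2

end Flat

/-! ### Linear algebra of a complex structure on a real plane -/

noncomputable section

section ComplexPlane

variable {V : Type*} [AddCommGroup V] [Module ℝ V]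

lemma exists_eq_smul_add_smul_apply {J : V → V} (hJ : IsLinearMap ℝ J) (hsq : ∀ v, J (J v) = -v)
    (hV : Module.finrank ℝ V = 2) {v : V} (hv : v ≠ 0) (u : V) :
    ∃ a b : ℝ, u = a • v + b • J v := by
  have hli : LinearIndependent ℝ ![v, J v] := by
    rw [LinearIndependent.pair_iff]
    intro s t h
    have h2 := congrArg J h
    rw [hJ.map_add, hJ.map_smul, hJ.map_smul, hsq, hJ.map_zero] at h2
    have h3 : (s ^ 2 + t ^ 2) • v = 0 := by
      linear_combination (norm := module) s • h - t • h2
    have h4 : s ^ 2 + t ^ 2 = 0 := (smul_eq_zero.1 h3).resolve_right hv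
    constructor <;> nlinarith [sq_nonneg s, sq_nonneg t]
  have := Module.finite_of_finrank_pos (R := ℝ) (M := V) (by omega)
  have := hli.span_eq_top_of_card_eq_finrank' (by simp [hV])
  have h5 : u ∈ Submodule.span ℝ (Set.range ![v, J v]) := this ▸ Submodule.mem_top
  rw [Matrix.range_cons, Matrix.range_cons, Matrix.range_empty, Set.union_empty,
    Set.singleton_union, Submodule.mem_span_pair] at h5
  obtain ⟨a, b, h⟩ := h5
  exact ⟨a, b, h.symm⟩

/-- The bilinear map of a torsion-free connection for which a complex structure `J` on a real
plane, with differential `K`, is parallel. -/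
def planeChristoffel (J : V → V) (K : V → V → V) (b a : V) : V :=
  (-(1 / 4 : ℝ)) • (K (J b) a + J (K b a) + (2 : ℝ) • J (K a b))

variable {J : V →ₗ[ℝ] V} {K : V →ₗ[ℝ] V →ₗ[ℝ] V}

/-- This is the equation `D J = 0`, namely `K_a b + Γ(J b, a) - J Γ(b, a) = 0`. It follows from `J²
= -1` and the anticommutation of `K` with `J`. -/
lemma planeChristoffel_apply_left (hsq : ∀ v, J (J v) = -v) (hK : ∀ a v, K a (J v) = -J (K a v))
    (b a : V) : planeChristoffel J (fun a v ↦ K a v) (J b) a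
      = J (planeChristoffel J (fun a v ↦ K a v) b a) - K a b := by
  simp only [planeChristoffel, hsq, hK, map_neg, map_smul, map_add, LinearMap.neg_apply]
  module

/-- Absence of torsion. In dimension two `a` is a combination of `b` and `J b`, and the only
nontrivial case is settled by `hK`: an almost complex structure on a surface has no integrability
obstruction. -/
lemma planeChristoffel_comm (hsq : ∀ v, J (J v) = -v) (hK : ∀ a v, K a (J v) = -J (K a v))
    (hV : Module.finrank ℝ V = 2) (b a : V) :
    planeChristoffel J (fun a v ↦ K a v) b a = planeChristoffel J (fun a v ↦ K a v) a b := by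
  rcases eq_or_ne b 0 with rfl | hb
  · simp [planeChristoffel]
  obtain ⟨s, t, rfl⟩ := exists_eq_smul_add_smul_apply J.isLinear hsq hV hb a
  simp only [planeChristoffel, hsq, hK, map_neg, map_smul, map_add, LinearMap.neg_apply,
    LinearMap.add_apply, LinearMap.smul_apply]
  module

/-- A symmetric bilinear form invariant under a complex structure on a plane is determined up to
a factor. -/
lemma mul_eq_mul_of_invariant (hsq : ∀ v, J (J v) = -v) (hV : Module.finrank ℝ V = 2)
    {g b : V →ₗ[ℝ] V →ₗ[ℝ] ℝ} (hg : ∀ u v, g u v = g v u) (hb : ∀ u v, b u v = b v u)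
    (hgJ : ∀ u v, g (J u) (J v) = g u v) (hbJ : ∀ u v, b (J u) (J v) = b u v) {e : V} (he : e ≠ 0)
    (u v : V) : b u v * g e e = b e e * g u v := by
  obtain ⟨s, t, rfl⟩ := exists_eq_smul_add_smul_apply J.isLinear hsq hV he u
  obtain ⟨s', t', rfl⟩ := exists_eq_smul_add_smul_apply J.isLinear hsq hV he v
  have h1 : ∀ c : V →ₗ[ℝ] V →ₗ[ℝ] ℝ, (∀ u v, c u v = c v u) → (∀ u v, c (J u) (J v) = c u v) →
      c e (J e) = 0 := by
    intro c hc hcJ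
    have h2 := hcJ e (J e)
    rw [hsq, map_neg, hc] at h2
    linarith
  simp only [map_add, map_smul, LinearMap.add_apply, LinearMap.smul_apply, smul_eq_mul, hgJ, hbJ,
    hg (J e) e, hb (J e) e, h1 g hg hgJ, h1 b hb hbJ]
  ring

end ComplexPlane

end

/-! ### The Hermitian metric and the complex connection of an almost complex structure -/

noncomputable section

section HermitianForm

variable {V : Type*} [NormedAddCommGroup V] [InnerProductSpace ℝ V]

/-- The bilinear form `⟪X, Y⟫ + ⟪J X, J Y⟫`. -/
def hermitianForm (J : V →L[ℝ] V) : V →L[ℝ] V →L[ℝ] ℝ :=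
  innerSL ℝ + ((((innerSL ℝ : V →L[ℝ] V →L[ℝ] ℝ).comp J).flip).comp J).flip

lemma hermitianForm_apply (J : V →L[ℝ] V) (u v : V) :
    hermitianForm J u v = inner ℝ u v + inner ℝ (J u) (J v) := rfl

lemma ContDiff.hermitianForm [FiniteDimensional ℝ V] {J : V → V →L[ℝ] V} (hJ : ContDiff ℝ ∞ J) :
    ContDiff ℝ ∞ fun x ↦ hermitianForm (J x) := by
  refine contDiff_clm_apply_iff.2 fun u ↦ contDiff_clm_apply_iff.2 fun v ↦ ?_
  simp only [hermitianForm_apply]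
  exact contDiff_const.add
    ((hJ.clm_apply contDiff_const).inner ℝ (hJ.clm_apply contDiff_const))

lemma isVonNBounded_hermitianForm (J : V →L[ℝ] V) :
    Bornology.IsVonNBounded ℝ {v : V | hermitianForm J v v < 1} := by
  refine (NormedSpace.isVonNBounded_ball ℝ V 1).subset fun v hv ↦ ?_
  have h1 : inner ℝ v v + inner ℝ (J v) (J v) < 1 := hv
  rw [real_inner_self_eq_norm_sq, real_inner_self_eq_norm_sq] at h1
  rw [mem_ball_zero_iff]
  nlinarith [norm_nonneg v, norm_nonneg (J v)]

lemma hermitianForm_comm (J : V →L[ℝ] V) (u v : V) :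
    hermitianForm J u v = hermitianForm J v u := by
  rw [hermitianForm_apply, hermitianForm_apply, real_inner_comm u, real_inner_comm (J u)]

lemma hermitianForm_pos (J : V →L[ℝ] V) {v : V} (hv : v ≠ 0) : 0 < hermitianForm J v v :=
  add_pos_of_pos_of_nonneg (real_inner_self_pos.2 hv) real_inner_self_nonneg

lemma hermitianForm_apply_apply {J : V →L[ℝ] V} (hsq : ∀ v, J (J v) = -v) (u v : V) :
    hermitianForm J (J u) (J v) = hermitianForm J u v := by
  rw [hermitianForm_apply, hermitianForm_apply, hsq, hsq, inner_neg_neg, add_comm]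

lemma hermitianForm_skew {J : V →L[ℝ] V} (hsq : ∀ v, J (J v) = -v) (u v : V) :
    hermitianForm J (J u) v = -hermitianForm J u (J v) := by
  rw [← hermitianForm_apply_apply hsq (J u) v, hsq]
  simp

/-- The difference between a torsion-free connection for which `J` is parallel and the
flat connection. -/
def connectionForm (J : V → V →L[ℝ] V) (x : V) : V →L[ℝ] V →L[ℝ] V :=
  (-(1 / 4 : ℝ)) • ((fderiv ℝ J x).comp (J x) +
    (ContinuousLinearMap.compL ℝ V V V (J x)).comp (fderiv ℝ J x) +
    (2 : ℝ) • (ContinuousLinearMap.compL ℝ V V V (J x)).comp (fderiv ℝ J x).flip)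

variable {J : V → V →L[ℝ] V}

lemma ContDiff.connectionForm [FiniteDimensional ℝ V] (hJ : ContDiff ℝ ∞ J) :
    ContDiff ℝ ∞ (connectionForm J) := by
  have h1 : ContDiff ℝ ∞ (fderiv ℝ J) := hJ.fderiv_right (by simp)
  refine contDiff_clm_apply_iff.2 fun b ↦ contDiff_clm_apply_iff.2 fun a ↦ ?_
  have h2 : ∀ a b : V, ContDiff ℝ ∞ fun x ↦ fderiv ℝ J x a b := fun a b ↦
    (h1.clm_apply contDiff_const).clm_apply contDiff_const
  exact ((((h1.clm_apply (hJ.clm_apply contDiff_const)).clm_apply contDiff_const).add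
    (hJ.clm_apply (h2 b a))).add ((hJ.clm_apply (h2 a b)).const_smul (2 : ℝ))).const_smul _

/-- Differentiate `J² = -1`. -/
lemma fderiv_apply_anticomm (hJ : ContDiff ℝ ∞ J) (hsq : ∀ x v, J x (J x v) = -v) (x a v : V) :
    fderiv ℝ J x a (J x v) = -J x (fderiv ℝ J x a v) := by
  have hd : HasFDerivAt J (fderiv ℝ J x) x := (hJ.differentiable (by simp) x).hasFDerivAt
  have h1 := hd.clm_apply (hd.clm_apply (hasFDerivAt_const v x))
  have h2 : (fun y ↦ J y (J y v)) = fun _ ↦ -v := by ext1 y; exact hsq y v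
  have h3 := congrArg (fun T ↦ T a) (h1.unique (h2 ▸ hasFDerivAt_const (-v) x))
  simp at h3
  exact eq_neg_of_add_eq_zero_right h3

lemma connectionForm_eq (x b a : V) : connectionForm J x b a =
    planeChristoffel (J x : V →ₗ[ℝ] V)
      (fun a v ↦ ((ContinuousLinearMap.coeLM ℝ).comp (fderiv ℝ J x : V →ₗ[ℝ] V →L[ℝ] V)) a v)
      b a := rfl

lemma connectionForm_comm (hJ : ContDiff ℝ ∞ J) (hsq : ∀ x v, J x (J x v) = -v)
    (hV : Module.finrank ℝ V = 2) (x b a : V) :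
    connectionForm J x b a = connectionForm J x a b := by
  rw [connectionForm_eq, connectionForm_eq, planeChristoffel_comm (hsq x)
    (fderiv_apply_anticomm hJ hsq x) hV]

lemma connectionForm_apply (hJ : ContDiff ℝ ∞ J) (hsq : ∀ x v, J x (J x v) = -v) (x b a : V) :
    connectionForm J x (J x b) a = J x (connectionForm J x b a) - fderiv ℝ J x a b := by
  rw [connectionForm_eq, connectionForm_eq]
  exact planeChristoffel_apply_left (J := (J x : V →ₗ[ℝ] V)) (hsq x)
    (fderiv_apply_anticomm hJ hsq x) b a

/-- The covariant derivative of `hermitianForm J`. -/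
lemma exists_fderiv_hermitianForm (hJ : ContDiff ℝ ∞ J) (hsq : ∀ x v, J x (J x v) = -v)
    (hV : Module.finrank ℝ V = 2) (x : V) : ∃ α : V →L[ℝ] ℝ, ∀ X u v : V,
      inner ℝ (fderiv ℝ J x X u) (J x v) + inner ℝ (J x u) (fderiv ℝ J x X v)
        - hermitianForm (J x) (connectionForm J x u X) v
        - hermitianForm (J x) u (connectionForm J x v X) = α X * hermitianForm (J x) u v := by
  have : Nontrivial V := Module.nontrivial_of_finrank_pos (R := ℝ) (by omega)
  obtain ⟨e, he⟩ := exists_ne (0 : V)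
  have hpos := hermitianForm_pos (J x) he
  -- The value of `α` is read off at `u = v = e`. It works for all `u`, `v` because the covariant
  -- derivative of the metric is symmetric and, by `D J = 0`, `J`-invariant, hence proportional to
  -- the metric on a plane.
  refine ⟨(2 / hermitianForm (J x) e e) • ((innerSL ℝ (J x e)).comp ((fderiv ℝ J x).flip e) -
    (hermitianForm (J x) e).comp (connectionForm J x e)), fun X u v ↦ ?_⟩
  let b : V →ₗ[ℝ] V →ₗ[ℝ] ℝ := LinearMap.mk₂ ℝ (fun u v ↦
    inner ℝ (fderiv ℝ J x X u) (J x v) + inner ℝ (J x u) (fderiv ℝ J x X v)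
        - hermitianForm (J x) (connectionForm J x u X) v
        - hermitianForm (J x) u (connectionForm J x v X))
    (fun _ _ _ ↦ by simp only [map_add, add_apply, inner_add_left]; ring)
    (fun _ _ _ ↦ by simp only [map_smul, smul_apply, real_inner_smul_left, smul_eq_mul]; ring)
    (fun _ _ _ ↦ by simp only [map_add, add_apply, inner_add_right]; ring)
    (fun _ _ _ ↦ by simp only [map_smul, smul_apply, real_inner_smul_right, smul_eq_mul]; ring)
  let g : V →ₗ[ℝ] V →ₗ[ℝ] ℝ :=
    (ContinuousLinearMap.coeLM ℝ).comp (hermitianForm (J x) : V →ₗ[ℝ] V →L[ℝ] ℝ)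
  have hb : ∀ u v, b u v = b v u := by
    intro u v
    simp only [b, LinearMap.mk₂_apply]
    rw [hermitianForm_comm _ u, hermitianForm_comm _ _ v, real_inner_comm (fderiv ℝ J x X v),
      real_inner_comm (J x v)]
    ring
  have hbJ : ∀ u v, b (J x u) (J x v) = b u v := by
    intro u v
    simp only [b, LinearMap.mk₂_apply]
    rw [connectionForm_apply hJ hsq, connectionForm_apply hJ hsq,
      fderiv_apply_anticomm hJ hsq, fderiv_apply_anticomm hJ hsq, hsq, hsq]
    simp only [map_sub, sub_apply, hermitianForm_apply_apply (hsq x)]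
    simp only [hermitianForm_apply, hsq, inner_neg_left, inner_neg_right]
    ring
  have h1 := mul_eq_mul_of_invariant (J := (J x : V →ₗ[ℝ] V)) (hsq x) hV (g := g) (b := b)
    (hermitianForm_comm (J x)) hb (hermitianForm_apply_apply (hsq x)) hbJ he u v
  have h2 : b e e = 2 * (inner ℝ (J x e) (fderiv ℝ J x X e) -
      hermitianForm (J x) e (connectionForm J x e X)) := by
    simp only [b, LinearMap.mk₂_apply]
    rw [hermitianForm_comm _ _ e, real_inner_comm (J x e)]
    ring
  have h3 : b u v * hermitianForm (J x) e e = b e e * hermitianForm (J x) u v := h1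
  rw [h2] at h3
  have h4 : b u v = _ := eq_div_of_mul_eq hpos.ne' h3
  refine h4.trans ?_
  simp only [smul_apply, sub_apply, ContinuousLinearMap.comp_apply, innerSL_apply_apply,
    ContinuousLinearMap.flip_apply, smul_eq_mul]
  ring

end HermitianForm

end

/-! ### The plane as a Hermitian surface -/

noncomputable section

section Surface

/-- The real plane, as a manifold. -/
abbrev Plane : Type := EuclideanSpace ℝ (Fin 2)

namespace Plane

variable {J : Plane → Plane →L[ℝ] Plane}

/-- The Hermitian metric `⟪X, Y⟫ + ⟪J X, J Y⟫`. -/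
def metric (hJ : ContDiff ℝ ∞ J) :
    ContMDiffRiemannianMetric (𝓡 2) ∞ (EuclideanSpace ℝ (Fin 2))
      (fun x : Plane ↦ TangentSpace (𝓡 2) x) where
  inner x := hermitianForm (J x)
  symm x v w := hermitianForm_comm (J x) v w
  pos x _ hv := hermitianForm_pos (J x) hv
  isVonNBounded x := isVonNBounded_hermitianForm (J x)
  contMDiff := contMDiff_bilin_flat hJ.hermitianForm

/-- A torsion-free connection for which `J` is parallel. -/
def connection (J : Plane → Plane →L[ℝ] Plane) :
    CovariantDerivative (𝓡 2) (EuclideanSpace ℝ (Fin 2))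
      (fun x : Plane ↦ TangentSpace (𝓡 2) x) where
  toFun σ x := flatD x σ +
    (show TangentSpace (𝓡 2) x →L[ℝ] TangentSpace (𝓡 2) x from connectionForm J x (σ x))
  isCovariantDerivativeOnUniv :=
    (⟨fun h h' _ ↦ flatD_add h h', fun h h' _ ↦ flatD_smul h' h⟩ :
      IsCovariantDerivativeOn (I := 𝓡 2) (EuclideanSpace ℝ (Fin 2))
        (fun (σ : ∀ y : Plane, TangentSpace (𝓡 2) y) x ↦ flatD x σ) Set.univ).add_one_form
      (connectionForm J)

lemma connection_apply (σ : Plane → Plane) (x X : Plane) :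
    connection J σ x X = fderiv ℝ σ x X + connectionForm J x (σ x) X :=
  congrArg (fun T : Plane →L[ℝ] Plane ↦ T X + connectionForm J x (σ x) X) (flatD_flat x σ)

lemma connection_const (v x X : Plane) :
    connection J (fun _ ↦ v) x X = connectionForm J x v X := by
  refine (connection_apply (fun _ ↦ v) x X).trans ?_
  rw [fderiv_const_apply, zero_apply, zero_add]

lemma contDiffAt_of_smoothFieldAt {σ : Plane → Plane} {x : Plane}
    (h : SmoothFieldAt (M := Plane) σ x) : ContDiffAt ℝ ∞ σ x :=
  contMDiffAt_vectorSpace_iff_contDiffAt.1 h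

lemma connection_sub_connection (hJ : ContDiff ℝ ∞ J) (hsq : ∀ x v, J x (J x v) = -v)
    (X Y : Plane → Plane) (x : Plane) :
    (fderiv ℝ Y x (X x) + connectionForm J x (Y x) (X x)) -
      (fderiv ℝ X x (Y x) + connectionForm J x (X x) (Y x)) =
    VectorField.lieBracket ℝ X Y x := by
  rw [connectionForm_comm hJ hsq (by simp) x (Y x), VectorField.lieBracket]
  exact add_sub_add_right_eq_sub ..

/-- The derivatives of `Y` and `Z` cancel, which reduces the Weyl condition to the pointwise one for
the metric. -/
lemma inner_leibniz_sub_connectionForm {Y Z : Plane → Plane} (X x : Plane) :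
    inner ℝ (Y x) (fderiv ℝ Z x X) + inner ℝ (fderiv ℝ Y x X) (Z x) +
      (inner ℝ (J x (Y x)) (J x (fderiv ℝ Z x X) + fderiv ℝ J x X (Z x)) +
        inner ℝ (J x (fderiv ℝ Y x X) + fderiv ℝ J x X (Y x)) (J x (Z x))) -
      hermitianForm (J x) (fderiv ℝ Y x X + connectionForm J x (Y x) X) (Z x) -
      hermitianForm (J x) (Y x) (fderiv ℝ Z x X + connectionForm J x (Z x) X) =
    inner ℝ (fderiv ℝ J x X (Y x)) (J x (Z x)) + inner ℝ (J x (Y x)) (fderiv ℝ J x X (Z x))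
        - hermitianForm (J x) (connectionForm J x (Y x) X) (Z x)
        - hermitianForm (J x) (Y x) (connectionForm J x (Z x) X) := by
  simp only [map_add, add_apply, hermitianForm_apply, inner_add_left, inner_add_right]
  ring

/-- The Weyl structure on the plane determined by a complex structure. -/
def weylSpace (hJ : ContDiff ℝ ∞ J) (hsq : ∀ x v, J x (J x v) = -v) : WeylSpace 2 Plane where
  metric := metric hJ
  D := connection J
  smooth := ⟨⟨fun {σ} hσ x _ ↦ by
    have h1 : ContDiffAt ℝ ∞ σ x := contDiffAt_of_smoothFieldAt
      (hσ.contMDiffAt Filter.univ_mem)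
    have h2 : ContDiffAt ℝ ∞ (fun y ↦ fderiv ℝ σ y + connectionForm J y (σ y)) x :=
      (h1.fderiv_right (by simp)).add (hJ.connectionForm.contDiffAt.clm_apply h1)
    have h3 := smoothEndAt_flat h2
    have h4 : (fun y ↦ fderiv ℝ σ y + connectionForm J y (σ y)) = connection J σ := by
      ext1 y; ext1 v; exact (connection_apply σ y v).symm
    rw [h4] at h3
    exact h3.contMDiffWithinAt⟩⟩
  torsion_eq_zero := by
    refine (connection J).torsion_eq_zero_iff.2 fun {X Y x} hX hY ↦ ?_
    exact (congrArg₂ (· - ·) (connection_apply Y x (X x)) (connection_apply X x (Y x))).trans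
      ((connection_sub_connection hJ hsq X Y x).trans
        (congrFun (VectorField.mlieBracket_eq_lieBracket X Y) x).symm)
  weyl x := by
    obtain ⟨α, hα⟩ := exists_fderiv_hermitianForm hJ hsq (by simp) x
    refine ⟨α, fun Y Z hY hZ X ↦ ?_⟩
    have dY : HasFDerivAt Y (fderiv ℝ Y x) x :=
      ((contDiffAt_of_smoothFieldAt hY).differentiableAt (by simp)).hasFDerivAt
    have dZ : HasFDerivAt Z (fderiv ℝ Z x) x :=
      ((contDiffAt_of_smoothFieldAt hZ).differentiableAt (by simp)).hasFDerivAt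
    have dJ : HasFDerivAt J (fderiv ℝ J x) x := (hJ.differentiable (by simp) x).hasFDerivAt
    have h1 := ((dY.inner ℝ dZ).add ((dJ.clm_apply dY).inner ℝ (dJ.clm_apply dZ)))
    have h2 := congrArg (fun T ↦ T X) h1.hasMFDerivAt.mfderiv
    refine Eq.trans (congrArg₂ (· - ·) (congrArg₂ (· - ·) h2
      (congrArg (fun v ↦ hermitianForm (J x) v (Z x)) (connection_apply Y x X)))
      (congrArg (fun v ↦ hermitianForm (J x) (Y x) v) (connection_apply Z x X)))
      (Eq.trans ?_ (hα X (Y x) (Z x)))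
    exact inner_leibniz_sub_connectionForm (Y := Y) (Z := Z) X x

lemma eq_zero_of_leibniz (hJ : ContDiff ℝ ∞ J) (hsq : ∀ x v, J x (J x v) = -v) {x X v C : Plane}
    (h : fderiv ℝ (fun y ↦ J y v) x X + connectionForm J x (J x v) X =
      C + J x (connectionForm J x v X)) : C = 0 := by
  have dJ : HasFDerivAt J (fderiv ℝ J x) x := (hJ.differentiable (by simp) x).hasFDerivAt
  rw [(dJ.clm_apply (hasFDerivAt_const v x)).fderiv, connectionForm_apply hJ hsq] at h
  simpa using h

variable (hJ : ContDiff ℝ ∞ J) (hsq : ∀ x v, J x (J x v) = -v)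

/-- Tested on constant fields, this is the algebraic relation `connectionForm_apply`. -/
lemma nabla_eq_zero (x : Plane) (X : TangentSpace (𝓡 2) x) :
    (weylSpace hJ hsq).nabla (smoothEndAt_flat hJ.contDiffAt) X = 0 := by
  ext1 v
  have sv : DiffFieldAt (M := Plane) (fun _ ↦ (show Plane from v)) x := SmoothFieldAt.diff
    (contMDiffAt_vectorSpace_iff_contDiffAt.2 contDiffAt_const)
  have h1 := (weylSpace hJ hsq).D_apply (smoothEndAt_flat hJ.contDiffAt) sv X
  have h2 := (connection_apply (J := J) (fun y ↦ J y v) x X).symm.trans h1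
  exact eq_zero_of_leibniz hJ hsq (X := X) (v := v)
    (h2.trans (congrArg (fun u ↦ _ + J x u) (connection_const v x X)))

/-- The plane with the almost complex structure `J`. -/
def hermitianSurface : HermitianSurface where
  N := Plane
  weyl := weylSpace hJ hsq
  J := J
  smooth x := smoothEndAt_flat hJ.contDiffAt
  sq_eq_neg x := by ext1 v; exact hsq x v
  skew x := hermitianForm_skew (hsq x)
  integrable := by
    -- Each term of the integrability criterion contains a covariant derivative of `J`.
    refine (weylSpace hJ hsq).isIntegrableDistribution_of (fun x ↦ smoothEndAt_flat hJ.contDiffAt)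
      (fun x v ↦ congrArg (J x) (hsq x v) |>.trans (map_neg (J x) v)) ?_
    intro x X₁ X₂ Y₁ Y₂ _ _
    simp [nabla_eq_zero]

end Plane
end Surface
end

/-! ### The Hessian of a function in a chart -/

noncomputable section

section Hessian

open FiberBundle

variable {m : ℕ} {M : Type*} [TopologicalSpace M] [ChartedSpace (EuclideanSpace ℝ (Fin m)) M]
  [IsManifold (𝓡 m) ∞ M]

local notation "𝔼" => EuclideanSpace ℝ (Fin m)

/-- The map `f`, expressed in the preferred chart at `x`. -/
def chartRep {N : Type*} (x : M) (f : M → N) (z : EuclideanSpace ℝ (Fin m)) : N :=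
  f ((extChartAt (𝓡 m) x).symm z)

variable {x : M} {G : Type*} [NormedAddCommGroup G] [NormedSpace ℝ G]

omit [IsManifold (𝓡 m) ∞ M] in
lemma eventually_extChartAt_symm {p : M → Prop} (h : ∀ᶠ y in nhds x, p y) :
    ∀ᶠ z in nhds (extChartAt (𝓡 m) x x), p ((extChartAt (𝓡 m) x).symm z) :=
  (continuousAt_extChartAt_symm x).eventually (by rwa [extChartAt_to_inv])

omit [IsManifold (𝓡 m) ∞ M] in
lemma contDiffAt_chartRep {f : M → G} (hf : ContMDiffAt (𝓡 m) 𝓘(ℝ, G) ∞ f x) :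
    ContDiffAt ℝ ∞ (chartRep x f) (extChartAt (𝓡 m) x x) := by
  have h := (contMDiffAt_iff.1 hf).2
  rw [ModelWithCorners.Boundaryless.range_eq_univ, contDiffWithinAt_univ] at h
  exact h

lemma differentiableAt_chartRep {f : M → G} {y : M} (hy : y ∈ (chartAt 𝔼 x).source)
    (hf : MDifferentiableAt (𝓡 m) 𝓘(ℝ, G) f y) :
    DifferentiableAt ℝ (chartRep x f) (extChartAt (𝓡 m) x y) := by
  have hy' : y ∈ (extChartAt (𝓡 m) x).source := by rwa [extChartAt_source]
  have h1 : MDifferentiableAt 𝓘(ℝ, 𝔼) (𝓡 m) (extChartAt (𝓡 m) x).symm (extChartAt (𝓡 m) x y) :=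
    ((contMDiffOn_extChartAt_symm (n := ∞) x).contMDiffAt
      ((isOpen_extChartAt_target x).mem_nhds ((extChartAt (𝓡 m) x).map_source hy'))).mdifferentiableAt
      (by simp)
  rw [← (extChartAt (𝓡 m) x).left_inv hy'] at hf
  exact (hf.comp _ h1).differentiableAt

lemma mvfderiv_eq_fderiv_chartRep {f : M → G} {y : M} (hy : y ∈ (chartAt 𝔼 x).source)
    (hf : MDifferentiableAt (𝓡 m) 𝓘(ℝ, G) f y) (v : TangentSpace (𝓡 m) y) :
    mvfderiv (𝓡 m) f y v = fderiv ℝ (chartRep x f) (extChartAt (𝓡 m) x y)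
      (mfderiv (𝓡 m) 𝓘(ℝ, 𝔼) (extChartAt (𝓡 m) x) y v) := by
  have hy' : y ∈ (extChartAt (𝓡 m) x).source := by rwa [extChartAt_source]
  have h1 := (differentiableAt_chartRep hy hf).mdifferentiableAt
  have h2 : MDifferentiableAt (𝓡 m) 𝓘(ℝ, 𝔼) (extChartAt (𝓡 m) x) y :=
    mdifferentiableAt_extChartAt hy
  have h3 := mfderiv_comp y h1 h2
  rw [mfderiv_eq_fderiv] at h3
  have h4 : chartRep x f ∘ extChartAt (𝓡 m) x =ᶠ[nhds y] f := by
    filter_upwards [(isOpen_extChartAt_source (I := 𝓡 m) x).mem_nhds hy'] with z hz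
    exact congrArg f ((extChartAt (𝓡 m) x).left_inv hz)
  rw [h4.mfderiv_eq] at h3
  exact congrArg (fun T ↦ T v) h3

lemma mvfderiv_eq_fderiv_chartRep_self {f : M → G}
    (hf : MDifferentiableAt (𝓡 m) 𝓘(ℝ, G) f x) (v : TangentSpace (𝓡 m) x) :
    mvfderiv (𝓡 m) f x v = fderiv ℝ (chartRep x f) (extChartAt (𝓡 m) x x) v := by
  rw [mvfderiv_eq_fderiv_chartRep (mem_chart_source _ x) hf]
  exact congrArg _ (congrArg (fun T : 𝔼 →L[ℝ] 𝔼 ↦ T v) (mfderiv_extChartAt_self (I := 𝓡 m)))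

lemma ContDiffAt.eventually_differentiableAt {E F : Type*} [NormedAddCommGroup E]
    [NormedSpace ℝ E] [NormedAddCommGroup F] [NormedSpace ℝ F] {g : E → F} {z : E}
    (h : ContDiffAt ℝ ∞ g z) : ∀ᶠ y in nhds z, DifferentiableAt ℝ g y :=
  ((h.of_le (m := 1) (by simp)).eventually (by simp)).mono fun _ hy ↦
    hy.differentiableAt (by simp)

lemma lieBracket_const {E : Type*} [NormedAddCommGroup E] [NormedSpace ℝ E] (u v z : E) :
    VectorField.lieBracket ℝ (fun _ ↦ u) (fun _ ↦ v) z = 0 := by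
  simp [VectorField.lieBracket]

namespace WeylSpace

variable (w : WeylSpace m M)

/-- The extensions of `u` and `v` are constant in the chart, so they commute; the symmetry is then
the absence of torsion. -/
lemma christoffel_comm (u v : TangentSpace (𝓡 m) x) :
    w.christoffel x u v = w.christoffel x v u := by
  have : IsManifold (𝓡 m) (minSmoothness ℝ 2) M := by
    rw [minSmoothness_of_isRCLikeNormedField]; infer_instance
  have h1 := w.mlieBracket_eq (smoothFieldAt_extend v).diff (smoothFieldAt_extend u).diff
  rw [w.D_extend, w.D_extend, extend_apply_self, extend_apply_self] at h1
  set χ := extChartAt (𝓡 m) x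
  have h2 : ∀ v : TangentSpace (𝓡 m) x, ∀ᶠ y in nhds x, extend 𝔼 v y =
      VectorField.mpullback (𝓡 m) 𝓘(ℝ, 𝔼) χ (fun _ ↦ (show 𝔼 from v)) y := by
    intro v
    filter_upwards [eventually_mem_chart_source (m := m) x] with y hy
    have hy' : y ∈ (extChartAt (𝓡 m) x).source := by rwa [extChartAt_source]
    obtain ⟨e, he⟩ := isInvertible_mfderiv_extChartAt (I := 𝓡 m) hy'
    have h3 := (fieldCoord_eq_mfderiv (extend 𝔼 v) hy).symm.trans (fieldCoord_extend v hy)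
    have h5 : (mfderiv (𝓡 m) 𝓘(ℝ, 𝔼) (extChartAt (𝓡 m) x) y).inverse
        (mfderiv (𝓡 m) 𝓘(ℝ, 𝔼) (extChartAt (𝓡 m) x) y (extend 𝔼 v y)) = extend 𝔼 v y := by
      rw [← he, ContinuousLinearMap.inverse_equiv]
      exact e.symm_apply_apply _
    exact h5.symm.trans (congrArg (mfderiv (𝓡 m) 𝓘(ℝ, 𝔼) (extChartAt (𝓡 m) x) y).inverse h3)
  rw [Filter.EventuallyEq.mlieBracket_vectorField_eq (h2 v) (h2 u), ← VectorField.mpullback_mlieBracket (n := ∞)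
      ((contMDiffAt_vectorSpace_iff_contDiffAt.2 contDiffAt_const).mdifferentiableAt
        (n := ∞) (by simp))
      ((contMDiffAt_vectorSpace_iff_contDiffAt.2 contDiffAt_const).mdifferentiableAt
        (n := ∞) (by simp))
      contMDiffAt_extChartAt
      (by rw [minSmoothness_of_isRCLikeNormedField]; exact ENat.LEInfty.out)] at h1
  have h4 : VectorField.mlieBracket 𝓘(ℝ, 𝔼) (fun _ : 𝔼 ↦ (show 𝔼 from v))
      (fun _ : 𝔼 ↦ (show 𝔼 from u)) (χ x) = 0 :=
    (congrFun (VectorField.mlieBracket_eq_lieBracket _ _) (χ x)).trans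
      (lieBracket_const (show 𝔼 from v) (show 𝔼 from u) (χ x))
  rw [VectorField.mpullback_apply, h4, map_zero] at h1
  exact (sub_eq_zero.1 h1.symm)

/-- The Hessian of a function, at `x`, as a bilinear form. -/
def hessianAt (f : M → ℝ) (x : M) : 𝔼 →L[ℝ] 𝔼 →L[ℝ] ℝ :=
  fderiv ℝ (fderiv ℝ (chartRep x f)) (extChartAt (𝓡 m) x x) -
    (ContinuousLinearMap.compL ℝ 𝔼 𝔼 ℝ (fderiv ℝ (chartRep x f) (extChartAt (𝓡 m) x x))).comp
      (show 𝔼 →L[ℝ] 𝔼 →L[ℝ] 𝔼 from w.christoffel x).flip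

lemma hessianAt_apply (f : M → ℝ) (X Y : TangentSpace (𝓡 m) x) : w.hessianAt f x X Y =
    fderiv ℝ (fderiv ℝ (chartRep x f)) (extChartAt (𝓡 m) x x) X Y -
      fderiv ℝ (chartRep x f) (extChartAt (𝓡 m) x x) (w.christoffel x Y X) := rfl

/-- The derivative of `Y` in the chart appears in both terms of the Hessian and cancels, leaving an
expression in the values at `x`. Algebra on the trace thus takes place in one tangent space. -/
lemma hessian_eq {f : M → ℝ} (hf : ContMDiffAt (𝓡 m) 𝓘(ℝ, ℝ) ∞ f x)
    {Y : ∀ y : M, TangentSpace (𝓡 m) y} (hY : DiffFieldAt Y x)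
    (X : ∀ y : M, TangentSpace (𝓡 m) y) :
    w.hessian f X Y x = w.hessianAt f x (X x) (Y x) := by
  set c := extChartAt (𝓡 m) x x
  have cf := contDiffAt_chartRep hf
  have hf1 : ∀ᶠ y in nhds x, MDifferentiableAt (𝓡 m) 𝓘(ℝ, ℝ) f y :=
    ((contMDiffAt_iff_contMDiffAt_nhds (by simp)).1 (hf.of_le (m := 1) (by simp))).mono fun y hy ↦
      hy.mdifferentiableAt (by simp)
  have dY := differentiableAt_chartRep (mem_chart_source _ x) (mdifferentiableAt_fieldCoord hY)
  set g : M → ℝ := fun y ↦ fderiv ℝ (chartRep x f) (extChartAt (𝓡 m) x y) (fieldCoord x Y y)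
  have e1 : (fun y ↦ mvfderiv (𝓡 m) f y (Y y)) =ᶠ[nhds x] g := by
    filter_upwards [hf1, eventually_mem_chart_source (m := m) x] with y hy hy'
    rw [mvfderiv_eq_fderiv_chartRep hy' hy]
    exact congrArg _ (fieldCoord_eq_mfderiv Y hy').symm
  have d1 : HasFDerivAt (fderiv ℝ (chartRep x f)) (fderiv ℝ (fderiv ℝ (chartRep x f)) c) c :=
    ((cf.fderiv_right (m := ∞) (by simp)).differentiableAt (by simp)).hasFDerivAt
  have d2 := d1.clm_apply dY.hasFDerivAt
  have e2 : chartRep x g =ᶠ[nhds c]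
      fun z ↦ fderiv ℝ (chartRep x f) z (chartRep x (fieldCoord x Y) z) := by
    filter_upwards [extChartAt_target_mem_nhds (I := 𝓡 m) x] with z hz
    exact congrArg (fun u ↦ fderiv ℝ (chartRep x f) u (chartRep x (fieldCoord x Y) z))
      ((extChartAt (𝓡 m) x).right_inv hz)
  have mg : MDifferentiableAt (𝓡 m) 𝓘(ℝ, ℝ) g x := by
    have h3 : MDifferentiableAt 𝓘(ℝ, 𝔼) 𝓘(ℝ, ℝ) (chartRep x g) (extChartAt (𝓡 m) x x) :=
      (d2.congr_of_eventuallyEq e2).differentiableAt.mdifferentiableAt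
    refine (h3.comp x (mdifferentiableAt_extChartAt (mem_chart_source _ x))).congr_of_eventuallyEq ?_
    filter_upwards [extChartAt_source_mem_nhds (I := 𝓡 m) x] with z hz
    exact (congrArg g ((extChartAt (𝓡 m) x).left_inv hz)).symm
  have e4 : flatD x Y (X x) = fderiv ℝ (chartRep x (fieldCoord x Y)) c (X x) :=
    mvfderiv_eq_fderiv_chartRep_self (mdifferentiableAt_fieldCoord hY) _
  have e5 : chartRep x (fieldCoord x Y) c = Y x :=
    (congrArg (fieldCoord x Y) (extChartAt_to_inv x)).trans (fieldCoord_self Y)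
  have e3 : mvfderiv (𝓡 m) (fun y ↦ mvfderiv (𝓡 m) f y (Y y)) x (X x) =
      fderiv ℝ (fderiv ℝ (chartRep x f)) c (X x) (Y x) +
      fderiv ℝ (chartRep x f) c (flatD x Y (X x)) := by
    rw [mvfderiv_congr e1, mvfderiv_eq_fderiv_chartRep_self mg, e2.fderiv_eq, d2.fderiv]
    exact (add_comm ..).trans (congrArg₂ (· + ·) (congrArg _ e5) (congrArg _ e4.symm))
  rw [hessian, e3, hessianAt_apply, w.D_eq_add_christoffel hY, map_add,
    mvfderiv_eq_fderiv_chartRep_self hf1.self_of_nhds, mvfderiv_eq_fderiv_chartRep_self hf1.self_of_nhds]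
  ring

end WeylSpace

end Hessian

end

/-! ### The second fundamental form of a map between Weyl spaces -/

noncomputable section

section Composition

open FiberBundle

variable {m : ℕ} {M : Type*} [TopologicalSpace M] [ChartedSpace (EuclideanSpace ℝ (Fin m)) M]
  [IsManifold (𝓡 m) ∞ M] {n : ℕ} {N : Type*} [TopologicalSpace N]
  [ChartedSpace (EuclideanSpace ℝ (Fin n)) N] [IsManifold (𝓡 n) ∞ N]

local notation "𝔼" => EuclideanSpace ℝ (Fin m)
local notation "𝔽" => EuclideanSpace ℝ (Fin n)

variable (n) in
/-- The map `φ` in the preferred charts at `x` and `φ x`. -/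
def mapRep (x : M) (φ : M → N) : EuclideanSpace ℝ (Fin m) → EuclideanSpace ℝ (Fin n) :=
  chartRep x fun y ↦ extChartAt (𝓡 n) (φ x) (φ y)

variable {φ : M → N} {x : M}

omit [IsManifold (𝓡 m) ∞ M] [IsManifold (𝓡 n) ∞ N] in
lemma mapRep_self :
    mapRep n x φ (extChartAt (𝓡 m) x x) = extChartAt (𝓡 n) (φ x) (φ x) :=
  congrArg (fun y ↦ extChartAt (𝓡 n) (φ x) (φ y)) (extChartAt_to_inv x)

omit [IsManifold (𝓡 m) ∞ M] [IsManifold (𝓡 n) ∞ N] in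
lemma contDiffAt_mapRep (hφ : ContMDiffAt (𝓡 m) (𝓡 n) ∞ φ x) :
    ContDiffAt ℝ ∞ (mapRep n x φ) (extChartAt (𝓡 m) x x) :=
  contDiffAt_chartRep (contMDiffAt_extChartAt.comp x hφ)

lemma fderiv_mapRep {y : M} (hy : y ∈ (chartAt 𝔼 x).source)
    (hφy : φ y ∈ (chartAt 𝔽 (φ x)).source) (hφ : MDifferentiableAt (𝓡 m) (𝓡 n) φ y)
    (v : TangentSpace (𝓡 m) y) :
    fderiv ℝ (mapRep n x φ) (extChartAt (𝓡 m) x y)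
      (mfderiv (𝓡 m) 𝓘(ℝ, 𝔼) (extChartAt (𝓡 m) x) y v) =
    mfderiv (𝓡 n) 𝓘(ℝ, 𝔽) (extChartAt (𝓡 n) (φ x)) (φ y) (mfderiv (𝓡 m) (𝓡 n) φ y v) := by
  have h1 : MDifferentiableAt (𝓡 n) 𝓘(ℝ, 𝔽) (extChartAt (𝓡 n) (φ x)) (φ y) :=
    mdifferentiableAt_extChartAt hφy
  have h2 := mvfderiv_eq_fderiv_chartRep hy (h1.comp y hφ) v
  have h3 := congrArg (fun T ↦ T v) (mfderiv_comp y h1 hφ)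
  exact h2.symm.trans h3

lemma fderiv_mapRep_self (hφ : MDifferentiableAt (𝓡 m) (𝓡 n) φ x) (v : TangentSpace (𝓡 m) x) :
    fderiv ℝ (mapRep n x φ) (extChartAt (𝓡 m) x x) v = mfderiv (𝓡 m) (𝓡 n) φ x v := by
  have h1 := fderiv_mapRep (mem_chart_source _ x) (mem_chart_source _ (φ x)) hφ v
  have h2 : mfderiv (𝓡 m) 𝓘(ℝ, 𝔼) (extChartAt (𝓡 m) x) x v = v :=
    congrArg (fun T : 𝔼 →L[ℝ] 𝔼 ↦ T v) (mfderiv_extChartAt_self (I := 𝓡 m))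
  have h3 : ∀ u : TangentSpace (𝓡 n) (φ x),
      mfderiv (𝓡 n) 𝓘(ℝ, 𝔽) (extChartAt (𝓡 n) (φ x)) (φ x) u = u := fun u ↦
    congrArg (fun T : 𝔽 →L[ℝ] 𝔽 ↦ T u) (mfderiv_extChartAt_self (I := 𝓡 n))
  exact (congrArg (fderiv ℝ (mapRep n x φ) (extChartAt (𝓡 m) x x)) h2).symm.trans (h1.trans (h3 _))

variable (n) in
/-- The second derivative of `φ` in the preferred charts at `x` and `φ x`. -/
def mapD2 (φ : M → N) (x : M) :
    TangentSpace (𝓡 m) x →L[ℝ] TangentSpace (𝓡 m) x →L[ℝ] TangentSpace (𝓡 n) (φ x) :=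
  fderiv ℝ (fderiv ℝ (mapRep n x φ)) (extChartAt (𝓡 m) x x)

namespace WeylSpace

variable (w : WeylSpace m M) (w' : WeylSpace n N)

/-- The second fundamental form `D dφ` of a map between Weyl spaces. -/
def secondForm (φ : M → N) (x : M) (X Y : TangentSpace (𝓡 m) x) : TangentSpace (𝓡 n) (φ x) :=
  mapD2 n φ x X Y - mfderiv (𝓡 m) (𝓡 n) φ x (w.christoffel x Y X) +
    w'.christoffel (φ x) (mfderiv (𝓡 m) (𝓡 n) φ x Y) (mfderiv (𝓡 m) (𝓡 n) φ x X)

/-- Second derivatives are symmetric, and both connections are torsion-free. -/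
lemma secondForm_comm (hφ : ContMDiffAt (𝓡 m) (𝓡 n) ∞ φ x) (X Y : TangentSpace (𝓡 m) x) :
    w.secondForm w' φ x X Y = w.secondForm w' φ x Y X := by
  have h1 : mapD2 n φ x X Y = mapD2 n φ x Y X :=
    ((contDiffAt_mapRep hφ).isSymmSndFDerivAt (by simpa using ENat.LEInfty.out)) X Y
  rw [secondForm, secondForm, w.christoffel_comm X,
    w'.christoffel_comm (mfderiv (𝓡 m) (𝓡 n) φ x X), h1]

/-- The second-order chain rule in charts. The Christoffel term of the target enters the Hessian of
`f` and the second fundamental form with opposite signs. -/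
lemma hessianAt_comp {f : N → ℝ} (hf : ContMDiffAt (𝓡 n) 𝓘(ℝ, ℝ) ∞ f (φ x))
    (hφ : ContMDiffAt (𝓡 m) (𝓡 n) ∞ φ x) (X Y : TangentSpace (𝓡 m) x) :
    w.hessianAt (f ∘ φ) x X Y = w'.hessianAt f (φ x) (mfderiv (𝓡 m) (𝓡 n) φ x X)
      (mfderiv (𝓡 m) (𝓡 n) φ x Y) +
      fderiv ℝ (chartRep (φ x) f) (extChartAt (𝓡 n) (φ x) (φ x)) (w.secondForm w' φ x X Y) := by
  set c := extChartAt (𝓡 m) x x with hc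
  have cf : ContDiffAt ℝ ∞ (chartRep (φ x) f) (mapRep n x φ c) := by
    rw [mapRep_self]; exact contDiffAt_chartRep hf
  have cφ := contDiffAt_mapRep hφ
  have e1 : chartRep x (f ∘ φ) =ᶠ[nhds c] chartRep (φ x) f ∘ mapRep n x φ := by
    filter_upwards [eventually_extChartAt_symm (hφ.continuousAt.eventually
      (extChartAt_source_mem_nhds (I := 𝓡 n) (φ x)))] with z hz
    exact (congrArg f ((extChartAt (𝓡 n) (φ x)).left_inv hz)).symm
  have e2 : fderiv ℝ (chartRep x (f ∘ φ)) =ᶠ[nhds c]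
      fun z ↦ (fderiv ℝ (chartRep (φ x) f) (mapRep n x φ z)).comp (fderiv ℝ (mapRep n x φ) z) := by
    filter_upwards [e1.eventuallyEq_nhds, cφ.eventually_differentiableAt,
      cφ.continuousAt.eventually cf.eventually_differentiableAt] with z h1 h2 h3
    rw [h1.fderiv_eq, fderiv_comp z h3 h2]
  have d1 : HasFDerivAt (fderiv ℝ (mapRep n x φ)) (fderiv ℝ (fderiv ℝ (mapRep n x φ)) c) c :=
    ((cφ.fderiv_right (m := ∞) (by simp)).differentiableAt (by simp)).hasFDerivAt
  have d2 : HasFDerivAt (fderiv ℝ (chartRep (φ x) f))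
      (fderiv ℝ (fderiv ℝ (chartRep (φ x) f)) (mapRep n x φ c)) (mapRep n x φ c) :=
    ((cf.fderiv_right (m := ∞) (by simp)).differentiableAt (by simp)).hasFDerivAt
  have d3 := (d2.comp c (cφ.differentiableAt (by simp)).hasFDerivAt).clm_comp d1
  have a1 : ∀ v, fderiv ℝ (mapRep n x φ) (extChartAt (𝓡 m) x x) v =
      mfderiv (𝓡 m) (𝓡 n) φ x v := fun v ↦ fderiv_mapRep_self (hφ.mdifferentiableAt (by simp)) v
  have e3 : fderiv ℝ (fderiv ℝ (chartRep x (f ∘ φ))) c X Y =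
      fderiv ℝ (fderiv ℝ (chartRep (φ x) f)) (mapRep n x φ c) (fderiv ℝ (mapRep n x φ) c X) (fderiv ℝ (mapRep n x φ) c Y) +
      fderiv ℝ (chartRep (φ x) f) (mapRep n x φ c) (fderiv ℝ (fderiv ℝ (mapRep n x φ)) c X Y) := by
    rw [e2.fderiv_eq]
    refine (congrArg (fun T ↦ T X Y) d3.fderiv).trans ?_
    exact add_comm ..
  have e4 : ∀ v, fderiv ℝ (chartRep x (f ∘ φ)) c v =
      fderiv ℝ (chartRep (φ x) f) (mapRep n x φ c) (fderiv ℝ (mapRep n x φ) c v) := fun v ↦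
    congrArg (fun T ↦ T v) e2.self_of_nhds
  rw [← hc] at a1
  rw [hessianAt_apply, hessianAt_apply, secondForm,
    ← mapRep_self (m := m) (n := n) (φ := φ) (x := x), ← hc]
  set B := fderiv ℝ (fderiv ℝ (chartRep (φ x) f)) (mapRep n x φ c)
  set l := fderiv ℝ (chartRep (φ x) f) (mapRep n x φ c)
  have e5 : ∀ p q r : 𝔽, l (p - q + r) = l p - l q + l r := fun p q r ↦ by
    rw [map_add, map_sub]
  have e6 := congrArg₂ (fun u v : 𝔽 ↦ B u v + l (mapD2 n φ x X Y)) (a1 X) (a1 Y)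
  refine (congrArg₂ (· - ·) (e3.trans e6) ((e4 _).trans (congrArg l (a1 _)))).trans
    (Eq.trans ?_ (congrArg (_ + ·) (e5 ..).symm))
  have e7 : ∀ p q r s : ℝ, p + q - r = p - s + (q - r + s) := fun p q r s ↦ by ring
  exact e7 _ _ _ _

/-- The Leibniz rule for `J ∘ dφ = dφ ∘ F`. -/
lemma apply_secondForm {F : EndField (𝓡 m) M} {J : EndField (𝓡 n) N} (hF : SmoothEndAt F x)
    (hJ : SmoothEndAt J (φ x)) (hφ : ContMDiffAt (𝓡 m) (𝓡 n) ∞ φ x)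
    (h : ∀ᶠ y in nhds x, ∀ v, J (φ y) (mfderiv (𝓡 m) (𝓡 n) φ y v) =
      mfderiv (𝓡 m) (𝓡 n) φ y (F y v)) (X v : TangentSpace (𝓡 m) x) :
    w'.nabla hJ (mfderiv (𝓡 m) (𝓡 n) φ x X) (mfderiv (𝓡 m) (𝓡 n) φ x v) +
      J (φ x) (w.secondForm w' φ x X v) =
    mfderiv (𝓡 m) (𝓡 n) φ x (w.nabla hF X v) + w.secondForm w' φ x X (F x v) := by
  set c := extChartAt (𝓡 m) x x with hc
  have cφ := contDiffAt_mapRep hφ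
  have a1 : ∀ v, fderiv ℝ (mapRep n x φ) (extChartAt (𝓡 m) x x) v =
      mfderiv (𝓡 m) (𝓡 n) φ x v := fun v ↦ fderiv_mapRep_self (hφ.mdifferentiableAt (by simp)) v
  set J' : 𝔽 → 𝔽 →L[ℝ] 𝔽 := chartRep (φ x) (endCoord (m := n) (φ x) J)
  set F' : 𝔼 → 𝔼 →L[ℝ] 𝔼 := chartRep x (endCoord (m := m) x F)
  have hφ1 : ∀ᶠ y in nhds x, MDifferentiableAt (𝓡 m) (𝓡 n) φ y :=
    ((contMDiffAt_iff_contMDiffAt_nhds (by simp)).1 (hφ.of_le (m := 1) (by simp))).mono fun y hy ↦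
      hy.mdifferentiableAt (by simp)
  -- The relation `J ∘ dφ = dφ ∘ F` is first written in the charts, on a neighbourhood, so that it
  -- can be differentiated with the ordinary product rule; the Christoffel terms are restored at the
  -- end.
  have e1 : (fun z ↦ (J' (mapRep n x φ z)).comp (fderiv ℝ (mapRep n x φ) z)) =ᶠ[nhds c]
      fun z ↦ (fderiv ℝ (mapRep n x φ) z).comp (F' z) := by
    filter_upwards [eventually_extChartAt_symm h, eventually_extChartAt_symm hφ1,
      eventually_extChartAt_symm (hφ.continuousAt.eventually (chart_source_mem_nhds 𝔽 (φ x))),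
      extChartAt_target_mem_nhds (I := 𝓡 m) x] with z h1 h2 h3 h4
    set y := (extChartAt (𝓡 m) x).symm z with hy
    have hyz : extChartAt (𝓡 m) x y = z := (extChartAt (𝓡 m) x).right_inv h4
    have hys : y ∈ (extChartAt (𝓡 m) x).source := (extChartAt (𝓡 m) x).map_target h4
    have hys' : y ∈ (chartAt 𝔼 x).source := by rwa [extChartAt_source] at hys
    ext1 u
    obtain ⟨e, he⟩ := isInvertible_mfderiv_extChartAt (I := 𝓡 m) hys
    obtain ⟨u', hu'⟩ := e.surjective u
    have hu : mfderiv (𝓡 m) 𝓘(ℝ, 𝔼) (extChartAt (𝓡 m) x) y u' = u := by rw [← he]; exact hu'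
    have k1 := fun v ↦ fderiv_mapRep hys' h3 h2 v
    rw [hyz] at k1
    have k2 := endCoord_mfderiv F hys' u'
    have k3 := endCoord_mfderiv J h3 (mfderiv (𝓡 m) (𝓡 n) φ y u')
    have k4 : J' (mapRep n x φ z) = endCoord (φ x) J (φ y) :=
      congrArg (endCoord (φ x) J) ((extChartAt (𝓡 n) (φ x)).left_inv (by rwa [extChartAt_source]))
    have k5 : fderiv ℝ (mapRep n x φ) z u = _ :=
      (congrArg (fderiv ℝ (mapRep n x φ) z) hu).symm.trans (k1 u')
    have k6 : F' z u = _ := (congrArg (endCoord x F y) hu).symm.trans k2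
    exact (congrArg₂ (fun (T : 𝔽 →L[ℝ] 𝔽) w ↦ T w) k4 k5).trans (k3.trans
      ((congrArg (mfderiv (𝓡 n) 𝓘(ℝ, 𝔽) (extChartAt (𝓡 n) (φ x)) (φ y)) (h1 u')).trans
        ((k1 _).symm.trans (congrArg (fderiv ℝ (mapRep n x φ) z) k6).symm)))
  have d1 : HasFDerivAt (fderiv ℝ (mapRep n x φ)) (fderiv ℝ (fderiv ℝ (mapRep n x φ)) c) c :=
    ((cφ.fderiv_right (m := ∞) (by simp)).differentiableAt (by simp)).hasFDerivAt
  have dφ : HasFDerivAt (mapRep n x φ) (fderiv ℝ (mapRep n x φ) c) c :=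
    (cφ.differentiableAt (by simp)).hasFDerivAt
  have dF : HasFDerivAt F' (fderiv ℝ F' c) c :=
    ((contDiffAt_chartRep hF.contMDiffAt_endCoord).differentiableAt (by simp)).hasFDerivAt
  have dJ : HasFDerivAt J' (fderiv ℝ J' (mapRep n x φ c)) (mapRep n x φ c) := by
    rw [mapRep_self]
    exact ((contDiffAt_chartRep hJ.contMDiffAt_endCoord).differentiableAt (by simp)).hasFDerivAt
  have k1 := ((dJ.comp c dφ).clm_comp d1).congr_of_eventuallyEq e1.symm |>.unique (d1.clm_comp dF)
  have k2 := congrArg (fun T ↦ T X v) k1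
  have k3 : J (φ x) (mapD2 n φ x X v) +
      endD (φ x) J (mfderiv (𝓡 m) (𝓡 n) φ x X) (mfderiv (𝓡 m) (𝓡 n) φ x v) =
      mfderiv (𝓡 m) (𝓡 n) φ x (endD x F X v) + mapD2 n φ x X (F x v) := by
    have j1 : J' (mapRep n x φ c) = J (φ x) :=
      (congrArg (endCoord (φ x) J) ((congrArg (extChartAt (𝓡 n) (φ x)).symm mapRep_self).trans
        (extChartAt_to_inv (φ x)))).trans (endCoord_self J)
    have j2 : F' c = F x := (congrArg (endCoord x F) (extChartAt_to_inv x)).trans (endCoord_self F)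
    have j3 : endD x F X = fderiv ℝ F' c X :=
      mvfderiv_eq_fderiv_chartRep_self hF.mdifferentiableAt_endCoord X
    have j4 : ∀ Z, endD (φ x) J Z = fderiv ℝ J' (mapRep n x φ c) Z := by
      rw [mapRep_self]
      exact fun Z ↦ mvfderiv_eq_fderiv_chartRep_self hJ.mdifferentiableAt_endCoord Z
    have j5 := congrArg₂ (fun u v : 𝔽 ↦ (fderiv ℝ J' (mapRep n x φ c) u) v) (a1 X) (a1 v)
    have j6 := (congrArg (fun T : 𝔽 →L[ℝ] 𝔽 ↦ T (mfderiv (𝓡 m) (𝓡 n) φ x v)) (j4 (mfderiv (𝓡 m) (𝓡 n) φ x X))).trans j5.symm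
    refine (congrArg₂ (fun (T : 𝔽 →L[ℝ] 𝔽) (u : 𝔽) ↦ T (mapD2 n φ x X v) + u) j1.symm j6).trans
      (k2.trans ?_)
    refine congrArg₂ (fun u v : 𝔽 ↦ u + v) ?_ ?_
    · exact (a1 _).trans (congrArg (fun T : 𝔼 →L[ℝ] 𝔼 ↦ mfderiv (𝓡 m) (𝓡 n) φ x (T v)) j3.symm)
    · exact congrArg (fun T : 𝔼 →L[ℝ] 𝔼 ↦ mapD2 n φ x X (T v)) j2
  have k4 := h.self_of_nhds (w.christoffel x v X)
  rw [w.nabla_eq, w'.nabla_eq, secondForm, secondForm, h.self_of_nhds]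
  simp only [map_add, map_sub, k4]
  linear_combination (norm := module) k3

end WeylSpace

end Composition

end

/-! ### Expansion in an orthonormal frame -/

noncomputable section

section OrthonormalFrame

variable {V : Type*} [AddCommGroup V] [Module ℝ V] [TopologicalSpace V]

lemma eq_sum_of_orthonormal [FiniteDimensional ℝ V] {g : V →L[ℝ] V →L[ℝ] ℝ} {m : ℕ}
    (hV : Module.finrank ℝ V = m)
    {e : Fin m → V} (he : ∀ i j, g (e i) (e j) = if i = j then 1 else 0) (v : V) :
    v = ∑ j, g (e j) v • e j := by
  have h1 : ∀ (c : Fin m → ℝ) i, g (e i) (∑ j, c j • e j) = c i := by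
    intro c i
    simp only [map_sum, map_smul, he, smul_eq_mul, mul_ite, mul_one, mul_zero, Finset.sum_ite_eq,
      Finset.mem_univ, if_true]
  have hli : LinearIndependent ℝ e := by
    rw [Fintype.linearIndependent_iff]
    intro c hc i
    rw [← h1 c i, hc, map_zero]
  have hs := hli.span_eq_top_of_card_eq_finrank' (by simp [hV])
  have h2 : v ∈ Submodule.span ℝ (Set.range e) := hs ▸ Submodule.mem_top
  obtain ⟨c, rfl⟩ := (Submodule.mem_span_range_iff_exists_fun ℝ).1 h2
  simp only [h1]

/-- A continuous bilinear form, as a bilinear form. -/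
def ContinuousLinearMap.toBilin {E : Type*} [NormedAddCommGroup E] [NormedSpace ℝ E]
    (B : E →L[ℝ] E →L[ℝ] ℝ) : E →ₗ[ℝ] E →ₗ[ℝ] ℝ :=
  (ContinuousLinearMap.coeLM ℝ).comp B.toLinearMap

end OrthonormalFrame

/-! ### Harmonicity of the submersion and geodesy of its fibres -/

section HarmonicMorphism

open FiberBundle

variable {m : ℕ} {M : Type*} [TopologicalSpace M] [ChartedSpace (EuclideanSpace ℝ (Fin m)) M]
  [IsManifold (𝓡 m) ∞ M] {w : WeylSpace m M}

namespace WeylSpace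

/-- On a surface, the Hessian of a harmonic function is anti-invariant. -/
lemma hessianAt_add_hessianAt {N : Type*} [TopologicalSpace N]
    [ChartedSpace (EuclideanSpace ℝ (Fin 2)) N] [IsManifold (𝓡 2) ∞ N] {w : WeylSpace 2 N}
    {f : N → ℝ} {U : Set N} (hU : IsOpen U) (hf : w.IsHarmonicOn f U) {y : N} (hy : y ∈ U)
    {J : TangentSpace (𝓡 2) y →L[ℝ] TangentSpace (𝓡 2) y} (hsq : ∀ v, J (J v) = -v)
    (hskew : w.IsSkew J) (u : TangentSpace (𝓡 2) y) :
    w.hessianAt f y u u + w.hessianAt f y (J u) (J u) = 0 := by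
  rcases eq_or_ne u 0 with rfl | hu
  · rw [map_zero]
    have : w.hessianAt f y 0 0 = 0 := by rw [map_zero]
    exact (congrArg₂ (· + ·) this this).trans (add_zero 0)
  have hpos := w.metric.pos y u hu
  -- Skewness and `J² = -1` make `u` and `J u` orthogonal of equal length, so normalizing by `s`
  -- gives an orthonormal frame in which the trace can be computed.
  set s := (Real.sqrt (w.metric.inner y u u))⁻¹ with hs
  have hss : s * s * w.metric.inner y u u = 1 := by
    rw [hs, ← mul_inv, Real.mul_self_sqrt hpos.le, inv_mul_cancel₀ hpos.ne']
  have hs0 : s * s ≠ 0 := fun h ↦ by simp [h] at hss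
  set e : Fin 2 → TangentSpace (𝓡 2) y := ![s • u, s • J u]
  have huJ : w.metric.inner y u (J u) = 0 := by
    have h1 := hskew u u
    rw [w.metric.symm] at h1
    linarith
  have h1 := hf.2 y hy (fun i ↦ extend (EuclideanSpace ℝ (Fin 2)) (e i))
    (fun i ↦ smoothFieldAt_extend (e i)) (fun i j ↦ by
      simp only [extend_apply_self]
      have hJJ : w.metric.inner y (J u) (J u) = w.metric.inner y u u := by
        have := hskew u (J u)
        rw [hsq] at this
        simpa using this
      have hJu : w.metric.inner y (J u) u = 0 := by rw [w.metric.symm, huJ]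
      fin_cases i <;> fin_cases j <;>
        simp [e, huJ, hJu, hJJ, ← mul_assoc, hss])
  have hf' : ContMDiffAt (𝓡 2) 𝓘(ℝ, ℝ) ∞ f y := hf.1.contMDiffAt (hU.mem_nhds hy)
  simp only [w.hessian_eq hf' (smoothFieldAt_extend _).diff, extend_apply_self, Fin.sum_univ_two] at h1
  have h2 : ∀ v : TangentSpace (𝓡 2) y, w.hessianAt f y (s • v) (s • v) = s * s * w.hessianAt f y v v := by
    intro v
    have h3 : ∀ (B : EuclideanSpace ℝ (Fin 2) →L[ℝ] EuclideanSpace ℝ (Fin 2) →L[ℝ] ℝ) (v),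
        B (s • v) (s • v) = s * s * B v v := fun B v ↦ by
      simp [mul_assoc]
    exact h3 _ v
  have h4 : w.hessianAt f y (s • u) (s • u) + w.hessianAt f y (s • J u) (s • J u) = 0 := h1
  rw [h2, h2, ← mul_add] at h4
  exact (mul_eq_zero.1 h4).resolve_left hs0

/-- The trace splits along `F`. On the kernel both `dφ` and `τ = D dφ` vanish. On the image, `τ` is
complex linear in its second argument and symmetric, so `τ(v, v) + τ(Fv, Fv) = 0`; the Hessian of a
harmonic `f` has the same property with respect to `J`. `IsRankTwoF.sum_eq_zero` concludes. -/
theorem SectionQ.isHarmonicMorphismOn (p : w.SectionQ 1) (hp : w.IsHolomorphicStructure p.smooth)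
    {S : HermitianSurface} (hS : ∀ y X, S.weyl.nabla (S.smooth y) X = 0)
    {W : Set M} (hW : IsOpen W) {φ : M → S.N} (hφ : ContMDiffOn (𝓡 m) (𝓡 2) ∞ φ W)
    (hker : ∀ x ∈ W, ∀ v, mfderiv (𝓡 m) (𝓡 2) φ x v = 0 ↔ p.F x v = 0)
    (hJ : ∀ x ∈ W, ∀ v, S.J (φ x) (mfderiv (𝓡 m) (𝓡 2) φ x v) =
      mfderiv (𝓡 m) (𝓡 2) φ x (p.F x v)) :
    w.IsHarmonicMorphismOn S.weyl φ W := by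
  intro V hV f hf
  refine ⟨hf.1.comp (hφ.mono Set.inter_subset_left) fun x hx ↦ hx.2, ?_⟩
  rintro x ⟨hxW, hxV⟩ e he horth
  have hφx : ContMDiffAt (𝓡 m) (𝓡 2) ∞ φ x := hφ.contMDiffAt (hW.mem_nhds hxW)
  have hfx : ContMDiffAt (𝓡 2) 𝓘(ℝ, ℝ) ∞ f (φ x) := hf.1.contMDiffAt (hV.mem_nhds hxV)
  have hsq : ∀ v, S.J (φ x) (S.J (φ x) v) = -v := fun v ↦
    congrArg (fun T ↦ T v) (S.sq_eq_neg (φ x))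
  set τ := w.secondForm S.weyl φ x
  -- The differentiated relation `J ∘ dφ = dφ ∘ F`, in which the term with `D J` vanishes by `hS`.
  have hτ : ∀ X v, S.J (φ x) (τ X v) =
      mfderiv (𝓡 m) (𝓡 2) φ x (w.nabla (p.smooth x) X v) + τ X (p.F x v) := by
    intro X v
    have h1 := w.apply_secondForm S.weyl (p.smooth x) (S.smooth (φ x)) hφx
      (Filter.eventually_of_mem (hW.mem_nhds hxW) hJ) X v
    rwa [hS, LinearMap.zero_apply, zero_add] at h1
  have hcomp := w.hessianAt_comp S.weyl hfx hφx
  have hsum : ∀ i, w.hessian (f ∘ φ) (e i) (e i) x = w.hessianAt (f ∘ φ) x (e i x) (e i x) :=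
    fun i ↦ w.hessian_eq (hfx.comp x hφx) (SmoothFieldAt.diff (he i)) _
  rw [Finset.sum_congr rfl fun i _ ↦ hsum i]
  refine (p.isRankTwoF x).sum_eq_zero (fun i ↦ e i x)
    (eq_sum_of_orthonormal (finrank_euclideanSpace_fin (n := m)) horth)
    (w.hessianAt (f ∘ φ) x).toBilin ?_ ?_
  · intro v (hv : p.F x v = 0)
    have h1 : mfderiv (𝓡 m) (𝓡 2) φ x v = 0 := (hker x hxW v).2 hv
    have h2 : τ v v = 0 := by
      have h3 := hτ v v
      rw [p.nabla_eq_zero hp hv, LinearMap.zero_apply, map_zero, zero_add, hv] at h3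
      have h4 : τ v 0 = 0 := by simp [τ, secondForm]
      rw [← neg_eq_zero, ← hsq, h3, h4, map_zero]
    refine (hcomp v v).trans ((congrArg₂ (· + ·)
      (congrArg (fun u : EuclideanSpace ℝ (Fin 2) ↦ S.weyl.hessianAt f (φ x) u u) h1)
      (congrArg _ h2)).trans ?_)
    exact (congrArg₂ (· + ·) (map_zero _) (map_zero _)).trans (add_zero 0)
  · intro v (hv : p.F x (p.F x v) = -v)
    have h1 : ∀ X u, p.F x (p.F x u) = -u → τ X (p.F x u) = S.J (φ x) (τ X u) := by
      intro X u hu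
      rw [hτ, (hker x hxW _).2 ((p.isRankTwoF x).apply_variation (p.isVariation x X) hu), zero_add]
    have hτs : ∀ X Y, τ X Y = τ Y X := w.secondForm_comm S.weyl hφx
    have h2 : τ v v + τ (p.F x v) (p.F x v) = 0 := by
      rw [h1 _ v hv, hτs (p.F x v) v, h1 _ v hv, hsq, add_neg_cancel]
    have h3 := hessianAt_add_hessianAt hV hf hxV hsq (S.skew (φ x))
      (mfderiv (𝓡 m) (𝓡 2) φ x v)
    rw [hJ x hxW] at h3
    refine (congrArg₂ (· + ·) (hcomp v v) (hcomp (p.F x v) (p.F x v))).trans ?_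
    rw [add_add_add_comm, h3, zero_add]
    exact (map_add _ _ _).symm.trans ((congrArg _ h2).trans (map_zero _))

/-- For `X`, `Y` tangent to the fibres, `-F (D_X Y) = (D_X F) Y = 0`. -/
lemma SectionQ.hasGeodesicFibresOn (p : w.SectionQ 1) (hp : w.IsHolomorphicStructure p.smooth)
    {N : Type*} [TopologicalSpace N] [ChartedSpace (EuclideanSpace ℝ (Fin 2)) N]
    {W : Set M} {φ : M → N}
    (hker : ∀ x ∈ W, ∀ v, mfderiv (𝓡 m) (𝓡 2) φ x v = 0 ↔ p.F x v = 0) :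
    w.HasGeodesicFibresOn (n := 2) φ W := by
  intro U hUW hU X Y hX hY hXk hYk x hx
  have hYx : SmoothFieldAt Y x := hY.contMDiffAt (hU.mem_nhds hx)
  have h1 := w.nabla_apply_ker (p.smooth x) hYx.diff
    (Filter.eventually_of_mem (hU.mem_nhds hx) fun y hy ↦ (hker y (hUW hy) _).1 (hYk y hy)) (X x)
  rw [p.nabla_eq_zero hp ((hker x (hUW hx) _).1 (hXk x hx)), LinearMap.zero_apply] at h1
  exact (hker x (hUW hx) _).2 (neg_eq_zero.1 h1.symm)

end WeylSpace

end HarmonicMorphism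

end

/-! ### Assembly of the local harmonic morphisms, and the theorem -/

noncomputable section

section LocalSubmersion

variable {m : ℕ} {M : Type*} [TopologicalSpace M] [ChartedSpace (EuclideanSpace ℝ (Fin m)) M]
  [IsManifold (𝓡 m) ∞ M] {w : WeylSpace m M}

omit [IsManifold (𝓡 m) ∞ M] in
lemma isHolomorphicOn_of_apply_mfderiv_eq {n : ℕ} {N : Type*} [TopologicalSpace N]
    [ChartedSpace (EuclideanSpace ℝ (Fin n)) N] {F : EndField (𝓡 m) M} {J : EndField (𝓡 n) N}
    (hF : ∀ x v, F x (F x (F x v)) = -F x v) (hJ : ∀ y v, J y (J y (J y v)) = -J y v)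
    {φ : M → N} {W : Set M}
    (h : ∀ x ∈ W, ∀ v, J (φ x) (mfderiv (𝓡 m) (𝓡 n) φ x v) = mfderiv (𝓡 m) (𝓡 n) φ x (F x v)) :
    IsHolomorphicOn (𝓡 m) (𝓡 n) φ (associatedDistribution (𝓡 m) F)
      (associatedDistribution (𝓡 n) J) W := by
  intro x hx Z hZ
  obtain ⟨X, Y, rfl⟩ := exists_eq_complexVector Z
  have h1 : F x Y = F x (F x X) := (complexVector_mem_sup_complexEigenspace (hF x)).1 hZ
  rw [baseChange_complexVector]
  refine (complexVector_mem_sup_complexEigenspace (hJ (φ x))).2 ?_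
  simp only [ContinuousLinearMap.coe_coe]
  rw [h x hx, h x hx, h x hx, h1]

lemma WeylSpace.SectionQ.isLocallyDefinedByHarmonicMorphisms (p : w.SectionQ 1)
    (hp : w.IsHolomorphicStructure p.smooth) : w.IsLocallyDefinedByHarmonicMorphisms p.F := by
  intro x
  obtain ⟨v₀, hv₀, hv⟩ := exists_ne_zero_apply_apply_eq_neg (p.mem_Q x).2.2
  obtain ⟨W, φ, J, hW, hxW, hφ, hφW, hJ, hsq, h⟩ :=
    exists_submersion_of_isIntegrableDistribution p.smooth p.cube (p.isIntegrable hp) hv₀ hv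
      fun w hw ↦ (p.isRankTwoF x).rank v₀ w hv₀ hv hw
  refine ⟨W, Plane.hermitianSurface hJ hsq, φ, hW, hxW,
    ⟨hφ, hφW, fun x hx ↦ (h x hx).1, fun x hx ↦ (h x hx).2.1, ?_⟩,
    p.isHarmonicMorphismOn hp (S := Plane.hermitianSurface hJ hsq) (Plane.nabla_eq_zero hJ hsq) hW
      hφ (fun x hx ↦ (h x hx).2.1) fun x hx ↦ (h x hx).2.2,
    p.hasGeodesicFibresOn hp fun x hx ↦ (h x hx).2.1⟩
  exact isHolomorphicOn_of_apply_mfderiv_eq p.cube (fun y v ↦ hsq y (J y v))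
    fun x hx ↦ (h x hx).2.2

end LocalSubmersion

end

theorem corollary5p8 {m : ℕ} (hm : 3 ≤ m)
    {M : Type*} [TopologicalSpace M] [T2Space M] [SecondCountableTopology M]
    [ChartedSpace (EuclideanSpace ℝ (Fin m)) M] [IsManifold (𝓡 m) ∞ M]
    (w : WeylSpace m M) (p : w.SectionQ 1) :
    IsHolomorphicOn (𝓡 m) (endModel m) p.toMap (associatedDistribution (𝓡 m) p.F)
        w.twistorDistribution Set.univ ↔
      IsIntegrableDistribution (𝓡 m) (associatedDistribution (𝓡 m) p.F) ∧
        w.IsLocallyDefinedByHarmonicMorphisms p.F := by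
  rw [p.isHolomorphicOn_iff]
  exact ⟨fun hp ↦ ⟨p.isIntegrable hp, p.isLocallyDefinedByHarmonicMorphisms hp⟩,
    fun h ↦ p.isHolomorphicStructure_of_isLocallyDefined h.1 h.2⟩
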